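/- **Setting.** Let $d\ge 1$, $s_0>\frac d2+2$ and $0<c_0\le 1$. Write $B_r=\{|x|<r\}\subset\mathbb R^d$. Fix a smooth inhomogeneous Littlewood–Paley decomposition $1=\sum_{j\ge 0}S_j$, for each $j\geq 0$ the partition $\mathcal Q_j$ of $\mathbb R^d$ into cubes of side length $2^j$, and smooth, compactly supported partitions of unity $1=\sum_{Q\in\mathcal Q_j}\chi_Q$ obtained by scaling and translating one bump function. For functions on $[0,T]\times\mathbb R^d$ let $$\|u\|_X=\sup_{l\ge 0}\sup_{Q\in\mathcal Q_l}2^{-l/2}\|u\|_{L^2([0,T]\times Q)},\qquad \|u\|_{X_j}=\max\big(2^{j/2}\|u\|_X,\ \|u\|_{L^\infty([0,T];L^2)}\big),$$ $$\|u\|_{\ell^1X^s}^2=\sum_{j\ge0}2^{2js}\Big(\sum_{Q\in\mathcal Q_j}\|\chi_Q S_ju\|_{X_j}\Big)^2,$$ and let $\|u\|_{\ell^1X^s(B_R^c)}$ be the infimum of $\|v\|_{\ell^1X^s}$ over all extensions $v$ of $u|_{\{|x|\ge R\}}$. Let $g=(g^{ij}(t,x))$ be a real symmetric matrix function on $[0,T]\times\mathbb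 R^d$, of class $C^2$ in $x$, with $c_0|\xi|^2\le g^{ij}\xi_i\xi_j\le c_0^{-1}|\xi|^2$. Put $$a(t,x,\xi)=g^{ij}(t,x)\xi_i\xi_j,\qquad H_a=\sum_{j=1}^d\big(\partial_{\xi_j}a\,\partial_{x_j}-\partial_{x_j}a\,\partial_{\xi_j}\big).$$ A geodesic at a fixed time $t$ is a complete solution $s\mapsto(x^s,\xi^s)$ of the projected Hamilton flow $$\dot x=a_\xi,\qquad \dot\xi=-a_x+(a_x\cdot\xi)\,\xi,\qquad |\xi|=1 .$$ Assume, for parameters $M\ge1$, $R$, $L$: * $\|g-I_d\|_{\ell^1X^{s_0}}+\|\partial_tg\|_{\ell^1X^{s_0-2}}\le M$; * $\|g-I_d\|_{\ell^1X^{s_0}(B_R^c)}\le\varepsilon$; * for every fixed $t\in[0,T]$, no geodesic is trapped, that is, $|x^s|\to\infty$ as $s\to\pm\infty$ along every geodesic, and for every geodesic the Euclidean length of its part inside $B_{2R}$, $\int_{\{|x^s|<2R\}}|\dot x^s|\,ds$, is at most $L$; * $R\ge R_0$, $\ \kappa\log M\le\log R$, $\ R\le L$. **Proposition.** There are constants $\varepsilon,\kappa,R_0>0$,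 which depend only on $d,s_0,c_0$ and on the fixed decompositions, such that the following holds. For every $C>0$ there are constants $C_1$ and $C_{j,k,l}$ $(j,k,l\ge0)$, which depend only on these data and on $C$, such that for all $T>0$, $M,R,L$ and $g$ as above there is a real function $q(t,x,\xi)$, smooth for $\xi\ne0$, nonnegative, and homogeneous of degree $0$ in $\xi$, with the following properties in the region $t\in[0,T]$, $|x|\le100R$, $\xi\neq 0$. 1. (Support) $\operatorname{supp}q\cap\{|x|>50R\}\subset\{\cos\theta<-\frac12\}$, where $\cos\theta=\frac{x\cdot\xi}{|x||\xi|}$. 2. (Size) For all $j$ and all multi-indices $\alpha,\beta$ with $|\alpha|=k$, $|\beta|=l$, $\ |\partial_t^j\partial_x^\alpha\partial_\xi^\beta q|\le e^{C_{j,k,l}ML}|\xi|^{-l}$. In particular $q\in S^0$ there. 3. (Positive commutator) $-H_aq\ge CM|\xi|\,q$, and moreover $-H_aq\ge|\xi|$ if $|x|<2R$. 4. (Bounded gradient) $|\xi|\,\big(|q_x|+|\xi||q_\xi|\big)\le e^{C_1ML}\,(-H_aq)$. -/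

import Mathlib

open MeasureTheory Set Filter Topology
open scoped ENNReal FourierTransform ContDiff

noncomputable section

/-- The Euclidean space `ℝ^d`. -/
abbrev Eu (d : ℕ) : Type := EuclideanSpace ℝ (Fin d)

/-! ### The local energy spaces `ℓ¹ X^s` on `[0,T] × ℝ^d` -/

/-- The point of `ℝ^d` with integer coordinates `m`. -/
def latticePt {d : ℕ} (m : Fin d → ℤ) : Eu d := WithLp.toLp 2 fun i => (m i : ℝ)

/-- The data that fix one of the (equivalent) versions of the norms: a smooth low frequency cutoff
`φ`, which generates an inhomogeneous Littlewood-Paley decomposition, and a smooth compactly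
supported `χ ≥ 0` whose integer translates form a partition of unity. -/
structure LPData (d : ℕ) where
  φ : Eu d → ℝ
  φ_smooth : ContDiff ℝ ∞ φ
  φ_nonneg : ∀ η, 0 ≤ φ η
  φ_le_one : ∀ η, φ η ≤ 1
  φ_low : ∀ η, ‖η‖ ≤ 1 → φ η = 1
  φ_high : ∀ η, 2 ≤ ‖η‖ → φ η = 0
  χ : Eu d → ℝ
  χ_smooth : ContDiff ℝ ∞ χ
  χ_nonneg : ∀ x, 0 ≤ χ x
  χ_compact : HasCompactSupport χ
  χ_partition : ∀ x, HasSum (fun m : Fin d → ℤ => χ (x - latticePt m)) 1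

namespace LPData

variable {d : ℕ} (P : LPData d)

/-- The Fourier symbol of the Littlewood-Paley projection `S_j`. -/
def symbol (j : ℕ) (η : Eu d) : ℝ :=
  if j = 0 then P.φ η
  else P.φ (((2 : ℝ) ^ j)⁻¹ • η) - P.φ (((2 : ℝ) ^ (j - 1))⁻¹ • η)

/-- The convolution kernel of `S_j`. -/
def kernel (j : ℕ) : Eu d → ℂ := 𝓕⁻ (fun η : Eu d => (P.symbol j η : ℂ))

/-- `S_j f`, the part of `f` at frequency about `2^j` (frequency `≲ 1` for `j = 0`). -/
def proj (j : ℕ) (f : Eu d → ℝ) (x : Eu d) : ℂ :=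
  ∫ y, P.kernel j y * ((f (x - y) : ℝ) : ℂ)

/-- The cutoff `χ_Q` that belongs to the `m`-th cube `Q` of side length `2^j`. -/
def cubeCutoff (j : ℕ) (m : Fin d → ℤ) (x : Eu d) : ℝ :=
  P.χ (((2 : ℝ) ^ j)⁻¹ • x - latticePt m)

end LPData

/-- The `m`-th cube of the partition `𝒬_l` of `ℝ^d` into cubes of side length `2^l`. -/
def dyadicCube {d : ℕ} (l : ℕ) (m : Fin d → ℤ) : Set (Eu d) :=
  {x | ∀ i, (2 : ℝ) ^ l * m i ≤ x i ∧ x i < (2 : ℝ) ^ l * (m i + 1)}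

/-- `‖u‖_X = sup_l sup_{Q ∈ 𝒬_l} 2^{-l/2} ‖u‖_{L²([0,T] × Q)}`. -/
def normX {d : ℕ} (T : ℝ) (u : ℝ → Eu d → ℂ) : ℝ≥0∞ :=
  ⨆ (l : ℕ) (m : Fin d → ℤ), (2 : ℝ≥0∞) ^ (-(l : ℝ) / 2) *
    (∫⁻ t in Icc 0 T, ∫⁻ x in dyadicCube l m, ‖u t x‖ₑ ^ (2 : ℝ)) ^ (1 / 2 : ℝ)

/-- The norm of `L^∞([0,T]; L²)`, for functions that are defined at every time. -/
def normLinfL2 {d : ℕ} (T : ℝ) (u : ℝ → Eu d → ℂ) : ℝ≥0∞ :=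
  ⨆ t ∈ Icc 0 T, eLpNorm (u t) 2 volume

/-- The norm of `X_j = 2^{-j/2} X ∩ L^∞ L²`. -/
def normXj {d : ℕ} (T : ℝ) (j : ℕ) (u : ℝ → Eu d → ℂ) : ℝ≥0∞ :=
  max ((2 : ℝ≥0∞) ^ ((j : ℝ) / 2) * normX T u) (normLinfL2 T u)

/-- `‖u‖_{ℓ¹X^s} = (∑_j 2^{2js} ‖S_j u‖²_{ℓ¹_j X_j})^{1/2}`, where
`‖v‖_{ℓ¹_j X_j} = ∑_{Q ∈ 𝒬_j} ‖χ_Q v‖_{X_j}`. -/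
def normL1X {d : ℕ} (P : LPData d) (T s : ℝ) (u : ℝ → Eu d → ℝ) : ℝ≥0∞ :=
  (∑' j : ℕ, ((2 : ℝ≥0∞) ^ ((j : ℝ) * s) *
    ∑' m : Fin d → ℤ,
      normXj T j (fun t x => (P.cubeCutoff j m x : ℂ) * P.proj j (u t) x)) ^ (2 : ℝ)) ^ (1 / 2 : ℝ)

/-- A matrix valued function of `(t,x)`. -/
abbrev MatField (d : ℕ) : Type := ℝ → Eu d → Matrix (Fin d) (Fin d) ℝ

/-- The `ℓ¹X^s` norm of a matrix field, as the sum over the entries. -/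
def matNormL1X {d : ℕ} (P : LPData d) (T s : ℝ) (h : MatField d) : ℝ≥0∞ :=
  ∑ i, ∑ k, normL1X P T s (fun t x => h t x i k)

/-- All entries of the matrix field are in `L²(ℝ^d)` at every time in `[0,T]`. -/
def InL2 {d : ℕ} (T : ℝ) (h : MatField d) : Prop :=
  ∀ t ∈ Icc 0 T, ∀ i k, MemLp (fun x => h t x i k) 2 volume

/-- The norm of the restriction space `ℓ¹X^s(B_R^c)`: the infimum of the norms of all extensions. -/
def matNormL1XExt {d : ℕ} (P : LPData d) (T s R : ℝ) (h : MatField d) : ℝ≥0∞ :=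
  ⨅ (v : MatField d) (_ : InL2 T v)
    (_ : ∀ t ∈ Icc 0 T, ∀ x : Eu d, R ≤ ‖x‖ → v t x = h t x), matNormL1X P T s v

/-- `h'` is the time derivative of `h` on `[0,T]`, in the integrated sense. -/
def HasTimeDeriv {d : ℕ} (T : ℝ) (h h' : MatField d) : Prop :=
  ∀ i k, Measurable (fun p : ℝ × Eu d => h' p.1 p.2 i k) ∧
    ∀ᵐ x : Eu d, ∀ r ∈ Icc 0 T, ∀ t ∈ Icc 0 T,
      IntervalIntegrable (fun τ => h' τ x i k) volume r t ∧
        h t x i k - h r x i k = ∫ τ in r..t, h' τ x i k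

/-! ### The Hamilton flow -/

/-- The principal symbol `a(x,ξ) = g^{ij}(x) ξ_i ξ_j` at a fixed time. -/
def princSymbol {d : ℕ} (g : Eu d → Matrix (Fin d) (Fin d) ℝ) (x ξ : Eu d) : ℝ :=
  ∑ i, ∑ k, g x i k * ξ i * ξ k

/-- The gradient in `x` of a function of `(x,ξ)`. -/
def gradX {d : ℕ} (p : Eu d → Eu d → ℝ) (x ξ : Eu d) : Eu d := gradient (fun y => p y ξ) x

/-- The gradient in `ξ` of a function of `(x,ξ)`. -/
def gradXi {d : ℕ} (p : Eu d → Eu d → ℝ) (x ξ : Eu d) : Eu d := gradient (fun η => p x η) ξ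

/-- `H_a q = ∑_j (∂_{ξ_j} a ∂_{x_j} q - ∂_{x_j} a ∂_{ξ_j} q)`. -/
def hamVF {d : ℕ} (a q : Eu d → Eu d → ℝ) (x ξ : Eu d) : ℝ :=
  inner ℝ (gradXi a x ξ) (gradX q x ξ) - inner ℝ (gradX a x ξ) (gradXi q x ξ)

/-- A complete integral curve `s ↦ (x^s, ξ^s)` of the Hamilton flow of `a`, projected onto the
cosphere bundle `|ξ| = 1`. -/
structure IsCosphereGeodesic {d : ℕ} (a : Eu d → Eu d → ℝ) (x ξ : ℝ → Eu d) : Prop where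
  unit : ∀ s, ‖ξ s‖ = 1
  deriv_x : ∀ s, HasDerivAt x (gradXi a (x s) (ξ s)) s
  deriv_xi : ∀ s, HasDerivAt ξ
    (-gradX a (x s) (ξ s) + (inner ℝ (gradX a (x s) (ξ s)) (ξ s) : ℝ) • ξ s) s

/-- The Euclidean length of the part of a curve inside the ball of radius `r`. -/
def lengthInBall {d : ℕ} (r : ℝ) (x : ℝ → Eu d) : ℝ≥0∞ :=
  ∫⁻ s in {s | ‖x s‖ < r}, ‖deriv x s‖ₑ

/-- No geodesic is trapped: all escape to spatial infinity at both ends. -/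
def IsNontrapping {d : ℕ} (a : Eu d → Eu d → ℝ) : Prop :=
  ∀ x ξ : ℝ → Eu d, IsCosphereGeodesic a x ξ →
    Tendsto (fun s => ‖x s‖) atTop atTop ∧ Tendsto (fun s => ‖x s‖) atBot atTop

/-! ### Assumptions on the metric -/

/-- `g` is a uniformly elliptic metric on `[0,T] × ℝ^d`, of class `C²` in `x`, of size `M`, small
outside `B_R`, and nontrapping at every fixed time with geodesics of length at most `L` in `B_{2R}`.
Here `gt` is the time derivative of `g`. -/
structure IsAdmissibleMetric {d : ℕ} (P : LPData d) (s₀ c₀ ε T M R L : ℝ) (g gt : MatField d) :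
    Prop where
  symm : ∀ t ∈ Icc 0 T, ∀ x, (g t x).IsSymm
  elliptic_lower : ∀ t ∈ Icc 0 T, ∀ x ξ : Eu d, c₀ * ‖ξ‖ ^ 2 ≤ princSymbol (g t) x ξ
  elliptic_upper : ∀ t ∈ Icc 0 T, ∀ x ξ : Eu d, princSymbol (g t) x ξ ≤ c₀⁻¹ * ‖ξ‖ ^ 2
  smooth : ∀ t ∈ Icc 0 T, ∀ i k, ContDiff ℝ 2 (fun x => g t x i k)
  timeDeriv : HasTimeDeriv T g gt
  memL2 : InL2 T (fun t x => g t x - 1)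
  memL2_deriv : InL2 T gt
  size : matNormL1X P T s₀ (fun t x => g t x - 1) + matNormL1X P T (s₀ - 2) gt ≤ ENNReal.ofReal M
  small : matNormL1XExt P T s₀ R (fun t x => g t x - 1) ≤ ENNReal.ofReal ε
  nontrapping : ∀ t ∈ Icc 0 T, IsNontrapping (princSymbol (g t))
  length_le : ∀ t ∈ Icc 0 T, ∀ x ξ : ℝ → Eu d, IsCosphereGeodesic (princSymbol (g t)) x ξ →
    lengthInBall (2 * R) x ≤ ENNReal.ofReal L

/-- `∂_t^j ∂_x^k ∂_ξ^l q` at `(t,x,ξ)`: the collection of all mixed partial derivatives of order `j`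
in `t`, `k` in `x` and `l` in `ξ`, as a multilinear map. -/
def mixedDeriv {d : ℕ} (j k l : ℕ) (q : ℝ → Eu d → Eu d → ℝ) (t : ℝ) (x ξ : Eu d) :
    ContinuousMultilinearMap ℝ (fun _ : Fin k => Eu d)
      (ContinuousMultilinearMap ℝ (fun _ : Fin l => Eu d) ℝ) :=
  iteratedDeriv j
    (fun τ => iteratedFDeriv ℝ k (fun y => iteratedFDeriv ℝ l (fun η => q τ y η) ξ) x) t

end

noncomputable section

section LittlewoodPaley

open scoped SchwartzMap Convolution

/-! ### Littlewood-Paley kernels as Schwartz functions -/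

/-! At a fixed time let `Φ` be the projected flow and `V` its field. The escape function is ψ(z) =
∫_{-τ}^0 f(Φ_s z) ds, where the density f is at least 1 for |x| ≤ 199R and vanishes for |x| ≥ 200R.
Its derivative along the flow is f(z) - f(Φ_{-τ} z). Two visits of a geodesic to the ball of radius
300R are at most 600R + L/(2c₀) apart (`IsSphereCurve.sub_le_of_norm_le`): the length bound controls
the time in B_{2R}, and outside it geodesics are almost straight. Hence for larger τ the second term
vanishes when |x| ≤ 101R, and ψ grows at rate at least 1 (`HamiltonBounds.exists_isEscapeFunction`).

The symbol is q = G(τ + 3 - ψ) at (x, ξ/|ξ|), with G(u) = e^{Ku} times a smooth step that vanishes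
for u ≤ 0. Since G' ≥ KG, -H_a q = |ξ| G' Vψ dominates K|ξ|q, and K is chosen proportional to M. The
gradient of q carries the same factor G', which gives the last property. For the support property f
is enlarged by τ + 4 on the outgoing region |x| ≥ 11R. A geodesic that ends in B_{2R} has never met
that region, because outgoing points do not return; so ψ ≤ τ there. At outgoing points near 50R one
unit of past time already gives ψ ≥ τ + 4, and q = 0.

Two consequences of the norm bounds enter (`exists_entryBounds`, `exists_time_lipschitz`). Globally,
g is of class C^{1,1} in x with constants O(M), so Φ_s has Lipschitz constant e^{O(M|s|)}. Outside
B_R, g - I is small, and so is the integral of |∂_x g| along any curve with |γ(s) - γ(s')| ≥ |s -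
s'|: such a curve crosses a cube of side 2^j in time O(2^j). A bootstrap then keeps ξ almost
constant (`IsSphereCurve.norm_xi_sub_le`).

The functions ψ are only Lipschitz in (x,ξ), and no regularity in time is known. They are frozen on
a fine time grid and mollified in all variables (`exists_isSmoothEscape`). The growth of ψ is
formulated through increments, which survive averaging. As g is Lipschitz and ∂_x g is 1/2-Hölder in
time, a scale polynomial in the Lipschitz constant costs at most half of the rate. With τ ~ L all
constants are exponential in ML. -/

theorem SchwartzMap.exists_one_add_pow_mul_norm_le {E F : Type*} [NormedAddCommGroup E]
    [NormedSpace ℝ E] [NormedAddCommGroup F] [NormedSpace ℝ F] (f : 𝓢(E, F)) (N : ℕ) :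
    ∃ C : ℝ, 0 ≤ C ∧ ∀ x, (1 + ‖x‖) ^ N * ‖f x‖ ≤ C := by
  refine ⟨2 ^ N * ((Finset.Iic (N, 0)).sup fun m => SchwartzMap.seminorm ℝ m.1 m.2) f,
    by positivity, fun x => ?_⟩
  simpa using SchwartzMap.one_add_le_sup_seminorm_apply (𝕜 := ℝ) (m := (N, 0)) (k := N) (n := 0)
    le_rfl le_rfl f x

namespace LPData

variable {d : ℕ} (P : LPData d)

theorem hasCompactSupport_lowSymbol (J : ℕ) :
    HasCompactSupport (fun η : Eu d => (P.φ (((2 : ℝ) ^ J)⁻¹ • η) : ℂ)) := by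
  apply HasCompactSupport.intro (isCompact_closedBall (0 : Eu d) (2 * 2 ^ J))
  intro η hη
  have h : 2 * 2 ^ J < ‖η‖ := by simpa using hη
  rw [P.φ_high, Complex.ofReal_zero]
  rw [norm_smul, norm_inv, norm_pow, Real.norm_ofNat, inv_mul_eq_div, le_div_iff₀ (by positivity)]
  exact h.le

theorem contDiff_lowSymbol (J : ℕ) :
    ContDiff ℝ ∞ (fun η : Eu d => (P.φ (((2 : ℝ) ^ J)⁻¹ • η) : ℂ)) :=
  Complex.ofRealCLM.contDiff.comp (P.φ_smooth.comp (contDiff_const_smul _))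

/-- The symbol `φ(2^{-J} η)`. -/
def lowSymbol (J : ℕ) : 𝓢(Eu d, ℂ) :=
  (P.hasCompactSupport_lowSymbol J).toSchwartzMap (P.contDiff_lowSymbol J)

theorem lowSymbol_apply (J : ℕ) (η : Eu d) :
    P.lowSymbol J η = (P.φ (((2 : ℝ) ^ J)⁻¹ • η) : ℂ) := rfl

/-- The kernel of the low frequency projection with symbol `φ(2^{-J} η)`. -/
def lowKernel (J : ℕ) : 𝓢(Eu d, ℂ) := 𝓕⁻ (P.lowSymbol J)

/-- The symbol of `S_j` as a Schwartz function. -/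
def bandSymbol : ℕ → 𝓢(Eu d, ℂ)
  | 0 => P.lowSymbol 0
  | j + 1 => P.lowSymbol (j + 1) - P.lowSymbol j

/-- The kernel of `S_j` as a Schwartz function. -/
def bandKernel (j : ℕ) : 𝓢(Eu d, ℂ) := 𝓕⁻ (P.bandSymbol j)

theorem bandSymbol_apply (j : ℕ) (η : Eu d) : P.bandSymbol j η = (P.symbol j η : ℂ) := by
  cases j with
  | zero => simp [bandSymbol, lowSymbol_apply, symbol]
  | succ j => simp [bandSymbol, lowSymbol_apply, symbol]

theorem coe_bandKernel (j : ℕ) : (P.bandKernel j : Eu d → ℂ) = P.kernel j := by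
  rw [bandKernel, SchwartzMap.fourierInv_coe, kernel]
  congr 1
  funext η
  exact P.bandSymbol_apply j η

theorem bandKernel_succ (j : ℕ) :
    P.bandKernel (j + 1) = P.lowKernel (j + 1) - P.lowKernel j := by
  simp only [bandKernel, lowKernel, bandSymbol]
  exact (FourierTransform.fourierInvCLM ℂ 𝓢(Eu d, ℂ)).map_sub _ _

theorem sum_bandKernel (J : ℕ) :
    ∑ j ∈ Finset.range (J + 1), P.bandKernel j = P.lowKernel J := by
  induction J with
  | zero =>
    rw [zero_add, Finset.sum_range_one]
    rfl
  | succ J ih => rw [Finset.sum_range_succ, ih, bandKernel_succ, add_sub_cancel]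

theorem lowKernel_apply (J : ℕ) (y : Eu d) :
    P.lowKernel J y = ((2 : ℝ) ^ J) ^ d * P.lowKernel 0 ((2 : ℝ) ^ J • y) := by
  simp only [lowKernel, SchwartzMap.fourierInv_coe, Real.fourierInv_eq]
  have h := Measure.integral_comp_inv_smul (volume : Measure (Eu d))
    (fun v => Real.fourierChar (inner ℝ v ((2 : ℝ) ^ J • y)) • P.lowSymbol 0 v) ((2 : ℝ) ^ J)
  rw [finrank_euclideanSpace_fin, abs_of_pos (by positivity)] at h
  rw [Complex.real_smul] at h
  push_cast at h ⊢
  rw [← h]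
  congr 1
  funext v
  have h2 : ((2 : ℝ) ^ J) ≠ 0 := by positivity
  rw [real_inner_smul_left, real_inner_smul_right, inv_mul_cancel_left₀ h2]
  simp [lowSymbol_apply]

theorem bandSymbol_eq_zero (j : ℕ) (η : Eu d) (h : 2 ^ (j + 1) ≤ ‖η‖) : P.bandSymbol j η = 0 := by
  have key : ∀ i ≤ j, P.lowSymbol i η = 0 := by
    intro i hi
    rw [lowSymbol_apply, P.φ_high, Complex.ofReal_zero]
    rw [norm_smul, norm_inv, norm_pow, Real.norm_ofNat, inv_mul_eq_div, le_div_iff₀ (by positivity)]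
    refine le_trans ?_ h
    rw [pow_succ']
    gcongr
    norm_num
  cases j with
  | zero => exact key 0 le_rfl
  | succ j =>
    rw [bandSymbol, _root_.sub_apply, key _ le_rfl, key _ (Nat.le_succ j), sub_zero]

theorem lowSymbol_mul_bandSymbol (j : ℕ) (η : Eu d) :
    P.lowSymbol (j + 1) η * P.bandSymbol j η = P.bandSymbol j η := by
  by_cases h : 2 ^ (j + 1) ≤ ‖η‖
  · rw [P.bandSymbol_eq_zero j η h, mul_zero]
  · rw [lowSymbol_apply, P.φ_low, Complex.ofReal_one, one_mul]
    rw [norm_smul, norm_inv, norm_pow, Real.norm_ofNat, inv_mul_eq_div, div_le_one (by positivity)]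
    exact (not_le.1 h).le

/-- The symbol φ(2^{-j-1}η) is one wherever the symbol of S_j is nonzero. By this reproducing
formula derivatives of S_j v fall on a Schwartz kernel, while S_j v itself, which the norms control,
stays under the integral. -/
theorem lowKernel_convolution_bandKernel (j : ℕ) :
    (P.lowKernel (j + 1) : Eu d → ℂ) ⋆[ContinuousLinearMap.mul ℂ ℂ] (P.bandKernel j : Eu d → ℂ)
      = P.bandKernel j := by
  funext x
  rw [← SchwartzMap.convolution_apply]
  congr 1
  have h : 𝓕 (SchwartzMap.convolution (ContinuousLinearMap.mul ℂ ℂ) (P.lowKernel (j + 1))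
      (P.bandKernel j)) = P.bandSymbol j := by
    rw [SchwartzMap.fourier_convolution]
    ext η
    rw [SchwartzMap.pairing_apply_apply]
    simp only [lowKernel, bandKernel, FourierTransform.fourier_fourierInv_eq]
    exact P.lowSymbol_mul_bandSymbol j η
  have h2 := congrArg (FourierTransformInv.fourierInv (F := 𝓢(Eu d, ℂ))) h
  rwa [FourierTransform.fourierInv_fourier_eq] at h2

theorem integral_lowKernel (J : ℕ) : ∫ y, P.lowKernel J y = 1 := by
  have h : 𝓕 (P.lowKernel J) = P.lowSymbol J := by
    simp only [lowKernel, FourierTransform.fourier_fourierInv_eq]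
  have h0 := congrArg (fun f : 𝓢(Eu d, ℂ) => f 0) h
  simp only [SchwartzMap.fourier_coe, Real.fourier_eq, lowSymbol_apply] at h0
  simpa [P.φ_low] using h0

end LPData

/-! ### Convolution of square integrable functions -/

section L2Convolution

variable {d : ℕ}

theorem MeasureTheory.MemLp.comp_sub_left_eu {F : Type*} [NormedAddCommGroup F] {v : Eu d → F}
    (hv : MemLp v 2 volume) (x : Eu d) : MemLp (fun y => v (x - y)) 2 volume :=
  hv.comp_measurePreserving (Measure.measurePreserving_sub_left volume x)

theorem integrable_mul_comp_sub {f v : Eu d → ℂ} (hf : MemLp f 2 volume) (hv : MemLp v 2 volume)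
    (x : Eu d) : Integrable (fun y => f y * v (x - y)) :=
  hf.integrable_mul (hv.comp_sub_left_eu x)

theorem integral_norm_mul_comp_sub_le {f v : Eu d → ℂ} (hf : MemLp f 2 volume)
    (hv : MemLp v 2 volume) (x : Eu d) :
    ∫ y, ‖f y‖ * ‖v (x - y)‖ ≤
      (∫ y, ‖f y‖ ^ (2 : ℝ)) ^ (1 / 2 : ℝ) * (∫ y, ‖v y‖ ^ (2 : ℝ)) ^ (1 / 2 : ℝ) := by
  have h := integral_mul_norm_le_Lp_mul_Lq (μ := (volume : Measure (Eu d))) (f := f)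
    (g := fun y => v (x - y)) (p := 2) (q := 2) (Real.HolderConjugate.two_two)
    (by simpa using hf) (by simpa using hv.comp_sub_left_eu x)
  rwa [integral_sub_left_eq_self (fun y => ‖v y‖ ^ (2 : ℝ)) volume x] at h

theorem norm_convolution_le_of_memLp_two {f v : Eu d → ℂ} (hf : MemLp f 2 volume)
    (hv : MemLp v 2 volume) (x : Eu d) :
    ‖(f ⋆[ContinuousLinearMap.mul ℂ ℂ] v) x‖ ≤
      (∫ y, ‖f y‖ ^ (2 : ℝ)) ^ (1 / 2 : ℝ) * (∫ y, ‖v y‖ ^ (2 : ℝ)) ^ (1 / 2 : ℝ) := by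
  refine le_trans (norm_integral_le_integral_norm _) ?_
  simp only [ContinuousLinearMap.mul_apply', norm_mul]
  exact integral_norm_mul_comp_sub_le hf hv x

theorem aestronglyMeasurable_convolution {F G H : Type*} [NormedAddCommGroup F] [NormedSpace ℝ F]
    [NormedAddCommGroup G] [NormedSpace ℝ G] [NormedAddCommGroup H] [NormedSpace ℝ H]
    (B : F →L[ℝ] G →L[ℝ] H) {f : Eu d → F} {v : Eu d → G}
    (hf : AEStronglyMeasurable f volume) (hv : AEStronglyMeasurable v volume) :
    AEStronglyMeasurable (f ⋆[B] v) volume :=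
  (hf.convolution_integrand B hv).integral_prod_right'

theorem aestronglyMeasurable_convolution_mul {f v : Eu d → ℂ}
    (hf : AEStronglyMeasurable f volume) (hv : AEStronglyMeasurable v volume) :
    AEStronglyMeasurable (f ⋆[ContinuousLinearMap.mul ℂ ℂ] v) volume :=
  (hf.convolution_integrand (ContinuousLinearMap.mul ℂ ℂ) hv).integral_prod_right'

theorem convolution_mul_assoc_of_memLp_two (f g : 𝓢(Eu d, ℂ)) {v : Eu d → ℂ}
    (hv : MemLp v 2 volume) :
    ((f : Eu d → ℂ) ⋆[ContinuousLinearMap.mul ℂ ℂ] (g : Eu d → ℂ)) ⋆[ContinuousLinearMap.mul ℂ ℂ] v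
      = (f : Eu d → ℂ) ⋆[ContinuousLinearMap.mul ℂ ℂ]
        ((g : Eu d → ℂ) ⋆[ContinuousLinearMap.mul ℂ ℂ] v) := by
  funext x
  have hg := g.memLp 2 volume
  have hf := f.memLp 2 volume
  refine convolution_assoc _ _ _ _ (fun a b c => by simp [mul_assoc])
    f.continuous.aestronglyMeasurable g.continuous.aestronglyMeasurable hv.1
    (ae_of_all _ fun y => integrable_mul_comp_sub hf hg y)
    (ae_of_all _ fun y => ?_) ?_
  · exact (integrable_mul_comp_sub hg hv y).norm.congr (ae_of_all _ fun t => by simp)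
  · have hb : ∀ y, ‖((fun x => ‖g x‖) ⋆[ContinuousLinearMap.mul ℝ ℝ] fun x => ‖v x‖) y‖ ≤
        (∫ y, ‖g y‖ ^ (2 : ℝ)) ^ (1 / 2 : ℝ) * (∫ y, ‖v y‖ ^ (2 : ℝ)) ^ (1 / 2 : ℝ) := by
      intro y
      refine le_trans (norm_integral_le_integral_norm _) ?_
      simpa using integral_norm_mul_comp_sub_le hg hv y
    have hm : AEStronglyMeasurable ((fun x => ‖g x‖) ⋆[ContinuousLinearMap.mul ℝ ℝ]
        fun x => ‖v x‖) volume :=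
      aestronglyMeasurable_convolution _ g.continuous.norm.aestronglyMeasurable hv.1.norm
    refine (f.integrable.norm.bdd_mul (f := fun y => ((fun x => ‖g x‖) ⋆[ContinuousLinearMap.mul ℝ ℝ]
      fun x => ‖v x‖) (x - y)) (hm.comp_measurePreserving
        (Measure.measurePreserving_sub_left volume x)) (ae_of_all _ fun y => hb (x - y))).congr
      (ae_of_all _ fun t => ?_)
    simp [mul_comm]

theorem hasFDerivAt_integral_smul_schwartz {F : Type*} [NormedAddCommGroup F] [NormedSpace ℝ F]
    [NormedSpace ℂ F] [SMulCommClass ℝ ℂ F] [CompleteSpace F] (κ : 𝓢(Eu d, F)) {w : Eu d → ℂ}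
    (hw : AEStronglyMeasurable w volume) {B : ℝ} (hB : ∀ y, ‖w y‖ ≤ B) (x : Eu d) :
    HasFDerivAt (fun x => ∫ y, w y • κ (x - y))
      (∫ y, w y • SchwartzMap.fderivCLM ℝ (Eu d) F κ (x - y)) x := by
  set κ' := SchwartzMap.fderivCLM ℝ (Eu d) F κ with hκ'
  have hB0 : 0 ≤ B := (norm_nonneg _).trans (hB 0)
  obtain ⟨C, hC0, hC⟩ := κ'.exists_one_add_pow_mul_norm_le (d + 1)
  have hint : ∀ (G : Type _) [NormedAddCommGroup G] [NormedSpace ℝ G] [NormedSpace ℂ G]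
      (k : 𝓢(Eu d, G)) (x : Eu d), Integrable (fun y => w y • k (x - y)) := by
    intro G _ _ _ k x
    exact (k.integrable.comp_sub_left x).bdd_smul B hw (ae_of_all _ hB)
  have hd : Integrable (fun y : Eu d => B * (C * 2 ^ (d + 1)) * (1 + ‖x - y‖) ^ (-((d + 1 : ℕ) : ℝ))) := by
    refine Integrable.const_mul ?_ _
    refine Integrable.comp_sub_left
      (f := fun y : Eu d => (1 + ‖y‖) ^ (-((d + 1 : ℕ) : ℝ))) ?_ x
    exact integrable_one_add_norm (by simp)
  refine hasFDerivAt_integral_of_dominated_of_fderiv_le (𝕜 := ℝ)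
    (F' := fun z y => w y • κ' (z - y)) (Metric.ball_mem_nhds x one_pos)
    (Eventually.of_forall fun z => (hint F κ z).1) (hint F κ x) (hint _ κ' x).1
    (bound := fun y => B * (C * 2 ^ (d + 1)) * (1 + ‖x - y‖) ^ (-((d + 1 : ℕ) : ℝ)))
    (ae_of_all _ fun y z hz => ?_) hd (ae_of_all _ fun y z hz => ?_)
  · rw [norm_smul, mul_assoc]
    refine mul_le_mul (hB y) ?_ (norm_nonneg _) hB0
    rw [Real.rpow_neg (by positivity), Real.rpow_natCast, ← div_eq_mul_inv,
      le_div_iff₀ (by positivity), mul_comm]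
    -- On the unit ball about x the weights 1 + |z - y| and 1 + |x - y| are comparable, so the
    -- majorant does not depend on z.
    have h1 : 1 + ‖x - y‖ ≤ 2 * (1 + ‖z - y‖) := by
      have h2 : ‖x - y‖ ≤ ‖z - y‖ + ‖z - x‖ := by
        rw [norm_sub_rev z x]
        calc ‖x - y‖ = ‖(z - y) + (x - z)‖ := by congr 1; abel
          _ ≤ _ := norm_add_le _ _
      have h3 : ‖z - x‖ < 1 := by simpa [dist_eq_norm] using hz
      have := norm_nonneg (z - y)
      linarith
    calc (1 + ‖x - y‖) ^ (d + 1) * ‖κ' (z - y)‖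
        ≤ (2 * (1 + ‖z - y‖)) ^ (d + 1) * ‖κ' (z - y)‖ := by gcongr
      _ = ((1 + ‖z - y‖) ^ (d + 1) * ‖κ' (z - y)‖) * 2 ^ (d + 1) := by rw [mul_pow]; ring
      _ ≤ C * 2 ^ (d + 1) := by gcongr; exact hC _
  · have h1 : HasFDerivAt (fun z => κ (z - y)) (κ' (z - y)) z := by
      have h2 : HasFDerivAt κ (κ' (z - y)) (z - y) := by
        simpa [hκ', SchwartzMap.fderivCLM_apply] using κ.differentiableAt.hasFDerivAt
      have h3 := h2.comp z ((hasFDerivAt_id z).sub_const y)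
      rwa [ContinuousLinearMap.comp_id] at h3
    exact h1.const_smul (w y)

end L2Convolution

/-! ### Reproducing formula and Littlewood-Paley reconstruction -/

namespace LPData

variable {d : ℕ} (P : LPData d)

theorem proj_eq_convolution (j : ℕ) (v : Eu d → ℝ) :
    P.proj j v = (P.bandKernel j : Eu d → ℂ) ⋆[ContinuousLinearMap.mul ℂ ℂ] fun x => (v x : ℂ) := by
  funext x
  rw [coe_bandKernel]
  rfl

theorem aestronglyMeasurable_proj (j : ℕ) {v : Eu d → ℝ} (hv : MemLp v 2 volume) :
    AEStronglyMeasurable (P.proj j v) volume := by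
  rw [proj_eq_convolution]
  exact aestronglyMeasurable_convolution_mul (P.bandKernel j).continuous.aestronglyMeasurable
    hv.ofReal.1

theorem exists_norm_proj_le (j : ℕ) {v : Eu d → ℝ} (hv : MemLp v 2 volume) :
    ∃ B, ∀ x, ‖P.proj j v x‖ ≤ B := by
  rw [proj_eq_convolution]
  exact ⟨_, norm_convolution_le_of_memLp_two ((P.bandKernel j).memLp 2 volume) hv.ofReal⟩

theorem proj_eq_integral_lowKernel (j : ℕ) {v : Eu d → ℝ} (hv : MemLp v 2 volume) (x : Eu d) :
    P.proj j v x = ∫ y, P.proj j v y • P.lowKernel (j + 1) (x - y) := by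
  have h := convolution_mul_assoc_of_memLp_two (P.lowKernel (j + 1)) (P.bandKernel j)
    (v := fun x => (v x : ℂ)) hv.ofReal
  rw [lowKernel_convolution_bandKernel, ← proj_eq_convolution] at h
  have hx := congrFun h x
  rw [convolution] at hx
  rw [hx, ← integral_sub_left_eq_self _ volume x]
  simp [mul_comm]

/-- The derivative of `S_j v`. -/
def projD (j : ℕ) (v : Eu d → ℝ) (x : Eu d) : Eu d →L[ℝ] ℂ :=
  ∫ y, P.proj j v y • SchwartzMap.fderivCLM ℝ (Eu d) ℂ (P.lowKernel (j + 1)) (x - y)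

/-- The second derivative of `S_j v`. -/
def projDD (j : ℕ) (v : Eu d → ℝ) (x : Eu d) : Eu d →L[ℝ] Eu d →L[ℝ] ℂ :=
  ∫ y, P.proj j v y • SchwartzMap.fderivCLM ℝ (Eu d) (Eu d →L[ℝ] ℂ)
    (SchwartzMap.fderivCLM ℝ (Eu d) ℂ (P.lowKernel (j + 1))) (x - y)

theorem hasFDerivAt_proj (j : ℕ) {v : Eu d → ℝ} (hv : MemLp v 2 volume) (x : Eu d) :
    HasFDerivAt (P.proj j v) (P.projD j v x) x := by
  obtain ⟨B, hB⟩ := P.exists_norm_proj_le j hv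
  have h := hasFDerivAt_integral_smul_schwartz (P.lowKernel (j + 1))
    (P.aestronglyMeasurable_proj j hv) hB x
  rwa [← funext (P.proj_eq_integral_lowKernel j hv)] at h

theorem hasFDerivAt_projD (j : ℕ) {v : Eu d → ℝ} (hv : MemLp v 2 volume) (x : Eu d) :
    HasFDerivAt (P.projD j v) (P.projDD j v x) x := by
  obtain ⟨B, hB⟩ := P.exists_norm_proj_le j hv
  exact hasFDerivAt_integral_smul_schwartz
    (SchwartzMap.fderivCLM ℝ (Eu d) ℂ (P.lowKernel (j + 1))) (P.aestronglyMeasurable_proj j hv) hB x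

theorem sum_proj (J : ℕ) {v : Eu d → ℝ} (hv : MemLp v 2 volume) (x : Eu d) :
    ∑ j ∈ Finset.range (J + 1), P.proj j v x =
      ((P.lowKernel J : Eu d → ℂ) ⋆[ContinuousLinearMap.mul ℂ ℂ] fun x => (v x : ℂ)) x := by
  simp only [proj_eq_convolution, convolution, ContinuousLinearMap.mul_apply']
  refine (integral_finsetSum _ fun j _ => integrable_mul_comp_sub (v := fun x => (v x : ℂ))
    ((P.bandKernel j).memLp 2 volume) hv.ofReal x).symm.trans ?_
  congr 1
  funext y
  rw [← Finset.sum_mul, ← P.sum_bandKernel J]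
  simp

/-- Fubini and the dilation y ↦ 2^{-J}y move the dependence on J from the kernel into the argument
of the correlation of h and v. In this form dominated convergence applies as J → ∞. -/
theorem integral_mul_lowKernel_convolution (J : ℕ) {v : Eu d → ℂ} (hv : MemLp v 2 volume)
    {h : Eu d → ℂ} (hh : MemLp h 2 volume) :
    ∫ x, h x * ((P.lowKernel J : Eu d → ℂ) ⋆[ContinuousLinearMap.mul ℂ ℂ] v) x =
      ∫ y, P.lowKernel 0 y * ∫ x, h x * v (x - ((2 : ℝ) ^ J)⁻¹ • y) := by
  have hvr : MemLp (fun y => v (-y)) 2 volume := by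
    simpa using hv.comp_sub_left_eu 0
  have hflip : ∀ y : Eu d, ∫ x, ‖h x‖ * ‖v (x - y)‖ ≤
      (∫ y, ‖h y‖ ^ (2 : ℝ)) ^ (1 / 2 : ℝ) * (∫ y, ‖v (-y)‖ ^ (2 : ℝ)) ^ (1 / 2 : ℝ) := by
    intro y
    have := integral_norm_mul_comp_sub_le hh hvr y
    simpa using this
  have hi : ∀ y : Eu d, Integrable fun x => h x * v (x - y) := by
    intro y
    have := integrable_mul_comp_sub hh hvr y
    simpa using this
  have hFub : Integrable (fun p : Eu d × Eu d => h p.1 * (P.lowKernel J p.2 * v (p.1 - p.2)))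
      (volume.prod volume) := by
    have hm : AEStronglyMeasurable
        (fun p : Eu d × Eu d => h p.1 * (P.lowKernel J p.2 * v (p.1 - p.2)))
        (volume.prod volume) :=
      hh.1.comp_fst.mul ((P.lowKernel J).continuous.aestronglyMeasurable.convolution_integrand
        (ContinuousLinearMap.mul ℂ ℂ) hv.1)
    rw [integrable_prod_iff' hm]
    refine ⟨ae_of_all _ fun y => ?_, ?_⟩
    · refine ((hi y).const_mul (P.lowKernel J y)).congr (ae_of_all _ fun x => ?_)
      ring
    · have hb : Integrable (fun y => ‖P.lowKernel J y‖ *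
          ((∫ y, ‖h y‖ ^ (2 : ℝ)) ^ (1 / 2 : ℝ) * (∫ y, ‖v (-y)‖ ^ (2 : ℝ)) ^ (1 / 2 : ℝ))) :=
        (P.lowKernel J).integrable.norm.mul_const _
      refine hb.mono hm.norm.prod_swap.integral_prod_right' (ae_of_all _ fun y => ?_)
      have e : ∫ x, ‖h x * (P.lowKernel J y * v (x - y))‖ =
          ‖P.lowKernel J y‖ * ∫ x, ‖h x‖ * ‖v (x - y)‖ := by
        rw [← integral_const_mul]
        congr 1
        funext x
        rw [norm_mul, norm_mul]
        ring
      simp only [e]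
      rw [Real.norm_of_nonneg (by positivity), Real.norm_of_nonneg (by positivity)]
      exact mul_le_mul_of_nonneg_left (hflip y) (norm_nonneg _)
  have e1 : ∫ x, h x * ((P.lowKernel J : Eu d → ℂ) ⋆[ContinuousLinearMap.mul ℂ ℂ] v) x =
      ∫ y, P.lowKernel J y * ∫ x, h x * v (x - y) := by
    calc _ = ∫ x, ∫ y, h x * (P.lowKernel J y * v (x - y)) := by
          congr 1
          funext x
          exact (integral_const_mul _ _).symm
      _ = ∫ y, ∫ x, h x * (P.lowKernel J y * v (x - y)) := integral_integral_swap hFub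
      _ = _ := by
          congr 1
          funext y
          rw [← integral_const_mul]
          congr 1
          funext x
          ring
  rw [e1]
  have hs := Measure.integral_comp_smul (volume : Measure (Eu d))
    (fun y => P.lowKernel 0 y * ∫ x, h x * v (x - ((2 : ℝ) ^ J)⁻¹ • y)) ((2 : ℝ) ^ J)
  rw [finrank_euclideanSpace_fin, abs_of_pos (by positivity), Complex.real_smul] at hs
  have h2 : (((2 : ℝ) ^ J) ^ d : ℂ) ≠ 0 := by norm_cast; positivity
  have hs' : ∫ y, P.lowKernel 0 y * ∫ x, h x * v (x - ((2 : ℝ) ^ J)⁻¹ • y) =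
      ((2 : ℝ) ^ J) ^ d * ∫ y, P.lowKernel 0 ((2 : ℝ) ^ J • y) *
        ∫ x, h x * v (x - ((2 : ℝ) ^ J)⁻¹ • (2 : ℝ) ^ J • y) := by
    rw [hs]
    push_cast at h2 ⊢
    rw [mul_inv_cancel_left₀ h2]
  rw [hs', ← integral_const_mul]
  congr 1
  funext y
  have h3 : ((2 : ℝ) ^ J) ≠ 0 := by positivity
  rw [P.lowKernel_apply J y, inv_smul_smul₀ h3]
  push_cast
  ring

/-- The correlation of h and v is bounded and continuous, and the kernel has integral one; hence the
low frequency truncations converge weakly. -/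
theorem tendsto_integral_mul_lowKernel_convolution {v : Eu d → ℂ} (hv : MemLp v 2 volume)
    {h : Eu d → ℂ} (hc : Continuous h) (hs : HasCompactSupport h) :
    Tendsto (fun J => ∫ x, h x * ((P.lowKernel J : Eu d → ℂ) ⋆[ContinuousLinearMap.mul ℂ ℂ] v) x)
      atTop (𝓝 (∫ x, h x * v x)) := by
  have hh : MemLp h 2 volume := hc.memLp_of_hasCompactSupport hs
  have hvr : MemLp (fun y => v (-y)) 2 volume := by
    simpa using hv.comp_sub_left_eu 0
  set c : Eu d → ℂ := h ⋆[ContinuousLinearMap.mul ℂ ℂ] fun y => v (-y) with hcdef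
  have hcc : Continuous c := hs.continuous_convolution_left _ hc
    (hvr.locallyIntegrable (by norm_num))
  have hce : ∀ y, c y = ∫ x, h x * v (x - y) := by
    intro y
    simp [hcdef, convolution]
  have hcb := norm_convolution_le_of_memLp_two hh hvr
  have e0 : ∫ x, h x * v x = ∫ y, P.lowKernel 0 y * c 0 := by
    rw [integral_mul_const, integral_lowKernel, one_mul, hce]
    simp
  rw [e0]
  have eJ : ∀ J, ∫ x, h x * ((P.lowKernel J : Eu d → ℂ) ⋆[ContinuousLinearMap.mul ℂ ℂ] v) x =
      ∫ y, P.lowKernel 0 y * c (((2 : ℝ) ^ J)⁻¹ • y) := by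
    intro J
    rw [P.integral_mul_lowKernel_convolution J hv hh]
    simp only [hce]
  simp only [eJ]
  refine tendsto_integral_of_dominated_convergence
    (fun y => ‖P.lowKernel 0 y‖ *
      ((∫ y, ‖h y‖ ^ (2 : ℝ)) ^ (1 / 2 : ℝ) * (∫ y, ‖v (-y)‖ ^ (2 : ℝ)) ^ (1 / 2 : ℝ)))
    (fun J => ((P.lowKernel 0).continuous.mul
      (hcc.comp (continuous_const_smul _))).aestronglyMeasurable)
    ((P.lowKernel 0).integrable.norm.mul_const _) (fun J => ae_of_all _ fun y => ?_)
    (ae_of_all _ fun y => ?_)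
  · rw [norm_mul]
    exact mul_le_mul_of_nonneg_left (hcb _) (norm_nonneg _)
  · refine Tendsto.const_mul _ ((hcc.tendsto 0).comp ?_)
    have : Tendsto (fun J : ℕ => ((2 : ℝ) ^ J)⁻¹) atTop (𝓝 0) :=
      (tendsto_pow_atTop_atTop_of_one_lt one_lt_two).inv_tendsto_atTop
    simpa using this.smul_const y

/-- The partial sums are low frequency truncations. Against test functions they converge to v, and
by summability also to the continuous sum of the series. -/
theorem ae_eq_tsum_proj {v : Eu d → ℝ} (hv : MemLp v 2 volume) {u : ℕ → ℝ} (hu : Summable u)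
    (hb : ∀ j x, ‖P.proj j v x‖ ≤ u j) :
    ∀ᵐ x, (v x : ℂ) = ∑' j, P.proj j v x := by
  have hcont : Continuous fun x => ∑' j, P.proj j v x :=
    continuous_tsum (fun j => continuous_iff_continuousAt.2 fun x =>
      (P.hasFDerivAt_proj j hv x).continuousAt) hu hb
  have hvC : MemLp (fun x => (v x : ℂ)) 2 volume := hv.ofReal
  refine ae_eq_of_integral_contDiff_smul_eq (hvC.locallyIntegrable (by norm_num))
    hcont.locallyIntegrable fun g hg hgs => ?_
  have hgc : Continuous fun x => (g x : ℂ) := Complex.continuous_ofReal.comp hg.continuous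
  have hgs' : HasCompactSupport fun x => (g x : ℂ) := hgs.comp_left Complex.ofReal_zero
  have h1 := P.tendsto_integral_mul_lowKernel_convolution hvC hgc hgs'
  have hu0 : ∀ j, 0 ≤ u j := fun j => (norm_nonneg _).trans (hb j 0)
  have h2 : Tendsto (fun J => ∫ x, (g x : ℂ) * ((P.lowKernel J : Eu d → ℂ)
      ⋆[ContinuousLinearMap.mul ℂ ℂ] fun x => (v x : ℂ)) x) atTop
      (𝓝 (∫ x, (g x : ℂ) * ∑' j, P.proj j v x)) := by
    refine tendsto_integral_of_dominated_convergence (fun x => ‖(g x : ℂ)‖ * ∑' j, u j)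
      (fun J => hgc.aestronglyMeasurable.mul (aestronglyMeasurable_convolution_mul
        (P.lowKernel J).continuous.aestronglyMeasurable hvC.1))
      ((hgc.integrable_of_hasCompactSupport hgs').norm.mul_const _)
      (fun J => ae_of_all _ fun x => ?_) (ae_of_all _ fun x => ?_)
    · rw [norm_mul, ← P.sum_proj J hv x]
      refine mul_le_mul_of_nonneg_left ?_ (norm_nonneg _)
      exact (norm_sum_le _ _).trans ((Finset.sum_le_sum fun j _ => hb j x).trans
        (hu.sum_le_tsum _ fun j _ => hu0 j))
    · refine Tendsto.const_mul _ ?_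
      have hs : Summable fun j => P.proj j v x := Summable.of_norm_bounded hu fun j => hb j x
      have := (hs.hasSum.tendsto_sum_nat).comp (tendsto_add_atTop_nat 1)
      refine this.congr fun J => ?_
      exact P.sum_proj J hv x
  have := tendsto_nhds_unique h1 h2
  simpa only [Complex.real_smul] using this

end LPData

/-! ### Pointwise bounds for Littlewood-Paley pieces -/

/-- The weight `(1 + |y|)^{-2}`. -/
def decayWeight {E : Type*} [NormedAddCommGroup E] (y : E) : ℝ := ((1 + ‖y‖) ^ 2)⁻¹

theorem decayWeight_nonneg {E : Type*} [NormedAddCommGroup E] (y : E) : 0 ≤ decayWeight y := by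
  unfold decayWeight; positivity

theorem decayWeight_le_one {E : Type*} [NormedAddCommGroup E] (y : E) : decayWeight y ≤ 1 := by
  unfold decayWeight
  exact inv_le_one_of_one_le₀ (one_le_pow₀ (by linarith [norm_nonneg y]))

theorem continuous_decayWeight {E : Type*} [NormedAddCommGroup E] :
    Continuous (decayWeight : E → ℝ) := by
  unfold decayWeight
  refine Continuous.inv₀ (by fun_prop) fun y => ?_
  have := norm_nonneg y
  positivity

theorem exists_lintegral_decay_sq_le (d : ℕ) :
    ∃ I : ℝ, 0 ≤ I ∧ ∀ (j : ℕ) (x : Eu d),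
      ∫⁻ y, ENNReal.ofReal (((1 + 2 ^ j * ‖x - y‖) ^ (d + 1))⁻¹) ^ (2 : ℝ) ≤
        ENNReal.ofReal (I ^ 2 * ((2 ^ j) ^ d)⁻¹) := by
  have hint : Integrable (fun y : Eu d => (1 + ‖y‖) ^ (-((d + 1 : ℕ) : ℝ))) :=
    integrable_one_add_norm (by simp)
  have hI : 0 ≤ ∫ y : Eu d, (1 + ‖y‖) ^ (-((d + 1 : ℕ) : ℝ)) :=
    integral_nonneg fun y => by positivity
  refine ⟨√(∫ y : Eu d, (1 + ‖y‖) ^ (-((d + 1 : ℕ) : ℝ))), Real.sqrt_nonneg _, fun j x => ?_⟩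
  rw [Real.sq_sqrt hI]
  have hs := Measure.integral_comp_smul (volume : Measure (Eu d))
    (fun y : Eu d => (1 + ‖y‖) ^ (-((d + 1 : ℕ) : ℝ))) ((2 : ℝ) ^ j)
  rw [finrank_euclideanSpace_fin, abs_of_pos (by positivity), smul_eq_mul] at hs
  rw [mul_comm, ← hs, ← integral_sub_left_eq_self _ volume x, ofReal_integral_eq_lintegral_ofReal
    ((hint.comp_smul (by positivity)).comp_sub_left x) (ae_of_all _ fun y => by positivity)]
  refine lintegral_mono fun y => ?_
  have h1 : 1 ≤ (1 + 2 ^ j * ‖x - y‖) ^ (d + 1) := one_le_pow₀ (by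
    have : 0 ≤ 2 ^ j * ‖x - y‖ := by positivity
    linarith)
  rw [ENNReal.ofReal_rpow_of_nonneg (by positivity) (by norm_num)]
  refine ENNReal.ofReal_le_ofReal ?_
  rw [norm_smul, norm_pow, Real.norm_ofNat, Real.rpow_neg (by positivity), Real.rpow_natCast,
    Real.rpow_two]
  exact pow_le_of_le_one (by positivity) (inv_le_one_of_one_le₀ h1) two_ne_zero

namespace LPData

variable {d : ℕ} (P : LPData d)

/-- `‖χ_Q S_j v‖_{L²}` for the `m`-th cube `Q` of side length `2^j`. -/
def cubeNorm (j : ℕ) (v : Eu d → ℝ) (m : Fin d → ℤ) : ℝ≥0∞ :=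
  eLpNorm (fun x => (P.cubeCutoff j m x : ℂ) * P.proj j v x) 2 volume

/-- The sum of the local norms `‖χ_Q S_j v‖_{L²}`, weighted by the distance from `x` to `Q`. -/
def localSum (j : ℕ) (v : Eu d → ℝ) (x : Eu d) : ℝ≥0∞ :=
  ∑' m : Fin d → ℤ,
    ENNReal.ofReal (decayWeight (((2 : ℝ) ^ j)⁻¹ • x - latticePt m)) * P.cubeNorm j v m

theorem continuous_cubeCutoff (j : ℕ) (m : Fin d → ℤ) : Continuous (P.cubeCutoff j m) := by
  unfold cubeCutoff
  exact P.χ_smooth.continuous.comp (by fun_prop)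

theorem tsum_enorm_cubeCutoff_mul (j : ℕ) (y : Eu d) (z : ℂ) :
    ∑' m : Fin d → ℤ, ‖(P.cubeCutoff j m y : ℂ) * z‖ₑ = ‖z‖ₑ := by
  have h := P.χ_partition (((2 : ℝ) ^ j)⁻¹ • y)
  have h2 : ∑' m : Fin d → ℤ, ENNReal.ofReal (P.cubeCutoff j m y) = 1 := by
    rw [← ENNReal.ofReal_one, ← h.tsum_eq]
    exact (ENNReal.ofReal_tsum_of_nonneg (fun m => P.χ_nonneg _) h.summable).symm
  simp only [enorm_mul]
  rw [ENNReal.tsum_mul_right]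
  have h3 : ∀ m, ‖(P.cubeCutoff j m y : ℂ)‖ₑ = ENNReal.ofReal (P.cubeCutoff j m y) := by
    intro m
    rw [← ofReal_norm, Complex.norm_real, Real.norm_of_nonneg (show 0 ≤ P.cubeCutoff j m y from P.χ_nonneg _)]
  simp only [h3, h2, one_mul]

/-- The partition of unity splits the integral into cubes. Of the d + 3 powers of decay, d + 1 are
spent in the Cauchy-Schwarz inequality, where scaling produces 2^{-jd/2}; the other two become the
weight that measures the distance of x from the cube. -/
theorem exists_lintegral_enorm_mul_le :
    ∃ C : ℝ, 0 ≤ C ∧ ∀ {F : Type} [NormedAddCommGroup F] (j : ℕ) (κ : Eu d → F) (A : ℝ),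
      0 ≤ A → (∀ z, ‖κ z‖ ≤ A * ((1 + 2 ^ j * ‖z‖) ^ (d + 3))⁻¹) →
      ∀ (v : Eu d → ℝ), MemLp v 2 volume → ∀ x,
      ∫⁻ y, ‖P.proj j v y‖ₑ * ‖κ (x - y)‖ₑ ≤
        ENNReal.ofReal (A * C * √(((2 ^ j) ^ d)⁻¹)) * P.localSum j v x := by
  obtain ⟨I, hI0, hI⟩ := exists_lintegral_decay_sq_le d
  obtain ⟨r, hr0, hr⟩ : ∃ r : ℝ, 0 ≤ r ∧ ∀ y, P.χ y ≠ 0 → ‖y‖ ≤ r := by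
    obtain ⟨r, hr⟩ := P.χ_compact.isCompact.isBounded.exists_norm_le
    exact ⟨max r 0, le_max_right _ _, fun y hy =>
      (hr y (subset_tsupport _ hy)).trans (le_max_left _ _)⟩
  refine ⟨(1 + r) ^ 2 * I, by positivity, fun {F} _ j κ A hA hκ v hv x => ?_⟩
  have hw := P.aestronglyMeasurable_proj j hv
  have hκe : ∀ m y, ‖(P.cubeCutoff j m y : ℂ) * P.proj j v y‖ₑ * ‖κ (x - y)‖ₑ ≤
      ENNReal.ofReal (A * (1 + r) ^ 2 * decayWeight (((2 : ℝ) ^ j)⁻¹ • x - latticePt m)) *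
      (‖(P.cubeCutoff j m y : ℂ) * P.proj j v y‖ₑ *
        ENNReal.ofReal (((1 + 2 ^ j * ‖x - y‖) ^ (d + 1))⁻¹)) := by
    intro m y
    by_cases h0 : P.cubeCutoff j m y = 0
    · simp [h0]
    have hry := hr _ h0
    rw [mul_left_comm]
    refine mul_le_mul_right ?_ _
    rw [← ENNReal.ofReal_mul (by have := decayWeight_nonneg (((2 : ℝ) ^ j)⁻¹ • x - latticePt m); positivity),
      ← ofReal_norm]
    refine ENNReal.ofReal_le_ofReal ((hκ _).trans ?_)
    set u := 2 ^ j * ‖x - y‖ with hu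
    have hu0 : 0 ≤ u := by positivity
    have h2j : (1 : ℝ) ≤ 2 ^ j := one_le_pow₀ one_le_two
    -- The kernel lives at scale 2^{-j} and the cubes at scale 2^j, so the wasteful bound 2^{-j}|x -
    -- y| ≤ 2^j|x - y| suffices.
    have hp : ‖((2 : ℝ) ^ j)⁻¹ • x - latticePt m‖ ≤ u + r := by
      have e : ((2 : ℝ) ^ j)⁻¹ • x - latticePt m =
          ((2 : ℝ) ^ j)⁻¹ • (x - y) + (((2 : ℝ) ^ j)⁻¹ • y - latticePt m) := by
        rw [smul_sub]; abel
      rw [e]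
      refine (norm_add_le _ _).trans (add_le_add ?_ hry)
      rw [norm_smul, norm_inv, norm_pow, Real.norm_ofNat, hu]
      refine mul_le_mul_of_nonneg_right ?_ (norm_nonneg _)
      exact (inv_le_one_of_one_le₀ h2j).trans h2j
    have hq : 1 + ‖((2 : ℝ) ^ j)⁻¹ • x - latticePt m‖ ≤ (1 + r) * (1 + u) := by
      nlinarith
    have key : ((1 + u) ^ 2)⁻¹ ≤
        (1 + r) ^ 2 * decayWeight (((2 : ℝ) ^ j)⁻¹ • x - latticePt m) := by
      unfold decayWeight
      rw [← div_eq_mul_inv, le_div_iff₀ (by positivity), inv_mul_le_iff₀ (by positivity)]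
      calc _ ≤ ((1 + r) * (1 + u)) ^ 2 := by gcongr
        _ = _ := by ring
    calc A * ((1 + u) ^ (d + 3))⁻¹ = A * ((1 + u) ^ (d + 1))⁻¹ * ((1 + u) ^ 2)⁻¹ := by
          rw [show d + 3 = d + 1 + 2 from rfl, pow_add, mul_inv, ← mul_assoc]
      _ ≤ A * ((1 + u) ^ (d + 1))⁻¹ *
          ((1 + r) ^ 2 * decayWeight (((2 : ℝ) ^ j)⁻¹ • x - latticePt m)) :=
        mul_le_mul_of_nonneg_left key (by positivity)
      _ = _ := by ring
  calc ∫⁻ y, ‖P.proj j v y‖ₑ * ‖κ (x - y)‖ₑ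
      ≤ ∫⁻ y, ∑' m : Fin d → ℤ, ENNReal.ofReal
          (A * (1 + r) ^ 2 * decayWeight (((2 : ℝ) ^ j)⁻¹ • x - latticePt m)) *
          (‖(P.cubeCutoff j m y : ℂ) * P.proj j v y‖ₑ *
            ENNReal.ofReal (((1 + 2 ^ j * ‖x - y‖) ^ (d + 1))⁻¹)) := by
        refine lintegral_mono fun y => ?_
        rw [← P.tsum_enorm_cubeCutoff_mul j y (P.proj j v y), ← ENNReal.tsum_mul_right]
        exact ENNReal.tsum_le_tsum fun m => hκe m y
    _ = ∑' m : Fin d → ℤ, ENNReal.ofReal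
          (A * (1 + r) ^ 2 * decayWeight (((2 : ℝ) ^ j)⁻¹ • x - latticePt m)) *
          ∫⁻ y, ‖(P.cubeCutoff j m y : ℂ) * P.proj j v y‖ₑ *
            ENNReal.ofReal (((1 + 2 ^ j * ‖x - y‖) ^ (d + 1))⁻¹) := by
        have hmeas : ∀ m : Fin d → ℤ, AEMeasurable (fun y =>
            ‖(P.cubeCutoff j m y : ℂ) * P.proj j v y‖ₑ *
            ENNReal.ofReal (((1 + 2 ^ j * ‖x - y‖) ^ (d + 1))⁻¹)) volume := by
          intro m
          refine ((Complex.continuous_ofReal.comp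
            (P.continuous_cubeCutoff j m)).aestronglyMeasurable.mul hw).enorm.mul ?_
          exact Measurable.aemeasurable (by fun_prop)
        rw [lintegral_tsum fun m => (hmeas m).const_mul _]
        congr 1
        funext m
        rw [lintegral_const_mul'' _ (hmeas m)]
    _ ≤ ∑' m : Fin d → ℤ, ENNReal.ofReal (A * ((1 + r) ^ 2 * I) * √(((2 ^ j) ^ d)⁻¹)) *
          (ENNReal.ofReal (decayWeight (((2 : ℝ) ^ j)⁻¹ • x - latticePt m)) *
            P.cubeNorm j v m) := by
        refine ENNReal.tsum_le_tsum fun m => ?_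
        have hH := ENNReal.lintegral_mul_le_Lp_mul_Lq (volume : Measure (Eu d))
          Real.HolderConjugate.two_two
          (f := fun y => ‖(P.cubeCutoff j m y : ℂ) * P.proj j v y‖ₑ)
          (g := fun y => ENNReal.ofReal (((1 + 2 ^ j * ‖x - y‖) ^ (d + 1))⁻¹))
          ((Complex.continuous_ofReal.comp
            (P.continuous_cubeCutoff j m)).aestronglyMeasurable.mul hw).enorm
          (Measurable.aemeasurable (by fun_prop))
        have hn : (∫⁻ y, ‖(P.cubeCutoff j m y : ℂ) * P.proj j v y‖ₑ ^ (2 : ℝ)) ^ (1 / (2 : ℝ)) =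
            P.cubeNorm j v m := by
          rw [cubeNorm, eLpNorm_eq_lintegral_rpow_enorm_toReal two_ne_zero ENNReal.ofNat_ne_top]
          simp
        have hd : (∫⁻ y, ENNReal.ofReal (((1 + 2 ^ j * ‖x - y‖) ^ (d + 1))⁻¹) ^ (2 : ℝ)) ^
            (1 / (2 : ℝ)) ≤ ENNReal.ofReal (I * √(((2 ^ j) ^ d)⁻¹)) := by
          refine (ENNReal.rpow_le_rpow (hI j x) (by norm_num)).trans ?_
          rw [ENNReal.ofReal_rpow_of_nonneg (by positivity) (by norm_num), ← Real.sqrt_eq_rpow,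
            Real.sqrt_mul (by positivity), Real.sqrt_sq hI0]
        rw [hn] at hH
        have hw0 := decayWeight_nonneg (((2 : ℝ) ^ j)⁻¹ • x - latticePt m)
        calc _ ≤ ENNReal.ofReal
              (A * (1 + r) ^ 2 * decayWeight (((2 : ℝ) ^ j)⁻¹ • x - latticePt m)) *
              (P.cubeNorm j v m * ENNReal.ofReal (I * √(((2 ^ j) ^ d)⁻¹))) := by
              refine mul_le_mul_right (hH.trans (mul_le_mul_right hd _)) _
          _ = _ := by
              rw [mul_comm (P.cubeNorm j v m), ← mul_assoc, ← mul_assoc,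
                ← ENNReal.ofReal_mul (by positivity), ← ENNReal.ofReal_mul (by positivity)]
              congr 2
              ring
    _ = _ := by rw [ENNReal.tsum_mul_left, localSum]

end LPData

/-! ### Regularity from summable Littlewood-Paley pieces -/

theorem SchwartzMap.fderivCLM_of_eq_smul_comp {d : ℕ} {F : Type*} [NormedAddCommGroup F]
    [NormedSpace ℝ F] {f g : 𝓢(Eu d, F)} {a c : ℝ} (h : ∀ z, f z = a • g (c • z)) (z : Eu d) :
    SchwartzMap.fderivCLM ℝ (Eu d) F f z =
      (a * c) • SchwartzMap.fderivCLM ℝ (Eu d) F g (c • z) := by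
  have e : (f : Eu d → F) = a • fun z => g (c • z) := funext h
  rw [SchwartzMap.fderivCLM_apply, SchwartzMap.fderivCLM_apply, e, fderiv_const_smul_field,
    Pi.smul_apply]
  rw [show (fun z => g (c • z)) = (g : Eu d → F) ∘ fun z => c • z from rfl]
  have h1 : HasFDerivAt (fun z : Eu d => c • z) (c • ContinuousLinearMap.id ℝ (Eu d)) z :=
    (hasFDerivAt_id z).const_smul c
  have h2 : HasFDerivAt g (fderiv ℝ g (c • z)) (c • z) := g.differentiableAt.hasFDerivAt
  rw [(h2.comp z h1).fderiv, mul_smul]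
  congr 1
  ext v
  simp

theorem SchwartzMap.exists_norm_le_of_eq_smul_comp {d : ℕ} {F : Type*} [NormedAddCommGroup F]
    [NormedSpace ℝ F] (g : 𝓢(Eu d, F)) (N : ℕ) :
    ∃ B : ℝ, 0 ≤ B ∧ ∀ (j : ℕ) (a : ℝ) (f : Eu d → F), 0 ≤ a →
      (∀ z, f z = a • g ((2 : ℝ) ^ (j + 1) • z)) →
      ∀ z, ‖f z‖ ≤ (a * B) * ((1 + 2 ^ j * ‖z‖) ^ N)⁻¹ := by
  obtain ⟨B, hB0, hB⟩ := g.exists_one_add_pow_mul_norm_le N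
  refine ⟨B, hB0, fun j a f ha hf z => ?_⟩
  rw [hf, norm_smul, Real.norm_of_nonneg ha, mul_assoc]
  refine mul_le_mul_of_nonneg_left ?_ ha
  rw [← div_eq_mul_inv, le_div_iff₀ (by positivity), mul_comm]
  refine le_trans ?_ (hB ((2 : ℝ) ^ (j + 1) • z))
  refine mul_le_mul_of_nonneg_right (pow_le_pow_left₀ (by positivity) ?_ N) (norm_nonneg _)
  rw [norm_smul, norm_pow, Real.norm_ofNat, pow_succ]
  have : 0 ≤ 2 ^ j * ‖z‖ := by positivity
  nlinarith

theorem ofReal_two_pow_mul_sqrt (d j k : ℕ) :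
    ENNReal.ofReal ((2 ^ j) ^ k * √((2 ^ j) ^ d)) = (2 : ℝ≥0∞) ^ ((j : ℝ) * (k + d / 2)) := by
  have h : ((2 : ℝ) ^ j) ^ k * √((2 ^ j) ^ d) = (2 : ℝ) ^ ((j : ℝ) * (k + d / 2)) := by
    rw [Real.sqrt_eq_rpow, ← pow_mul, ← pow_mul, ← Real.rpow_natCast, ← Real.rpow_natCast,
      ← Real.rpow_mul (by norm_num), ← Real.rpow_add (by norm_num)]
    congr 1
    push_cast
    ring
  rw [h, ← ENNReal.ofReal_rpow_of_pos (by norm_num), ENNReal.ofReal_ofNat]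

/-- Take s₀ where the rescaled curve is closest to p. The expansion hypothesis bounds 2^{-j}|s - s₀|
by the sum of the two distances to p, hence by twice the distance at s. So the weight is dominated
by 1/(1 + (s - s₀)²/2^{2j+2}), whose integral is 2π·2^j. -/
theorem lintegral_decayWeight_comp_le {d : ℕ} (j : ℕ) (p : Eu d) {γ : ℝ → Eu d} {a b : ℝ}
    (hγ : ContinuousOn γ (Icc a b))
    (hexp : ∀ s ∈ Icc a b, ∀ s' ∈ Icc a b, |s - s'| ≤ ‖γ s - γ s'‖) :
    ∫⁻ s in Icc a b, ENNReal.ofReal (decayWeight (((2 : ℝ) ^ j)⁻¹ • γ s - p)) ≤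
      8 * (2 : ℝ≥0∞) ^ (j : ℝ) := by
  rcases (Icc a b).eq_empty_or_nonempty with h | h
  · simp [h]
  obtain ⟨s₀, hs₀, hmin⟩ := isCompact_Icc.exists_isMinOn h
    (f := fun s => ‖((2 : ℝ) ^ j)⁻¹ • γ s - p‖) (by fun_prop)
  have h2 : (0 : ℝ) < 2 ^ j := by positivity
  set c : ℝ := (2 * 2 ^ j)⁻¹ with hc
  have hc0 : 0 < c := by positivity
  have hint : Integrable fun s : ℝ => (1 + s ^ 2)⁻¹ := integrable_inv_one_add_sq
  have hpt : ∀ s ∈ Icc a b, decayWeight (((2 : ℝ) ^ j)⁻¹ • γ s - p) ≤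
      (1 + (c * (s - s₀)) ^ 2)⁻¹ := by
    intro s hs
    have h1 : ‖((2 : ℝ) ^ j)⁻¹ • γ s₀ - p‖ ≤ ‖((2 : ℝ) ^ j)⁻¹ • γ s - p‖ := hmin hs
    have h3 : (2 ^ j)⁻¹ * |s - s₀| ≤ ‖((2 : ℝ) ^ j)⁻¹ • γ s - p‖ + ‖((2 : ℝ) ^ j)⁻¹ • γ s₀ - p‖ := by
      calc (2 ^ j)⁻¹ * |s - s₀| ≤ (2 ^ j)⁻¹ * ‖γ s - γ s₀‖ :=
            mul_le_mul_of_nonneg_left (hexp s hs s₀ hs₀) (by positivity)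
        _ = ‖(((2 : ℝ) ^ j)⁻¹ • γ s - p) - (((2 : ℝ) ^ j)⁻¹ • γ s₀ - p)‖ := by
            rw [sub_sub_sub_cancel_right, ← smul_sub, norm_smul, norm_inv, norm_pow,
              Real.norm_ofNat]
        _ ≤ _ := norm_sub_le _ _
    have h4 : |c * (s - s₀)| ≤ ‖((2 : ℝ) ^ j)⁻¹ • γ s - p‖ := by
      rw [abs_mul, abs_of_pos hc0, hc, mul_inv]
      nlinarith
    unfold decayWeight
    refine inv_anti₀ (by positivity) ?_
    rw [← sq_abs]
    have := abs_nonneg (c * (s - s₀))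
    nlinarith
  calc ∫⁻ s in Icc a b, ENNReal.ofReal (decayWeight (((2 : ℝ) ^ j)⁻¹ • γ s - p))
      ≤ ∫⁻ s in Icc a b, ENNReal.ofReal ((1 + (c * (s - s₀)) ^ 2)⁻¹) :=
        setLIntegral_mono' measurableSet_Icc fun s hs => ENNReal.ofReal_le_ofReal (hpt s hs)
    _ ≤ ∫⁻ s, ENNReal.ofReal ((1 + (c * (s - s₀)) ^ 2)⁻¹) := setLIntegral_le_lintegral _ _
    _ = ENNReal.ofReal (∫ s, (1 + (c * (s - s₀)) ^ 2)⁻¹) :=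
        (ofReal_integral_eq_lintegral_ofReal
          ((hint.comp_mul_left' hc0.ne').comp_sub_right s₀)
          (ae_of_all _ fun s => by positivity)).symm
    _ ≤ ENNReal.ofReal (8 * 2 ^ j) := by
        refine ENNReal.ofReal_le_ofReal ?_
        rw [integral_sub_right_eq_self (fun s => (1 + (c * s) ^ 2)⁻¹) s₀,
          Measure.integral_comp_mul_left (fun s => (1 + s ^ 2)⁻¹) c, integral_univ_inv_one_add_sq,
          smul_eq_mul, abs_of_pos (by positivity), hc, inv_inv]
        have := Real.pi_le_four
        nlinarith
    _ = _ := by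
        rw [ENNReal.ofReal_mul (by norm_num), ENNReal.ofReal_pow (by norm_num)]
        simp

namespace LPData

variable {d : ℕ} (P : LPData d)

/-- Bernstein's inequality in localised form. The k-th derivative of the kernel has size 2^{j(d+k)},
and Cauchy-Schwarz on the cubes gives back 2^{-jd/2}. -/
theorem exists_enorm_proj_le : ∃ C : ℝ, 0 ≤ C ∧ ∀ (j : ℕ) (v : Eu d → ℝ), MemLp v 2 volume → ∀ x,
    ‖P.proj j v x‖ₑ ≤ ENNReal.ofReal C * ((2 : ℝ≥0∞) ^ ((j : ℝ) * (d / 2)) * P.localSum j v x) ∧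
    ‖P.projD j v x‖ₑ ≤
      ENNReal.ofReal C * ((2 : ℝ≥0∞) ^ ((j : ℝ) * (1 + d / 2)) * P.localSum j v x) ∧
    ‖P.projDD j v x‖ₑ ≤
      ENNReal.ofReal C * ((2 : ℝ≥0∞) ^ ((j : ℝ) * (2 + d / 2)) * P.localSum j v x) := by
  obtain ⟨C, hC0, hC⟩ := P.exists_lintegral_enorm_mul_le
  set g0 := P.lowKernel 0
  set g1 := SchwartzMap.fderivCLM ℝ (Eu d) ℂ g0
  set g2 := SchwartzMap.fderivCLM ℝ (Eu d) (Eu d →L[ℝ] ℂ) g1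
  obtain ⟨B0, hB00, hB0⟩ := g0.exists_norm_le_of_eq_smul_comp (d + 3)
  obtain ⟨B1, hB10, hB1⟩ := g1.exists_norm_le_of_eq_smul_comp (d + 3)
  obtain ⟨B2, hB20, hB2⟩ := g2.exists_norm_le_of_eq_smul_comp (d + 3)
  have e0 : ∀ j z, P.lowKernel (j + 1) z =
      (((2 : ℝ) ^ (j + 1)) ^ d) • g0 ((2 : ℝ) ^ (j + 1) • z) := by
    intro j z
    rw [P.lowKernel_apply, Complex.real_smul]
    push_cast
    rfl
  have e1 := fun j => SchwartzMap.fderivCLM_of_eq_smul_comp (e0 j)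
  have e2 := fun j => SchwartzMap.fderivCLM_of_eq_smul_comp (e1 j)
  have key : ∀ {F : Type} [NormedAddCommGroup F] [NormedSpace ℝ F] [NormedSpace ℂ F] (k j : ℕ)
      (κ : Eu d → F) (B : ℝ), 0 ≤ B → B ≤ B0 + B1 + B2 → k ≤ 2 →
      (∀ z, ‖κ z‖ ≤ (((2 : ℝ) ^ (j + 1)) ^ d * (2 ^ (j + 1)) ^ k * B) *
        ((1 + 2 ^ j * ‖z‖) ^ (d + 3))⁻¹) →
      ∀ v : Eu d → ℝ, MemLp v 2 volume → ∀ x, ‖∫ y, P.proj j v y • κ (x - y)‖ₑ ≤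
      ENNReal.ofReal ((B0 + B1 + B2) * C * 2 ^ (d + 2)) *
        ((2 : ℝ≥0∞) ^ ((j : ℝ) * (k + d / 2)) * P.localSum j v x) := by
    intro F _ _ _ k j κ B hB hBB hk hκ v hv x
    have h := hC j κ _ (by positivity) hκ v hv x
    refine (enorm_integral_le_lintegral_enorm _).trans ?_
    simp only [enorm_smul]
    refine h.trans ?_
    rw [← mul_assoc, ← ofReal_two_pow_mul_sqrt, ← ENNReal.ofReal_mul (by positivity)]
    refine mul_le_mul_left (ENNReal.ofReal_le_ofReal ?_) _
    have h2 : (0 : ℝ) < 2 ^ j := by positivity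
    have hs : ((2 : ℝ) ^ j) ^ d * √(((2 ^ j) ^ d)⁻¹) = √((2 ^ j) ^ d) := by
      rw [Real.sqrt_inv, ← div_eq_mul_inv, Real.div_sqrt]
    calc ((2 : ℝ) ^ (j + 1)) ^ d * (2 ^ (j + 1)) ^ k * B * C * √(((2 ^ j) ^ d)⁻¹)
        = B * C * 2 ^ (d + k) * ((2 ^ j) ^ k * (((2 : ℝ) ^ j) ^ d * √(((2 ^ j) ^ d)⁻¹))) := by
          rw [pow_succ, mul_pow, mul_pow, pow_add]; ring
      _ ≤ (B0 + B1 + B2) * C * 2 ^ (d + 2) * ((2 ^ j) ^ k * √((2 ^ j) ^ d)) := by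
          rw [hs]
          gcongr
          norm_num
  refine ⟨(B0 + B1 + B2) * C * 2 ^ (d + 2), by positivity, fun j v hv x => ⟨?_, ?_, ?_⟩⟩
  · have h := key 0 j (P.lowKernel (j + 1)) B0 hB00 (by linarith) (by norm_num) (by
      simpa using hB0 j _ _ (by positivity) (e0 j)) v hv x
    rw [← P.proj_eq_integral_lowKernel j hv] at h
    simpa using h
  · have h := key 1 j _ B1 hB10 (by linarith) (by norm_num) (by
      simpa using hB1 j _ _ (by positivity) (e1 j)) v hv x
    simpa [projD] using h
  · have h := key 2 j _ B2 hB20 (by linarith) (by norm_num) (by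
      simpa [pow_two, mul_assoc] using hB2 j _ _ (by positivity) (e2 j)) v hv x
    simpa [projDD] using h

/-- The norm `∑_j 2^{ja} ∑_Q ‖χ_Q S_j v‖_{L²}`. -/
def besovNorm (a : ℝ) (v : Eu d → ℝ) : ℝ≥0∞ :=
  ∑' j : ℕ, (2 : ℝ≥0∞) ^ ((j : ℝ) * a) * ∑' m, P.cubeNorm j v m

/-- The pointwise majorant `∑_j 2^{j(1+d/2)} ∑_Q w_Q(x) ‖χ_Q S_j v‖_{L²}` of the gradient. -/
def gradSum (v : Eu d → ℝ) (x : Eu d) : ℝ≥0∞ :=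
  ∑' j : ℕ, (2 : ℝ≥0∞) ^ ((j : ℝ) * (1 + d / 2)) * P.localSum j v x

theorem localSum_le (j : ℕ) (v : Eu d → ℝ) (x : Eu d) :
    P.localSum j v x ≤ ∑' m, P.cubeNorm j v m := by
  refine ENNReal.tsum_le_tsum fun m => ?_
  calc _ ≤ ENNReal.ofReal 1 * P.cubeNorm j v m :=
        mul_le_mul_left (ENNReal.ofReal_le_ofReal (decayWeight_le_one _)) _
    _ = _ := by simp

/-- Each cube of side 2^j contributes weighted time O(2^j), so integration along the curve costs one
power of 2^j more than the pointwise gradient. This is the same exponent 2 + d/2 as for second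
derivatives. -/
theorem lintegral_gradSum_comp_le (v : Eu d → ℝ) {γ : ℝ → Eu d} {a b : ℝ}
    (hγ : Continuous γ)
    (hexp : ∀ s ∈ Icc a b, ∀ s' ∈ Icc a b, |s - s'| ≤ ‖γ s - γ s'‖) :
    ∫⁻ s in Icc a b, P.gradSum v (γ s) ≤ 8 * P.besovNorm (2 + d / 2) v := by
  have hm : ∀ (j : ℕ) (m : Fin d → ℤ), Measurable fun s =>
      ENNReal.ofReal (decayWeight (((2 : ℝ) ^ j)⁻¹ • γ s - latticePt m)) := by
    intro j m
    refine (continuous_decayWeight.comp ?_).measurable.ennreal_ofReal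
    fun_prop
  have hm2 : ∀ j, Measurable fun s => P.localSum j v (γ s) := fun j =>
    Measurable.tsum fun m => (hm j m).mul_const _
  simp only [gradSum, besovNorm]
  rw [lintegral_tsum fun j => ((hm2 j).const_mul _).aemeasurable, ← ENNReal.tsum_mul_left]
  refine ENNReal.tsum_le_tsum fun j => ?_
  rw [lintegral_const_mul _ (hm2 j)]
  simp only [localSum]
  rw [lintegral_tsum fun m => ((hm j m).mul_const _).aemeasurable]
  calc _ ≤ (2 : ℝ≥0∞) ^ ((j : ℝ) * (1 + d / 2)) *
        ∑' m, 8 * (2 : ℝ≥0∞) ^ (j : ℝ) * P.cubeNorm j v m := by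
        refine mul_le_mul_right (ENNReal.tsum_le_tsum fun m => ?_) _
        rw [lintegral_mul_const _ (hm j m)]
        exact mul_le_mul_left (lintegral_decayWeight_comp_le j _ hγ.continuousOn hexp) _
    _ = _ := by
        rw [ENNReal.tsum_mul_left, show (j : ℝ) * (2 + d / 2) = j * (1 + d / 2) + j by ring,
          ENNReal.rpow_add _ _ (by norm_num) (by norm_num)]
        ring

end LPData

theorem enorm_tsum_nat_le {F : Type*} [NormedAddCommGroup F] [CompleteSpace F] (f : ℕ → F) :
    ‖∑' j, f j‖ₑ ≤ ∑' j, ‖f j‖ₑ :=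
  enorm_tsum_le_tsum_enorm

theorem norm_tsum_le_of_tsum_enorm_le {F : Type*} [NormedAddCommGroup F] [CompleteSpace F]
    {f : ℕ → F} {C : ℝ} (hC : 0 ≤ C) (h : ∑' j, ‖f j‖ₑ ≤ ENNReal.ofReal C) :
    ‖∑' j, f j‖ ≤ C := by
  have h1 : ‖∑' j, f j‖ₑ ≤ ENNReal.ofReal C := enorm_tsum_le_tsum_enorm.trans h
  rw [← ofReal_norm] at h1
  exact (ENNReal.ofReal_le_ofReal_iff hC).1 h1

theorem norm_le_toReal_of_enorm_le {F : Type*} [NormedAddCommGroup F] {z : F} {a : ℝ≥0∞}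
    (ha : a ≠ ⊤) (h : ‖z‖ₑ ≤ a) : ‖z‖ ≤ a.toReal := by
  rw [← ofReal_norm] at h
  exact ENNReal.ofReal_le_iff_le_toReal ha |>.1 h

/-! ### Summation over frequencies: sup bounds, C^{1,1} representatives and fixed time slices of the
norm -/

namespace LPData

variable {d : ℕ} (P : LPData d)

theorem tsum_le_besovNorm (C : ℝ) (a : ℝ) (v : Eu d → ℝ) {N : ℝ}
    (hC : 0 ≤ C) (hN : P.besovNorm a v ≤ ENNReal.ofReal N) :
    ∑' j : ℕ, ENNReal.ofReal C * ((2 : ℝ≥0∞) ^ ((j : ℝ) * a) * ∑' m, P.cubeNorm j v m) ≤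
      ENNReal.ofReal (C * N) := by
  rw [ENNReal.tsum_mul_left, ENNReal.ofReal_mul hC]
  exact mul_le_mul_right hN _

theorem exists_ae_abs_le : ∃ C : ℝ, 0 ≤ C ∧ ∀ (v : Eu d → ℝ), MemLp v 2 volume → ∀ N : ℝ, 0 ≤ N →
    P.besovNorm (d / 2) v ≤ ENNReal.ofReal N → ∀ᵐ x, |v x| ≤ C * N := by
  obtain ⟨C, hC0, hC⟩ := P.exists_enorm_proj_le
  refine ⟨C, hC0, fun v hv N hN0 hN => ?_⟩
  have hle := P.tsum_le_besovNorm C (d / 2) v hC0 hN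
  have hfin : ∑' j : ℕ, ENNReal.ofReal C *
      ((2 : ℝ≥0∞) ^ ((j : ℝ) * (d / 2)) * ∑' m, P.cubeNorm j v m) ≠ ⊤ :=
    ne_top_of_le_ne_top ENNReal.ofReal_ne_top hle
  have hj : ∀ j x, ‖P.proj j v x‖ₑ ≤ ENNReal.ofReal C *
      ((2 : ℝ≥0∞) ^ ((j : ℝ) * (d / 2)) * ∑' m, P.cubeNorm j v m) := fun j x =>
    (hC j v hv x).1.trans (mul_le_mul_right (mul_le_mul_right (P.localSum_le j v x) _) _)
  have hae := P.ae_eq_tsum_proj hv (ENNReal.summable_toReal hfin) fun j x =>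
    norm_le_toReal_of_enorm_le (ENNReal.ne_top_of_tsum_ne_top hfin j) (hj j x)
  filter_upwards [hae] with x hx
  have h := norm_tsum_le_of_tsum_enorm_le (by positivity : 0 ≤ C * N)
    ((ENNReal.tsum_le_tsum fun j => hj j x).trans hle)
  rwa [← hx, Complex.norm_real, Real.norm_eq_abs] at h

/-- At exponent 2 + d/2 the second derivatives of the pieces are summable, whence the gradient is
Lipschitz. The pointwise bound by `gradSum` retains the localisation to cubes, which is needed for
integrals along curves. -/
theorem exists_regular_representative : ∃ C : ℝ, 0 ≤ C ∧ ∀ (v : Eu d → ℝ), MemLp v 2 volume →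
    ∀ N : ℝ, 0 ≤ N → P.besovNorm (2 + d / 2) v ≤ ENNReal.ofReal N →
    ∃ (W : Eu d → ℝ) (W' : Eu d → Eu d →L[ℝ] ℝ), (∀ᵐ x, v x = W x) ∧
      (∀ x, HasFDerivAt W (W' x) x) ∧ (∀ x, |W x| ≤ C * N) ∧ (∀ x, ‖W' x‖ ≤ C * N) ∧
      (∀ x, ‖W' x‖ₑ ≤ ENNReal.ofReal C * P.gradSum v x) ∧
      (∀ x y, ‖W' x - W' y‖ ≤ C * N * ‖x - y‖) := by
  obtain ⟨C, hC0, hC⟩ := P.exists_enorm_proj_le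
  refine ⟨C, hC0, fun v hv N hN0 hN => ?_⟩
  set u : ℕ → ℝ≥0∞ := fun j => ENNReal.ofReal C *
      ((2 : ℝ≥0∞) ^ ((j : ℝ) * (2 + d / 2)) * ∑' m, P.cubeNorm j v m) with hu
  have hle : ∑' j, u j ≤ ENNReal.ofReal (C * N) := P.tsum_le_besovNorm C (2 + d / 2) v hC0 hN
  have hfin : ∑' j, u j ≠ ⊤ := ne_top_of_le_ne_top ENNReal.ofReal_ne_top hle
  have hpow : ∀ (j : ℕ) (a : ℝ) (x : Eu d), a ≤ 2 + d / 2 →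
      ENNReal.ofReal C * ((2 : ℝ≥0∞) ^ ((j : ℝ) * a) * P.localSum j v x) ≤ u j := by
    intro j a x ha
    refine mul_le_mul_right (mul_le_mul' ?_ (P.localSum_le j v x)) _
    exact ENNReal.rpow_le_rpow_of_exponent_le (by norm_num)
      (mul_le_mul_of_nonneg_left ha (Nat.cast_nonneg j))
  have h0 : ∀ j x, ‖P.proj j v x‖ₑ ≤ u j := fun j x =>
    (hC j v hv x).1.trans (hpow j _ x (by linarith))
  have h1 : ∀ j x, ‖P.projD j v x‖ₑ ≤ u j := fun j x =>
    (hC j v hv x).2.1.trans (hpow j _ x (by linarith))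
  have h2 : ∀ j x, ‖P.projDD j v x‖ₑ ≤ u j := fun j x =>
    (hC j v hv x).2.2.trans (hpow j _ x le_rfl)
  have huj : ∀ j, u j ≠ ⊤ := ENNReal.ne_top_of_tsum_ne_top hfin
  have hsum : Summable fun j => (u j).toReal := ENNReal.summable_toReal hfin
  have hae := P.ae_eq_tsum_proj hv hsum fun j x => norm_le_toReal_of_enorm_le (huj j) (h0 j x)
  have hs0 : ∀ x, Summable fun j => P.proj j v x := fun x =>
    Summable.of_norm_bounded hsum fun j => norm_le_toReal_of_enorm_le (huj j) (h0 j x)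
  have hs1 : ∀ x, Summable fun j => P.projD j v x := fun x =>
    Summable.of_norm_bounded hsum fun j => norm_le_toReal_of_enorm_le (huj j) (h1 j x)
  have hder : ∀ x, HasFDerivAt (fun y => ∑' j, P.proj j v y) (∑' j, P.projD j v x) x :=
    hasFDerivAt_tsum hsum (fun j x => P.hasFDerivAt_proj j hv x)
      (fun j x => norm_le_toReal_of_enorm_le (huj j) (h1 j x)) (hs0 0)
  have hre : ∀ L : Eu d →L[ℝ] ℂ, ‖Complex.reCLM.comp L‖ ≤ ‖L‖ := fun L => by
    refine (Complex.reCLM.opNorm_comp_le L).trans ?_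
    rw [Complex.reCLM_norm, one_mul]
  refine ⟨fun x => (∑' j, P.proj j v x).re, fun x => Complex.reCLM.comp (∑' j, P.projD j v x),
    ?_, fun x => ?_, fun x => ?_, fun x => ?_, fun x => ?_, fun x y => ?_⟩
  · filter_upwards [hae] with x hx
    rw [← hx, Complex.ofReal_re]
  · exact Complex.reCLM.hasFDerivAt.comp x (hder x)
  · exact (Complex.abs_re_le_norm _).trans (norm_tsum_le_of_tsum_enorm_le (by positivity)
      ((ENNReal.tsum_le_tsum fun j => h0 j x).trans hle))
  · exact (hre _).trans (norm_tsum_le_of_tsum_enorm_le (by positivity)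
      ((ENNReal.tsum_le_tsum fun j => h1 j x).trans hle))
  · have hle' : ‖Complex.reCLM.comp (∑' j, P.projD j v x)‖ₑ ≤ ‖∑' j, P.projD j v x‖ₑ := by
      rw [← ofReal_norm, ← ofReal_norm]
      exact ENNReal.ofReal_le_ofReal (hre _)
    refine hle'.trans ((enorm_tsum_nat_le fun j => P.projD j v x).trans ?_)
    rw [gradSum, ← ENNReal.tsum_mul_left]
    exact ENNReal.tsum_le_tsum fun j => (hC j v hv x).2.1
  · rw [← ContinuousLinearMap.comp_sub, ← (hs1 x).tsum_sub (hs1 y)]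
    refine (hre _).trans (norm_tsum_le_of_tsum_enorm_le (by positivity) ?_)
    have hlip : ∀ j, ‖P.projD j v x - P.projD j v y‖ ≤ (u j).toReal * ‖x - y‖ := fun j =>
      convex_univ.norm_image_sub_le_of_norm_hasFDerivWithin_le
        (fun z _ => (P.hasFDerivAt_projD j hv z).hasFDerivWithinAt)
        (fun z _ => norm_le_toReal_of_enorm_le (huj j) (h2 j z)) (mem_univ _) (mem_univ _)
    calc ∑' j, ‖P.projD j v x - P.projD j v y‖ₑ
        ≤ ∑' j, u j * ENNReal.ofReal ‖x - y‖ := by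
          refine ENNReal.tsum_le_tsum fun j => ?_
          rw [← ofReal_norm, ← ENNReal.ofReal_toReal (huj j),
            ← ENNReal.ofReal_mul ENNReal.toReal_nonneg]
          exact ENNReal.ofReal_le_ofReal (hlip j)
      _ ≤ ENNReal.ofReal (C * N * ‖x - y‖) := by
          rw [ENNReal.tsum_mul_right, ENNReal.ofReal_mul (by positivity : 0 ≤ C * N)]
          exact mul_le_mul_left hle _

/-- Each term of the square sum is bounded by the whole norm, and the gap a < s turns this into
summability through a geometric series. Only the L^∞L² part of X_j is used, as it gives information
at every single time. -/
theorem exists_besovNorm_le {a s : ℝ} (has : a < s) :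
    ∃ C : ℝ, 0 ≤ C ∧ ∀ (T : ℝ) (v : ℝ → Eu d → ℝ), ∀ t ∈ Icc 0 T,
      P.besovNorm a (v t) ≤ ENNReal.ofReal C * normL1X P T s v := by
  set r : ℝ≥0∞ := (2 : ℝ≥0∞) ^ (a - s) with hr
  have hr1 : r < 1 := ENNReal.rpow_lt_one_of_one_lt_of_neg (by norm_num) (by linarith)
  have hfin : (1 - r)⁻¹ ≠ ⊤ := by
    rw [ENNReal.inv_ne_top]
    exact (tsub_pos_of_lt hr1).ne'
  refine ⟨((1 - r)⁻¹).toReal, ENNReal.toReal_nonneg, fun T v t ht => ?_⟩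
  rw [ENNReal.ofReal_toReal hfin, ← ENNReal.tsum_geometric, ← ENNReal.tsum_mul_right, besovNorm]
  refine ENNReal.tsum_le_tsum fun j => ?_
  have h1 : ∑' m, P.cubeNorm j (v t) m ≤ ∑' m : Fin d → ℤ, normXj T j
      (fun t x => (P.cubeCutoff j m x : ℂ) * P.proj j (v t) x) :=
    ENNReal.tsum_le_tsum fun m => le_max_of_le_right
      (le_iSup₂ (f := fun t (_ : t ∈ Icc 0 T) =>
        eLpNorm (fun x => (P.cubeCutoff j m x : ℂ) * P.proj j (v t) x) 2 volume) t ht)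
  have h2 : (2 : ℝ≥0∞) ^ ((j : ℝ) * s) * ∑' m : Fin d → ℤ, normXj T j
      (fun t x => (P.cubeCutoff j m x : ℂ) * P.proj j (v t) x) ≤ normL1X P T s v := by
    rw [normL1X]
    set F : ℕ → ℝ≥0∞ := fun j => (2 : ℝ≥0∞) ^ ((j : ℝ) * s) * ∑' m : Fin d → ℤ, normXj T j
      (fun t x => (P.cubeCutoff j m x : ℂ) * P.proj j (v t) x) with hF
    calc F j = (F j ^ (2 : ℝ)) ^ (1 / 2 : ℝ) := by
          rw [← ENNReal.rpow_mul]; norm_num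
      _ ≤ _ := ENNReal.rpow_le_rpow (ENNReal.le_tsum (f := fun j => F j ^ (2 : ℝ)) j) (by norm_num)
  calc _ ≤ r ^ j * ((2 : ℝ≥0∞) ^ ((j : ℝ) * s) * ∑' m : Fin d → ℤ, normXj T j
        (fun t x => (P.cubeCutoff j m x : ℂ) * P.proj j (v t) x)) := by
        rw [← mul_assoc]
        refine mul_le_mul' (le_of_eq ?_) h1
        rw [hr, ← ENNReal.rpow_natCast, ← ENNReal.rpow_mul,
          ← ENNReal.rpow_add _ _ (by norm_num) (by norm_num)]
        congr 1
        ring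
    _ ≤ _ := mul_le_mul_right h2 _

end LPData

end LittlewoodPaley

/-! ### Bounds for the entries of an admissible metric -/

/-- Derivative bound from a bound on the function and on the oscillation of its derivative. -/
theorem norm_fderiv_le_of_abs_le {E : Type*} [NormedAddCommGroup E] [NormedSpace ℝ E]
    {h : E → ℝ} {h' : E → E →L[ℝ] ℝ} (hd : ∀ x, HasFDerivAt h (h' x) x) {B η : ℝ}
    (hη : 0 < η) (hh : ∀ x, |h x| ≤ B * η ^ 2) (hl : ∀ x y, ‖h' x - h' y‖ ≤ 2 * B * ‖x - y‖)
    (x : E) : ‖h' x‖ ≤ 4 * B * η := by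
  have hB : 0 ≤ B := by
    have := (abs_nonneg _).trans (hh x)
    by_contra hB
    nlinarith [pow_pos hη 2]
  refine ContinuousLinearMap.opNorm_le_of_unit_norm (by positivity) fun v hv => ?_
  -- Taylor expansion with step η: the remainder is at most 2Bη² and the two values at most Bη²
  -- each, so η|h'(x)v| ≤ 4Bη².
  have h1 : ‖h (x + η • v) - h x - h' x (x + η • v - x)‖ ≤ 2 * B * η * ‖x + η • v - x‖ := by
    refine (convex_closedBall x η).norm_image_sub_le_of_norm_hasFDerivWithin_le'
      (fun z _ => (hd z).hasFDerivWithinAt) (fun z hz => ?_) (Metric.mem_closedBall_self hη.le) ?_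
    · refine (hl z x).trans (mul_le_mul_of_nonneg_left ?_ (by positivity))
      simpa [dist_eq_norm] using hz
    · simp [norm_smul, hv, abs_of_pos hη]
  rw [add_sub_cancel_left, norm_smul, hv, mul_one, Real.norm_of_nonneg hη.le, map_smul,
    smul_eq_mul, Real.norm_eq_abs] at h1
  have h2 := hh (x + η • v)
  have h3 := hh x
  rw [abs_le] at h1 h2 h3
  rw [Real.norm_eq_abs, abs_le]
  constructor <;> nlinarith

theorem normL1X_le_matNormL1X {d : ℕ} (P : LPData d) (T s : ℝ) (h : MatField d) (i k : Fin d) :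
    normL1X P T s (fun t x => h t x i k) ≤ matNormL1X P T s h := by
  rw [matNormL1X]
  refine le_trans ?_ (Finset.single_le_sum
    (f := fun i => ∑ k, normL1X P T s (fun t x => h t x i k)) (fun _ _ => zero_le)
    (Finset.mem_univ i))
  exact Finset.single_le_sum (f := fun k => normL1X P T s (fun t x => h t x i k))
    (fun _ _ => zero_le) (Finset.mem_univ k)

/-- Bounds for a function with derivative `h'`, global with constant `A` and in the exterior of
the ball of radius `R` with constant `η`. -/
structure EntryBounds {d : ℕ} (A η R : ℝ) (h : Eu d → ℝ) (h' : Eu d → Eu d →L[ℝ] ℝ) : Prop where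
  hasFDerivAt : ∀ x, HasFDerivAt h (h' x) x
  abs_le : ∀ x, |h x| ≤ A
  norm_deriv_le : ∀ x, ‖h' x‖ ≤ A
  lipschitz : ∀ x y, ‖h' x - h' y‖ ≤ A * ‖x - y‖
  exterior : ∀ x, R < ‖x‖ → |h x| ≤ η
  curve : ∀ (γ : ℝ → Eu d) (a b : ℝ), Continuous γ →
    (∀ s ∈ Icc a b, ∀ s' ∈ Icc a b, |s - s'| ≤ ‖γ s - γ s'‖) →
    (∀ s ∈ Icc a b, R < ‖γ s‖) → ∫⁻ s in Icc a b, ‖h' (γ s)‖ₑ ≤ ENNReal.ofReal η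

/-- Both the entry of g - I and its representative are continuous, so they agree everywhere and the
global bounds follow. The exterior bounds come from the representative of a nearly optimal
extension. It agrees with the entry on the open set |x| > R, where therefore the derivatives agree
too. -/
theorem exists_entryBounds {d : ℕ} (P : LPData d) {s₀ : ℝ} (hs₀ : (d : ℝ) / 2 + 2 < s₀) :
    ∃ C : ℝ, 1 ≤ C ∧ ∀ (c₀ ε T M R L : ℝ) (g gt : MatField d), 0 < ε → 1 ≤ M →
      IsAdmissibleMetric P s₀ c₀ ε T M R L g gt → ∀ t ∈ Icc 0 T, ∀ i k,
        EntryBounds (C * M) (C * ε) R (fun x => g t x i k - (1 : Matrix (Fin d) (Fin d) ℝ) i k)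
          (fun x => fderiv ℝ (fun x => g t x i k) x) := by
  obtain ⟨C₁, hC₁0, hC₁⟩ := P.exists_regular_representative
  obtain ⟨C₂, hC₂0, hC₂⟩ := P.exists_besovNorm_le (a := 2 + d / 2) (s := s₀) (by linarith)
  have hCC : 0 ≤ C₁ * C₂ := by positivity
  refine ⟨16 * (C₁ * C₂) + 1, by linarith,
    fun c₀ ε T M R L g gt hε hM hg t ht i k => ?_⟩
  set h : Eu d → ℝ := fun x => g t x i k - (1 : Matrix (Fin d) (Fin d) ℝ) i k with hh
  have hgdiff : Differentiable ℝ (fun x => g t x i k) :=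
    (hg.smooth t ht i k).differentiable (by norm_num)
  have hhd : ∀ x, HasFDerivAt h (fderiv ℝ (fun x => g t x i k) x) x := fun x =>
    (hgdiff x).hasFDerivAt.sub_const _
  have hhc : Continuous h := continuous_iff_continuousAt.2 fun x => (hhd x).continuousAt
  have hL2 : MemLp h 2 volume := hg.memL2 t ht i k
  have hbes : P.besovNorm (2 + d / 2) h ≤ ENNReal.ofReal (C₂ * M) := by
    refine (hC₂ T (fun t x => (g t x - 1) i k) t ht).trans ?_
    rw [ENNReal.ofReal_mul hC₂0]
    refine mul_le_mul_right ((normL1X_le_matNormL1X P T s₀ (fun t x => g t x - 1) i k).trans ?_) _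
    exact le_self_add.trans hg.size
  obtain ⟨W, W', hW, hWd, hWb, hWb', -, hWl⟩ := hC₁ h hL2 (C₂ * M) (by positivity) hbes
  have hWc : Continuous W := continuous_iff_continuousAt.2 fun x => (hWd x).continuousAt
  have hhW : h = W := (hhc.ae_eq_iff_eq volume hWc).1 hW
  have hW' : ∀ x, fderiv ℝ (fun x => g t x i k) x = W' x := fun x => by
    have := hhd x
    rw [hhW] at this
    exact this.unique (hWd x)
  have hcM : C₁ * (C₂ * M) ≤ (16 * (C₁ * C₂) + 1) * M := by nlinarith [mul_nonneg hCC (by linarith : (0:ℝ) ≤ M)]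
  -- The infimum over extensions need not be attained; the factor 2 makes room for an extension
  -- below the bound.
  have hlt : matNormL1XExt P T s₀ R (fun t x => g t x - 1) < ENNReal.ofReal (2 * ε) :=
    hg.small.trans_lt ((ENNReal.ofReal_lt_ofReal_iff (by positivity)).2 (by linarith))
  simp only [matNormL1XExt, iInf_lt_iff] at hlt
  obtain ⟨u, huL2, hu, hun⟩ := hlt
  have hubes : P.besovNorm (2 + d / 2) (fun x => u t x i k) ≤ ENNReal.ofReal (C₂ * (2 * ε)) := by
    refine (hC₂ T (fun t x => u t x i k) t ht).trans ?_
    rw [ENNReal.ofReal_mul hC₂0]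
    exact mul_le_mul_right ((normL1X_le_matNormL1X P T s₀ u i k).trans hun.le) _
  obtain ⟨U, U', hU, hUd, hUb, -, hUg, -⟩ :=
    hC₁ _ (huL2 t ht i k) (C₂ * (2 * ε)) (by positivity) hubes
  have hUc : Continuous U := continuous_iff_continuousAt.2 fun x => (hUd x).continuousAt
  have hopen : IsOpen {x : Eu d | R < ‖x‖} := isOpen_lt continuous_const continuous_norm
  have hhU : EqOn h U {x : Eu d | R < ‖x‖} := by
    refine Measure.eqOn_open_of_ae_eq (μ := volume) ?_ hopen hhc.continuousOn hUc.continuousOn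
    rw [Filter.EventuallyEq, ae_restrict_iff' hopen.measurableSet]
    filter_upwards [hU] with x hx hxR
    rw [← hx, hu t ht x (le_of_lt hxR)]
    rfl
  have hU' : ∀ x : Eu d, R < ‖x‖ → fderiv ℝ (fun x => g t x i k) x = U' x := fun x hx =>
    (hhd x).unique ((hUd x).congr_of_eventuallyEq
      (hhU.eventuallyEq_of_mem (hopen.mem_nhds hx)))
  have hcε : 8 * (C₁ * (C₂ * (2 * ε))) ≤ (16 * (C₁ * C₂) + 1) * ε := by nlinarith
  have hcε0 : 0 ≤ C₁ * (C₂ * (2 * ε)) := by positivity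
  refine ⟨hhd, fun x => ?_, fun x => ?_, fun x y => ?_, fun x hx => ?_,
    fun γ a b hγ hexp hγR => ?_⟩
  · rw [hhW]
    exact (hWb x).trans hcM
  · rw [hW']
    exact (hWb' x).trans hcM
  · rw [hW', hW']
    exact (hWl x y).trans (mul_le_mul_of_nonneg_right hcM (norm_nonneg _))
  · rw [hhU hx]
    exact (hUb x).trans (by linarith)
  · calc ∫⁻ s in Icc a b, ‖fderiv ℝ (fun x => g t x i k) (γ s)‖ₑ
        ≤ ∫⁻ s in Icc a b, ENNReal.ofReal C₁ * P.gradSum (fun x => u t x i k) (γ s) := by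
          refine setLIntegral_mono' measurableSet_Icc fun s hs => ?_
          rw [hU' _ (hγR s hs)]
          exact hUg _
      _ = ENNReal.ofReal C₁ * ∫⁻ s in Icc a b, P.gradSum (fun x => u t x i k) (γ s) :=
          lintegral_const_mul' _ _ ENNReal.ofReal_ne_top
      _ ≤ ENNReal.ofReal C₁ * (8 * ENNReal.ofReal (C₂ * (2 * ε))) :=
          mul_le_mul_right ((P.lintegral_gradSum_comp_le _ hγ hexp).trans
            (mul_le_mul_right hubes _)) _
      _ ≤ ENNReal.ofReal ((16 * (C₁ * C₂) + 1) * ε) := by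
          rw [show (8 : ℝ≥0∞) = ENNReal.ofReal 8 by simp, ← ENNReal.ofReal_mul (by norm_num),
            ← ENNReal.ofReal_mul hC₁0]
          exact ENNReal.ofReal_le_ofReal (by linarith)

/-- At each time ∂_t g is O(M) for almost every x, since s₀ - 2 > d/2. Fubini exchanges the
quantifiers over time and space, integration in time gives the estimate for almost every x, and
continuity in x removes the null set. -/
theorem exists_time_lipschitz {d : ℕ} (P : LPData d) {s₀ : ℝ} (hs₀ : (d : ℝ) / 2 + 2 < s₀) :
    ∃ C : ℝ, 0 ≤ C ∧ ∀ (c₀ ε T M R L : ℝ) (g gt : MatField d), 1 ≤ M →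
      IsAdmissibleMetric P s₀ c₀ ε T M R L g gt → ∀ t ∈ Icc 0 T, ∀ r ∈ Icc 0 T, ∀ i k x,
        |g t x i k - g r x i k| ≤ C * M * |t - r| := by
  obtain ⟨C₁, hC₁0, hC₁⟩ := P.exists_ae_abs_le
  obtain ⟨C₂, hC₂0, hC₂⟩ := P.exists_besovNorm_le (a := d / 2) (s := s₀ - 2) (by linarith)
  refine ⟨C₁ * C₂, by positivity, fun c₀ ε T M R L g gt hM hg t ht r hr i k => ?_⟩
  have hb : ∀ τ ∈ Icc 0 T, ∀ᵐ x, |gt τ x i k| ≤ C₁ * (C₂ * M) := by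
    intro τ hτ
    refine hC₁ _ (hg.memL2_deriv τ hτ i k) (C₂ * M) (by positivity) ?_
    refine (hC₂ T (fun t x => gt t x i k) τ hτ).trans ?_
    rw [ENNReal.ofReal_mul hC₂0]
    exact mul_le_mul_right ((normL1X_le_matNormL1X P T (s₀ - 2) gt i k).trans
      (le_add_self.trans hg.size)) _
  obtain ⟨hmeas, hint⟩ := hg.timeDeriv i k
  have hms : MeasurableSet {p : ℝ × Eu d | |gt p.1 p.2 i k| ≤ C₁ * (C₂ * M)} :=
    measurableSet_le (hmeas.norm) measurable_const
  have hae : ∀ᵐ x : Eu d, ∀ᵐ τ ∂(volume.restrict (Icc 0 T)), |gt τ x i k| ≤ C₁ * (C₂ * M) := by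
    rw [← Measure.ae_ae_comm hms, ae_restrict_iff' measurableSet_Icc]
    exact ae_of_all _ hb
  have hfin : ∀ᵐ x : Eu d, |g t x i k - g r x i k| ≤ C₁ * C₂ * M * |t - r| := by
    filter_upwards [hae, hint] with x hx hx2
    rw [(hx2 r hr t ht).2, mul_assoc C₁ C₂ M]
    rw [← Real.norm_eq_abs]
    refine intervalIntegral.norm_integral_le_of_norm_le_const_ae ?_
    rw [ae_restrict_iff' measurableSet_Icc] at hx
    filter_upwards [hx] with τ hτ hτm
    refine hτ ?_
    rcases (mem_uIoc.1 hτm) with h | h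
    · exact ⟨hr.1.trans h.1.le, h.2.trans ht.2⟩
    · exact ⟨ht.1.trans h.1.le, h.2.trans hr.2⟩
  have hcl : IsClosed {x : Eu d | |g t x i k - g r x i k| ≤ C₁ * C₂ * M * |t - r|} :=
    isClosed_le (((hg.smooth t ht i k).continuous.sub (hg.smooth r hr i k).continuous).abs)
      continuous_const
  intro x
  have hd : Dense {x : Eu d | |g t x i k - g r x i k| ≤ C₁ * C₂ * M * |t - r|} :=
    Measure.dense_of_ae hfin
  have : x ∈ closure {x : Eu d | |g t x i k - g r x i k| ≤ C₁ * C₂ * M * |t - r|} := hd x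
  rwa [hcl.closure_eq] at this

/-- The time regularity of the entries and their gradients, with the space regularity. -/
theorem exists_metric_bounds {d : ℕ} (P : LPData d) {s₀ : ℝ} (hs₀ : (d : ℝ) / 2 + 2 < s₀) :
    ∃ C : ℝ, 1 ≤ C ∧ ∀ (c₀ ε T M R L : ℝ) (g gt : MatField d), 0 < ε → 1 ≤ M →
      IsAdmissibleMetric P s₀ c₀ ε T M R L g gt →
      (∀ t ∈ Icc 0 T, ∀ i k,
        EntryBounds (C * M) (C * ε) R (fun x => g t x i k - (1 : Matrix (Fin d) (Fin d) ℝ) i k)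
          (fun x => fderiv ℝ (fun x => g t x i k) x)) ∧
      (∀ t ∈ Icc 0 T, ∀ r ∈ Icc 0 T, ∀ i k x, |g t x i k - g r x i k| ≤ C * M * |t - r|) ∧
      (∀ t ∈ Icc 0 T, ∀ r ∈ Icc 0 T, ∀ i k x,
        ‖fderiv ℝ (fun x => g t x i k) x - fderiv ℝ (fun x => g r x i k) x‖ ≤
          C * M * √|t - r|) := by
  obtain ⟨C₁, hC₁1, hC₁⟩ := exists_entryBounds P hs₀
  obtain ⟨C₂, hC₂0, hC₂⟩ := exists_time_lipschitz P hs₀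
  refine ⟨4 * (C₁ + C₂), by linarith, fun c₀ ε T M R L g gt hε hM hg => ⟨?_, ?_, ?_⟩⟩
  · intro t ht i k
    have h := hC₁ c₀ ε T M R L g gt hε hM hg t ht i k
    have hA : C₁ * M ≤ 4 * (C₁ + C₂) * M := by nlinarith
    have hη : C₁ * ε ≤ 4 * (C₁ + C₂) * ε := by nlinarith
    exact ⟨h.hasFDerivAt, fun x => (h.abs_le x).trans hA, fun x => (h.norm_deriv_le x).trans hA,
      fun x y => (h.lipschitz x y).trans (mul_le_mul_of_nonneg_right hA (norm_nonneg _)),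
      fun x hx => (h.exterior x hx).trans hη,
      fun γ a b h1 h2 h3 => (h.curve γ a b h1 h2 h3).trans (ENNReal.ofReal_le_ofReal hη)⟩
  · intro t ht r hr i k x
    refine (hC₂ c₀ ε T M R L g gt hM hg t ht r hr i k x).trans ?_
    refine mul_le_mul_of_nonneg_right ?_ (abs_nonneg _)
    nlinarith
  · intro t ht r hr i k x
    rcases eq_or_ne t r with rfl | hne
    · simp
    have h1 := hC₁ c₀ ε T M R L g gt hε hM hg t ht i k
    have h2 := hC₁ c₀ ε T M R L g gt hε hM hg r hr i k
    have hpos : 0 < |t - r| := abs_pos.2 (sub_ne_zero.2 hne)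
    -- Interpolation at scale √|t - r|: the difference of two time slices is O(M|t - r|) and its
    -- gradient is O(M)-Lipschitz, so the gradient is O(M√|t - r|).
    have := norm_fderiv_le_of_abs_le (B := (C₁ + C₂) * M) (η := √|t - r|)
      (h := fun x => (g t x i k - (1 : Matrix (Fin d) (Fin d) ℝ) i k) -
        (g r x i k - (1 : Matrix (Fin d) (Fin d) ℝ) i k))
      (fun x => (h1.hasFDerivAt x).sub (h2.hasFDerivAt x)) (Real.sqrt_pos.2 hpos)
      (fun x => ?_) (fun x y => ?_) x
    · refine this.trans (le_of_eq (by ring))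
    · rw [Real.sq_sqrt hpos.le, sub_sub_sub_cancel_right]
      refine (hC₂ c₀ ε T M R L g gt hM hg t ht r hr i k x).trans ?_
      refine mul_le_mul_of_nonneg_right ?_ (abs_nonneg _)
      nlinarith
    · rw [sub_sub_sub_comm]
      refine (norm_sub_le _ _).trans ?_
      have h3 := h1.lipschitz x y
      have h4 := h2.lipschitz x y
      have h5 : 0 ≤ C₂ * M * ‖x - y‖ := by positivity
      linarith

/-! ### The Hamilton field of an admissible metric -/

/-- Quantitative properties of the components `X = a_ξ`, `Y = a_x` of the Hamilton field of a
metric that is a small perturbation of the flat metric in the exterior of a ball. -/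
structure HamiltonBounds {E : Type*} [NormedAddCommGroup E] [InnerProductSpace ℝ E]
    (X Y : E → E → E) (Λ c η R : ℝ) : Prop where
  lip_X : ∀ x x' ξ ξ', ‖ξ‖ ≤ 1 → ‖ξ'‖ ≤ 1 → ‖X x ξ - X x' ξ'‖ ≤ Λ * (‖x - x'‖ + ‖ξ - ξ'‖)
  lip_Y : ∀ x x' ξ ξ', ‖ξ‖ ≤ 1 → ‖ξ'‖ ≤ 1 → ‖Y x ξ - Y x' ξ'‖ ≤ Λ * (‖x - x'‖ + ‖ξ - ξ'‖)
  norm_X_le : ∀ x ξ, ‖ξ‖ ≤ 1 → ‖X x ξ‖ ≤ Λ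
  norm_Y_le : ∀ x ξ, ‖ξ‖ ≤ 1 → ‖Y x ξ‖ ≤ Λ
  inner_X : ∀ x ξ, ‖ξ‖ = 1 → 2 * c ≤ inner ℝ (X x ξ) ξ
  X_neg : ∀ x ξ, X x (-ξ) = -X x ξ
  Y_neg : ∀ x ξ, Y x (-ξ) = Y x ξ
  exterior : ∀ x ξ, R < ‖x‖ → ‖ξ‖ ≤ 1 → ‖X x ξ - (2 : ℝ) • ξ‖ ≤ η
  curve : ∀ (γ ζ : ℝ → E) (a b : ℝ), Continuous γ → (∀ s, ‖ζ s‖ ≤ 1) →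
    (∀ s ∈ Icc a b, ∀ s' ∈ Icc a b, |s - s'| ≤ ‖γ s - γ s'‖) →
    (∀ s ∈ Icc a b, R < ‖γ s‖) → ∫⁻ s in Icc a b, ‖Y (γ s) (ζ s)‖ₑ ≤ ENNReal.ofReal η

theorem norm_le_of_forall_inner_le {E : Type*} [NormedAddCommGroup E] [InnerProductSpace ℝ E]
    {w : E} {C : ℝ} (hC : 0 ≤ C) (h : ∀ v, inner ℝ w v ≤ C * ‖v‖) : ‖w‖ ≤ C := by
  rcases eq_or_ne w 0 with rfl | hw
  · simpa using hC
  · have h1 := h w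
    rw [real_inner_self_eq_norm_sq] at h1
    have := norm_pos_iff.2 hw
    nlinarith

theorem sum_sum_le_of_abs_le {d : ℕ} {a : Fin d → Fin d → ℝ} {b : ℝ}
    (h : ∀ i k, |a i k| ≤ b) : ∑ i, ∑ k, a i k ≤ (d : ℝ) ^ 2 * b := by
  calc ∑ i, ∑ k, a i k ≤ ∑ _i : Fin d, ∑ _k : Fin d, b :=
        Finset.sum_le_sum fun i _ => Finset.sum_le_sum fun k _ => (le_abs_self _).trans (h i k)
    _ = _ := by simp [pow_two, mul_assoc]

theorem inner_gradient_eq {E : Type*} [NormedAddCommGroup E] [InnerProductSpace ℝ E]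
    [CompleteSpace E] (f : E → ℝ) (x v : E) : inner ℝ (gradient f x) v = fderiv ℝ f x v := by
  rw [gradient, InnerProductSpace.toDual_symm_apply]

theorem hasFDerivAt_princSymbol_xi {d : ℕ} (G : Eu d → Matrix (Fin d) (Fin d) ℝ) (x ξ : Eu d) :
    HasFDerivAt (fun η => princSymbol G x η)
      (∑ i, ∑ k, G x i k • (ξ k • (EuclideanSpace.proj i : Eu d →L[ℝ] ℝ) +
        ξ i • (EuclideanSpace.proj k : Eu d →L[ℝ] ℝ))) ξ := by
  unfold princSymbol
  refine HasFDerivAt.fun_sum fun i _ => HasFDerivAt.fun_sum fun k _ => ?_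
  have hi : HasFDerivAt (fun η : Eu d => η i) (EuclideanSpace.proj i : Eu d →L[ℝ] ℝ) ξ :=
    (EuclideanSpace.proj i : Eu d →L[ℝ] ℝ).hasFDerivAt
  have hk : HasFDerivAt (fun η : Eu d => η k) (EuclideanSpace.proj k : Eu d →L[ℝ] ℝ) ξ :=
    (EuclideanSpace.proj k : Eu d →L[ℝ] ℝ).hasFDerivAt
  refine ((hi.const_mul (G x i k)).fun_mul hk).congr_fderiv ?_
  ext v
  simp
  ring

theorem inner_gradXi_princSymbol {d : ℕ} (G : Eu d → Matrix (Fin d) (Fin d) ℝ) (x ξ v : Eu d) :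
    inner ℝ (gradXi (princSymbol G) x ξ) v =
      ∑ i, ∑ k, G x i k * (ξ k * v i + ξ i * v k) := by
  rw [gradXi, inner_gradient_eq, (hasFDerivAt_princSymbol_xi G x ξ).fderiv]
  simp [mul_add]

theorem inner_gradX_princSymbol {d : ℕ} (G : Eu d → Matrix (Fin d) (Fin d) ℝ) (x ξ v : Eu d)
    (hG : ∀ i k, DifferentiableAt ℝ (fun x => G x i k) x) :
    inner ℝ (gradX (princSymbol G) x ξ) v =
      ∑ i, ∑ k, fderiv ℝ (fun x => G x i k) x v * (ξ i * ξ k) := by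
  have h : HasFDerivAt (fun y => princSymbol G y ξ)
      (∑ i, ∑ k, (ξ i * ξ k) • fderiv ℝ (fun x => G x i k) x) x := by
    unfold princSymbol
    refine HasFDerivAt.fun_sum fun i _ => HasFDerivAt.fun_sum fun k _ => ?_
    refine (((hG i k).hasFDerivAt.mul_const (ξ i)).mul_const (ξ k)).congr_fderiv ?_
    ext w
    simp
    ring
  rw [gradX, inner_gradient_eq, h.fderiv]
  simp [mul_comm]

theorem abs_mul_add_mul_le {d : ℕ} (ξ v : Eu d) (i k : Fin d) :
    |ξ k * v i + ξ i * v k| ≤ 2 * (‖ξ‖ * ‖v‖) := by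
  have h : ∀ (w : Eu d) (i : Fin d), |w i| ≤ ‖w‖ := fun w i => by
    simpa using PiLp.norm_apply_le w i
  refine (abs_add_le _ _).trans ?_
  rw [abs_mul, abs_mul, two_mul]
  exact add_le_add (mul_le_mul (h _ _) (h _ _) (abs_nonneg _) (norm_nonneg _))
    (mul_le_mul (h _ _) (h _ _) (abs_nonneg _) (norm_nonneg _))

theorem abs_mul_coord_le {d : ℕ} (ξ v : Eu d) (i k : Fin d) : |ξ i * v k| ≤ ‖ξ‖ * ‖v‖ := by
  have h : ∀ (w : Eu d) (i : Fin d), |w i| ≤ ‖w‖ := fun w i => by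
    simpa using PiLp.norm_apply_le w i
  rw [abs_mul]
  exact mul_le_mul (h _ _) (h _ _) (abs_nonneg _) (norm_nonneg _)

theorem two_mul_inner_eq_sum {d : ℕ} (ξ v : Eu d) :
    2 * inner ℝ ξ v =
      ∑ i, ∑ k, (1 : Matrix (Fin d) (Fin d) ℝ) i k * (ξ k * v i + ξ i * v k) := by
  rw [PiLp.inner_apply, Finset.mul_sum]
  refine Finset.sum_congr rfl fun i _ => ?_
  rw [Finset.sum_eq_single i (fun k _ hk => by simp [Matrix.one_apply_ne hk.symm]) (by simp)]
  simp
  ring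

/-! ### From bounds on the entries to bounds on the Hamilton field -/

section HamiltonBounds

variable {d : ℕ} {A η R c : ℝ} {G : Eu d → Matrix (Fin d) (Fin d) ℝ}

theorem EntryBounds.differentiableAt
    (h : ∀ i k, EntryBounds A η R (fun x => G x i k - (1 : Matrix (Fin d) (Fin d) ℝ) i k)
      (fun x => fderiv ℝ (fun x => G x i k) x)) (i k : Fin d) (x : Eu d) :
    DifferentiableAt ℝ (fun x => G x i k) x := by
  have := ((h i k).hasFDerivAt x).add_const ((1 : Matrix (Fin d) (Fin d) ℝ) i k)
  simp only [sub_add_cancel] at this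
  exact this.differentiableAt

/-- All norms are estimated by duality: the pairing with a vector v is a double sum over the
entries, which accounts for the factors d². -/
theorem hamiltonBounds_of_entryBounds (hA : 1 ≤ A) (hη : 0 ≤ η)
    (h : ∀ i k, EntryBounds A η R (fun x => G x i k - (1 : Matrix (Fin d) (Fin d) ℝ) i k)
      (fun x => fderiv ℝ (fun x => G x i k) x))
    (hell : ∀ x ξ : Eu d, c * ‖ξ‖ ^ 2 ≤ princSymbol G x ξ) :
    HamiltonBounds (gradXi (princSymbol G)) (gradX (princSymbol G)) (4 * d ^ 2 * A) c
      (2 * d ^ 2 * η) R := by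
  have hdiff := EntryBounds.differentiableAt h
  have hGb : ∀ i k x, |G x i k| ≤ 2 * A := by
    intro i k x
    have h1 := (h i k).abs_le x
    have h2 : |(1 : Matrix (Fin d) (Fin d) ℝ) i k| ≤ 1 := by
      rw [Matrix.one_apply]
      split_ifs <;> simp
    have := abs_sub_abs_le_abs_sub (G x i k) ((1 : Matrix (Fin d) (Fin d) ℝ) i k)
    linarith
  have hGl : ∀ i k x x', |G x i k - G x' i k| ≤ A * ‖x - x'‖ := by
    intro i k x x'
    exact convex_univ.norm_image_sub_le_of_norm_hasFDerivWithin_le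
      (fun z _ => (hdiff i k z).hasFDerivAt.hasFDerivWithinAt)
      (fun z _ => (h i k).norm_deriv_le z) (mem_univ _) (mem_univ _)
  have hd2 : (0 : ℝ) ≤ (d : ℝ) ^ 2 := by positivity
  have hYn : ∀ x ξ, ‖ξ‖ ≤ 1 → ‖gradX (princSymbol G) x ξ‖ ≤
      ∑ i, ∑ k, ‖fderiv ℝ (fun x => G x i k) x‖ := by
    intro x ξ hξ
    refine norm_le_of_forall_inner_le (by positivity) fun v => ?_
    rw [inner_gradX_princSymbol G x ξ v fun i k => hdiff i k x, Finset.sum_mul]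
    refine Finset.sum_le_sum fun i _ => ?_
    rw [Finset.sum_mul]
    refine Finset.sum_le_sum fun k _ => (le_abs_self _).trans ?_
    rw [abs_mul]
    have h1 := abs_mul_coord_le ξ ξ i k
    have h2 : |fderiv ℝ (fun x => G x i k) x v| ≤ ‖fderiv ℝ (fun x => G x i k) x‖ * ‖v‖ := by
      rw [← Real.norm_eq_abs]
      exact ContinuousLinearMap.le_opNorm _ v
    have h3 : |ξ i * ξ k| ≤ 1 := h1.trans (by nlinarith [norm_nonneg ξ])
    calc _ ≤ ‖fderiv ℝ (fun x => G x i k) x‖ * ‖v‖ * 1 :=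
          mul_le_mul h2 h3 (abs_nonneg _) (by positivity)
      _ = _ := mul_one _
  refine ⟨fun x x' ξ ξ' hξ hξ' => ?_, fun x x' ξ ξ' hξ hξ' => ?_, fun x ξ hξ => ?_,
    fun x ξ hξ => ?_, fun x ξ hξ => ?_, fun x ξ => ?_, fun x ξ => ?_, fun x ξ hx hξ => ?_,
    fun γ ζ a b hγ hζ hexp hR => ?_⟩
  · refine norm_le_of_forall_inner_le (by positivity) fun v => ?_
    rw [inner_sub_left, inner_gradXi_princSymbol, inner_gradXi_princSymbol,
      ← Finset.sum_sub_distrib]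
    simp only [← Finset.sum_sub_distrib]
    refine (sum_sum_le_of_abs_le
      (b := A * ‖x - x'‖ * (2 * ‖v‖) + 2 * A * (2 * (‖ξ - ξ'‖ * ‖v‖))) fun i k => ?_).trans ?_
    · have e : G x i k * (ξ k * v i + ξ i * v k) - G x' i k * (ξ' k * v i + ξ' i * v k) =
          (G x i k - G x' i k) * (ξ k * v i + ξ i * v k) +
          G x' i k * ((ξ - ξ') k * v i + (ξ - ξ') i * v k) := by
        simp only [PiLp.sub_apply]; ring
      rw [e]
      refine (abs_add_le _ _).trans (add_le_add ?_ ?_)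
      · rw [abs_mul]
        refine mul_le_mul (hGl i k x x') ((abs_mul_add_mul_le ξ v i k).trans ?_) (abs_nonneg _)
          (by positivity)
        nlinarith [norm_nonneg v]
      · rw [abs_mul]
        exact mul_le_mul (hGb i k x') (abs_mul_add_mul_le _ v i k) (abs_nonneg _) (by positivity)
    · have : 0 ≤ (d : ℝ) ^ 2 * A * ‖x - x'‖ * ‖v‖ := by positivity
      nlinarith
  · refine norm_le_of_forall_inner_le (by positivity) fun v => ?_
    rw [inner_sub_left, inner_gradX_princSymbol G x ξ v fun i k => hdiff i k x,
      inner_gradX_princSymbol G x' ξ' v fun i k => hdiff i k x', ← Finset.sum_sub_distrib]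
    simp only [← Finset.sum_sub_distrib]
    refine (sum_sum_le_of_abs_le
      (b := A * ‖x - x'‖ * ‖v‖ + A * ‖v‖ * (2 * ‖ξ - ξ'‖)) fun i k => ?_).trans ?_
    · have e : fderiv ℝ (fun x => G x i k) x v * (ξ i * ξ k) -
          fderiv ℝ (fun x => G x i k) x' v * (ξ' i * ξ' k) =
          (fderiv ℝ (fun x => G x i k) x - fderiv ℝ (fun x => G x i k) x') v * (ξ i * ξ k) +
          fderiv ℝ (fun x => G x i k) x' v *
            ((ξ - ξ') i * ξ k + ξ' i * (ξ - ξ') k) := by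
        simp only [PiLp.sub_apply, _root_.sub_apply]; ring
      rw [e]
      refine (abs_add_le _ _).trans (add_le_add ?_ ?_)
      · rw [abs_mul]
        have h1 : |(fderiv ℝ (fun x => G x i k) x - fderiv ℝ (fun x => G x i k) x') v| ≤
            A * ‖x - x'‖ * ‖v‖ :=
          (ContinuousLinearMap.le_opNorm _ v).trans
            (mul_le_mul_of_nonneg_right ((h i k).lipschitz x x') (norm_nonneg _))
        have h2 : |ξ i * ξ k| ≤ 1 :=
          (abs_mul_coord_le ξ ξ i k).trans (by nlinarith [norm_nonneg ξ])
        calc _ ≤ A * ‖x - x'‖ * ‖v‖ * 1 := mul_le_mul h1 h2 (abs_nonneg _) (by positivity)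
          _ = _ := mul_one _
      · rw [abs_mul]
        refine mul_le_mul ((ContinuousLinearMap.le_opNorm _ v).trans
          (mul_le_mul_of_nonneg_right ((h i k).norm_deriv_le x') (norm_nonneg _))) ?_
          (abs_nonneg _) (by positivity)
        refine (abs_add_le _ _).trans ?_
        have h1 := abs_mul_coord_le (ξ - ξ') ξ i k
        have h2 := abs_mul_coord_le ξ' (ξ - ξ') i k
        nlinarith [norm_nonneg (ξ - ξ')]
    · have h1 : 0 ≤ (d : ℝ) ^ 2 * A * ‖x - x'‖ * ‖v‖ := by positivity
      have h2 : 0 ≤ (d : ℝ) ^ 2 * A * ‖ξ - ξ'‖ * ‖v‖ := by positivity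
      nlinarith
  · refine norm_le_of_forall_inner_le (by positivity) fun v => ?_
    rw [inner_gradXi_princSymbol]
    refine (sum_sum_le_of_abs_le (b := 2 * A * (2 * ‖v‖)) fun i k => ?_).trans
      (le_of_eq (by ring))
    rw [abs_mul]
    refine mul_le_mul (hGb i k x) ((abs_mul_add_mul_le ξ v i k).trans ?_) (abs_nonneg _)
      (by positivity)
    nlinarith [norm_nonneg v]
  · refine (hYn x ξ hξ).trans ((sum_sum_le_of_abs_le (b := A) fun i k => ?_).trans ?_)
    · rw [abs_of_nonneg (norm_nonneg _)]
      exact (h i k).norm_deriv_le x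
    · nlinarith
  · have h1 := hell x ξ
    rw [hξ] at h1
    -- Euler's identity for the quadratic form; with ellipticity it bounds the speed from below by
    -- 2c.
    have h2 : inner ℝ (gradXi (princSymbol G) x ξ) ξ = 2 * princSymbol G x ξ := by
      rw [inner_gradXi_princSymbol, princSymbol, Finset.mul_sum]
      refine Finset.sum_congr rfl fun i _ => ?_
      rw [Finset.mul_sum]
      exact Finset.sum_congr rfl fun k _ => by ring
    rw [h2]
    linarith
  · refine ext_inner_right ℝ fun v => ?_
    rw [inner_neg_left, inner_gradXi_princSymbol, inner_gradXi_princSymbol,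
      ← Finset.sum_neg_distrib]
    refine Finset.sum_congr rfl fun i _ => ?_
    rw [← Finset.sum_neg_distrib]
    refine Finset.sum_congr rfl fun k _ => ?_
    simp only [PiLp.neg_apply]
    ring
  · refine ext_inner_right ℝ fun v => ?_
    rw [inner_gradX_princSymbol G x _ v fun i k => hdiff i k x,
      inner_gradX_princSymbol G x ξ v fun i k => hdiff i k x]
    simp
  · refine norm_le_of_forall_inner_le (by positivity) fun v => ?_
    rw [inner_sub_left, real_inner_smul_left, inner_gradXi_princSymbol, two_mul_inner_eq_sum,
      ← Finset.sum_sub_distrib]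
    simp only [← Finset.sum_sub_distrib, ← sub_mul]
    refine (sum_sum_le_of_abs_le (b := η * (2 * ‖v‖)) fun i k => ?_).trans (le_of_eq (by ring))
    rw [abs_mul]
    refine mul_le_mul ((h i k).exterior x hx) ((abs_mul_add_mul_le ξ v i k).trans ?_)
      (abs_nonneg _) hη
    nlinarith [norm_nonneg v]
  · have hcont : ∀ i k, Continuous fun s => fderiv ℝ (fun x => G x i k) (γ s) := fun i k => by
      have hl : LipschitzWith (Real.toNNReal A) fun x => fderiv ℝ (fun x => G x i k) x :=
        LipschitzWith.of_dist_le_mul fun x y => by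
          rw [dist_eq_norm, dist_eq_norm, Real.coe_toNNReal _ (by linarith)]
          exact (h i k).lipschitz x y
      exact hl.continuous.comp hγ
    calc ∫⁻ s in Icc a b, ‖gradX (princSymbol G) (γ s) (ζ s)‖ₑ
        ≤ ∫⁻ s in Icc a b, ∑ i, ∑ k, ‖fderiv ℝ (fun x => G x i k) (γ s)‖ₑ := by
          refine lintegral_mono fun s => ?_
          rw [← ofReal_norm]
          refine (ENNReal.ofReal_le_ofReal (hYn _ _ (hζ s))).trans (le_of_eq ?_)
          rw [ENNReal.ofReal_sum_of_nonneg fun i _ => by positivity]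
          refine Finset.sum_congr rfl fun i _ => ?_
          rw [ENNReal.ofReal_sum_of_nonneg fun i _ => by positivity]
          exact Finset.sum_congr rfl fun k _ => ofReal_norm _
      _ = ∑ i, ∑ k, ∫⁻ s in Icc a b, ‖fderiv ℝ (fun x => G x i k) (γ s)‖ₑ := by
          rw [lintegral_finsetSum _ fun i _ => Finset.measurable_sum _ fun k _ =>
            (hcont i k).enorm.measurable]
          refine Finset.sum_congr rfl fun i _ => ?_
          rw [lintegral_finsetSum _ fun k _ => (hcont i k).enorm.measurable]
      _ ≤ ∑ _i : Fin d, ∑ _k : Fin d, ENNReal.ofReal η :=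
          Finset.sum_le_sum fun i _ => Finset.sum_le_sum fun k _ =>
            (h i k).curve γ a b hγ hexp hR
      _ ≤ ENNReal.ofReal (2 * d ^ 2 * η) := by
          simp only [Finset.sum_const, Finset.card_univ, Fintype.card_fin, nsmul_eq_mul]
          rw [← ENNReal.ofReal_natCast, ← ENNReal.ofReal_mul (by positivity),
            ← ENNReal.ofReal_mul (by positivity)]
          refine ENNReal.ofReal_le_ofReal ?_
          have : 0 ≤ (d : ℝ) ^ 2 * η := by positivity
          nlinarith

theorem norm_gradXi_sub_le {G' : Eu d → Matrix (Fin d) (Fin d) ℝ} {x ξ : Eu d} {B : ℝ}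
    (hB : ∀ i k, |G x i k - G' x i k| ≤ B) (hB0 : 0 ≤ B) (hξ : ‖ξ‖ ≤ 1) :
    ‖gradXi (princSymbol G) x ξ - gradXi (princSymbol G') x ξ‖ ≤ 2 * d ^ 2 * B := by
  refine norm_le_of_forall_inner_le (by positivity) fun v => ?_
  rw [inner_sub_left, inner_gradXi_princSymbol, inner_gradXi_princSymbol,
    ← Finset.sum_sub_distrib]
  simp only [← Finset.sum_sub_distrib, ← sub_mul]
  refine (sum_sum_le_of_abs_le (b := B * (2 * ‖v‖)) fun i k => ?_).trans (le_of_eq (by ring))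
  rw [abs_mul]
  refine mul_le_mul (hB i k) ((abs_mul_add_mul_le ξ v i k).trans ?_) (abs_nonneg _) hB0
  nlinarith [norm_nonneg v]

theorem norm_gradX_sub_le {G' : Eu d → Matrix (Fin d) (Fin d) ℝ} {x ξ : Eu d} {B : ℝ}
    (hG : ∀ i k, DifferentiableAt ℝ (fun x => G x i k) x)
    (hG' : ∀ i k, DifferentiableAt ℝ (fun x => G' x i k) x)
    (hB : ∀ i k, ‖fderiv ℝ (fun x => G x i k) x - fderiv ℝ (fun x => G' x i k) x‖ ≤ B)
    (hB0 : 0 ≤ B) (hξ : ‖ξ‖ ≤ 1) :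
    ‖gradX (princSymbol G) x ξ - gradX (princSymbol G') x ξ‖ ≤ d ^ 2 * B := by
  refine norm_le_of_forall_inner_le (by positivity) fun v => ?_
  rw [inner_sub_left, inner_gradX_princSymbol G x ξ v hG, inner_gradX_princSymbol G' x ξ v hG',
    ← Finset.sum_sub_distrib]
  simp only [← Finset.sum_sub_distrib, ← sub_mul, ← _root_.sub_apply]
  refine (sum_sum_le_of_abs_le (b := B * ‖v‖) fun i k => ?_).trans (le_of_eq (by ring))
  rw [abs_mul]
  have h1 : |(fderiv ℝ (fun x => G x i k) x - fderiv ℝ (fun x => G' x i k) x) v| ≤ B * ‖v‖ :=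
    by
    rw [← Real.norm_eq_abs]
    exact (ContinuousLinearMap.le_opNorm _ v).trans
      (mul_le_mul_of_nonneg_right (hB i k) (norm_nonneg _))
  have h2 : |ξ i * ξ k| ≤ 1 := (abs_mul_coord_le ξ ξ i k).trans (by nlinarith [norm_nonneg ξ])
  calc _ ≤ B * ‖v‖ * 1 := mul_le_mul h1 h2 (abs_nonneg _) (by positivity)
    _ = _ := mul_one _

end HamiltonBounds

/-! ### Global flows of bounded Lipschitz fields -/

theorem HasDerivAt.comp_neg_arg {G : Type*} [NormedAddCommGroup G] [NormedSpace ℝ G] {f : ℝ → G}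
    {f' : G} {s : ℝ} (h : HasDerivAt f f' (-s)) : HasDerivAt (fun s => f (-s)) (-f') s := by
  have h2 := h.scomp s (hasDerivAt_neg s)
  rw [neg_one_smul] at h2
  exact h2

section GlobalFlow

variable {G : Type*} [NormedAddCommGroup G] [NormedSpace ℝ G] {V : G → G} {K : NNReal} {B : ℝ}

theorem LipschitzWith.dist_le_of_hasDerivAt (hV : LipschitzWith K V) {f g : ℝ → G}
    (hf : ∀ s, HasDerivAt f (V (f s)) s) (hg : ∀ s, HasDerivAt g (V (g s)) s) (s : ℝ) :
    dist (f s) (g s) ≤ Real.exp (K * |s|) * dist (f 0) (g 0) := by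
  have key : ∀ (V : G → G), LipschitzWith K V → ∀ f g : ℝ → G, (∀ s, HasDerivAt f (V (f s)) s) →
      (∀ s, HasDerivAt g (V (g s)) s) → ∀ s, 0 ≤ s →
      dist (f s) (g s) ≤ Real.exp (K * s) * dist (f 0) (g 0) := by
    intro V hV f g hf hg s hs
    have h := dist_le_of_trajectories_ODE (v := fun _ => V) (K := K) (f := f) (g := g) (a := 0)
      (b := s) (δ := dist (f 0) (g 0)) (fun _ => hV)
      (continuous_iff_continuousAt.2 fun s => (hf s).continuousAt).continuousOn
      (fun t _ => (hf t).hasDerivWithinAt)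
      (continuous_iff_continuousAt.2 fun s => (hg s).continuousAt).continuousOn
      (fun t _ => (hg t).hasDerivWithinAt) le_rfl s ⟨hs, le_rfl⟩
    rwa [sub_zero, mul_comm] at h
  rcases le_total 0 s with hs | hs
  · rw [abs_of_nonneg hs]
    exact key V hV f g hf hg s hs
  · have hneg : ∀ f : ℝ → G, (∀ s, HasDerivAt f (V (f s)) s) →
        ∀ s, HasDerivAt (fun s => f (-s)) (-V (f (-s))) s := fun f hf s =>
      (hf (-s)).comp_neg_arg
    have h := key (fun z => -V z) hV.neg (fun s => f (-s)) (fun s => g (-s)) (hneg f hf)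
      (hneg g hg) (-s) (by linarith)
    rw [abs_of_nonpos hs]
    simpa using h

theorem LipschitzWith.eq_of_hasDerivAt (hV : LipschitzWith K V) {f g : ℝ → G}
    (hf : ∀ s, HasDerivAt f (V (f s)) s) (hg : ∀ s, HasDerivAt g (V (g s)) s)
    (h0 : f 0 = g 0) : f = g := by
  funext s
  have h := hV.dist_le_of_hasDerivAt hf hg s
  rw [h0, dist_self, mul_zero] at h
  exact dist_le_zero.1 h

/-- A bounded field admits Picard-Lindelöf solutions on (-n-1, n+1) for every n, because the ball of
radius B(n+1) is never left. Uniqueness makes them agree, and at time s the solution with n = ⌈|s|⌉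
is used. -/
theorem LipschitzWith.exists_global_flow [CompleteSpace G] (hV : LipschitzWith K V)
    (hB : ∀ z, ‖V z‖ ≤ B) :
    ∃ Φ : ℝ → G → G, (∀ z, Φ 0 z = z) ∧ ∀ z s, HasDerivAt (fun s => Φ s z) (V (Φ s z)) s := by
  have hloc : ∀ (z : G) (n : ℕ), ∃ α : ℝ → G, α 0 = z ∧
      ∀ s ∈ Ioo (-(n + 1 : ℝ)) (n + 1), HasDerivAt α (V (α s)) s := by
    intro z n
    have hn : (0 : ℝ) < n + 1 := by positivity
    have hp : IsPicardLindelof (fun _ => V) (tmin := -(n + 1 : ℝ)) (tmax := n + 1)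
        ⟨0, by constructor <;> linarith⟩ z (B.toNNReal * (n + 1)) 0 B.toNNReal K := by
      refine IsPicardLindelof.of_time_independent (fun w _ => ?_) hV.lipschitzOnWith ?_
      · exact (hB w).trans (Real.le_coe_toNNReal B)
      · simp
    obtain ⟨α, h0, hα⟩ := hp.exists_eq_forall_mem_Icc_hasDerivWithinAt₀
    exact ⟨α, h0, fun s hs => (hα s (Ioo_subset_Icc_self hs)).hasDerivAt (Icc_mem_nhds hs.1 hs.2)⟩
  choose α hα0 hα using hloc
  have hagree : ∀ (z : G) (n m : ℕ) (s : ℝ), |s| < n + 1 → |s| < m + 1 → α z n s = α z m s := by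
    have aux : ∀ (z : G) (n m : ℕ) (s : ℝ), n ≤ m → |s| < n + 1 → α z n s = α z m s := by
      intro z n m s hnm hs
      have hnm' : (n : ℝ) ≤ m := by exact_mod_cast hnm
      refine ODE_solution_unique_of_mem_Ioo (v := fun _ => V) (s := fun _ => univ) (t₀ := 0)
        (K := K) (fun _ _ => hV.lipschitzOnWith) (a := -(n + 1 : ℝ)) (b := n + 1)
        ⟨by linarith [(by positivity : (0 : ℝ) < n + 1)], by positivity⟩
        (fun t ht => ⟨hα z n t ht, mem_univ _⟩)
        (fun t ht => ⟨hα z m t ⟨by linarith [ht.1], by linarith [ht.2]⟩, mem_univ _⟩)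
        (by rw [hα0, hα0]) (abs_lt.1 hs)
    intro z n m s hn hm
    rcases le_total n m with h | h
    · exact aux z n m s h hn
    · exact (aux z m n s h hm).symm
  refine ⟨fun s z => α z ⌈|s|⌉₊ s, fun z => hα0 z _, fun z s => ?_⟩
  set N := ⌈|s|⌉₊ with hN
  have hsN : |s| < N + 1 := (Nat.le_ceil |s|).trans_lt (lt_add_one _)
  have hd := hα z N s (abs_lt.1 hsN)
  refine hd.congr_of_eventuallyEq ?_
  filter_upwards [(continuous_abs.isOpen_preimage _ isOpen_Iio).mem_nhds hsN] with t ht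
  exact hagree z _ _ t ((Nat.le_ceil |t|).trans_lt (lt_add_one _)) ht

variable {γ : ℝ → G}

theorem norm_sub_le_of_hasDerivAt_bounded (hB : ∀ z, ‖V z‖ ≤ B)
    (hγ : ∀ s, HasDerivAt γ (V (γ s)) s) (a b : ℝ) : ‖γ b - γ a‖ ≤ B * |b - a| := by
  have := convex_univ.norm_image_sub_le_of_norm_hasDerivWithin_le
    (fun s _ => (hγ s).hasDerivWithinAt) (fun s _ => hB (γ s)) (mem_univ a) (mem_univ b)
  simpa using this

/-- The error of one Euler step. It allows increments along straight segments to replace increments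
along the flow. -/
theorem LipschitzWith.norm_sub_sub_smul_le (hV : LipschitzWith K V) (hB : ∀ z, ‖V z‖ ≤ B)
    (hγ : ∀ s, HasDerivAt γ (V (γ s)) s) {h : ℝ} (hh : 0 ≤ h) :
    ‖γ h - γ 0 - h • V (γ 0)‖ ≤ K * B * h ^ 2 := by
  have hB0 : 0 ≤ B := (norm_nonneg _).trans (hB 0)
  have hd : ∀ s, HasDerivAt (fun s => γ s - s • V (γ 0)) (V (γ s) - V (γ 0)) s := fun s => by
    simpa using (hγ s).fun_sub ((hasDerivAt_id' s).smul_const (V (γ 0)))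
  have := (convex_Icc 0 h).norm_image_sub_le_of_norm_hasDerivWithin_le (C := K * (B * h))
    (fun s _ => (hd s).hasDerivWithinAt) (fun s hs => ?_) (left_mem_Icc.2 hh) (right_mem_Icc.2 hh)
  · rw [zero_smul, sub_zero, sub_zero, Real.norm_of_nonneg hh] at this
    rw [sub_right_comm]
    exact this.trans (le_of_eq (by ring))
  · have h1 := hV.dist_le_mul (γ s) (γ 0)
    rw [dist_eq_norm, dist_eq_norm] at h1
    refine h1.trans (mul_le_mul_of_nonneg_left ?_ K.2)
    refine (norm_sub_le_of_hasDerivAt_bounded hB hγ 0 s).trans ?_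
    rw [sub_zero, abs_of_nonneg hs.1]
    exact mul_le_mul_of_nonneg_left hs.2 hB0

end GlobalFlow

/-! ### The flow on the cosphere bundle -/

section Cosphere

variable {E : Type*} [NormedAddCommGroup E] [InnerProductSpace ℝ E]

/-- The radial retraction onto the closed unit ball. -/
def unitRetraction (ξ : E) : E := (max 1 ‖ξ‖)⁻¹ • ξ

theorem norm_unitRetraction_le (ξ : E) : ‖unitRetraction ξ‖ ≤ 1 := by
  have h : 0 < max 1 ‖ξ‖ := lt_max_of_lt_left one_pos
  rw [unitRetraction, norm_smul, norm_inv, Real.norm_of_nonneg h.le, inv_mul_le_iff₀ h, mul_one]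
  exact le_max_right _ _

theorem unitRetraction_of_norm_le {ξ : E} (h : ‖ξ‖ ≤ 1) : unitRetraction ξ = ξ := by
  rw [unitRetraction, max_eq_left h, inv_one, one_smul]

theorem norm_unitRetraction_sub_le (ξ ζ : E) :
    ‖unitRetraction ξ - unitRetraction ζ‖ ≤ 2 * ‖ξ - ζ‖ := by
  set m := max 1 ‖ξ‖ with hm
  set n := max 1 ‖ζ‖ with hn
  have hm1 : 1 ≤ m := le_max_left _ _
  have hn1 : 1 ≤ n := le_max_left _ _
  have hζn : ‖ζ‖ ≤ n := le_max_right _ _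
  have e : unitRetraction ξ - unitRetraction ζ = m⁻¹ • (ξ - ζ) + (m⁻¹ - n⁻¹) • ζ := by
    rw [unitRetraction, unitRetraction, smul_sub, sub_smul]; abel
  have hmn : |n - m| ≤ ‖ξ - ζ‖ := by
    refine (abs_max_sub_max_le_max _ _ _ _).trans ?_
    rw [sub_self, abs_zero, max_eq_right (abs_nonneg _), norm_sub_rev]
    exact abs_norm_sub_norm_le _ _
  rw [e, two_mul]
  refine (norm_add_le _ _).trans (add_le_add ?_ ?_)
  · rw [norm_smul, norm_inv, Real.norm_of_nonneg (by linarith)]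
    exact mul_le_of_le_one_left (norm_nonneg _) (inv_le_one_of_one_le₀ hm1)
  · rw [norm_smul, inv_sub_inv (by linarith) (by linarith), norm_div, Real.norm_eq_abs,
      Real.norm_of_nonneg (by positivity), div_mul_eq_mul_div, div_le_iff₀ (by positivity)]
    calc |n - m| * ‖ζ‖ ≤ ‖ξ - ζ‖ * n := by gcongr
      _ ≤ ‖ξ - ζ‖ * (m * n) := by
          refine mul_le_mul_of_nonneg_left ?_ (norm_nonneg _)
          nlinarith

/-- The projected Hamilton field, extended off the unit sphere as a bounded Lipschitz field. -/
def cosphereField (X Y : E → E → E) (z : E × E) : E × E :=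
  (X z.1 (unitRetraction z.2), -Y z.1 (unitRetraction z.2) +
    (inner ℝ (Y z.1 (unitRetraction z.2)) (unitRetraction z.2) : ℝ) • unitRetraction z.2)

/-- A complete integral curve of the projected Hamilton field on the unit sphere bundle. -/
structure IsSphereCurve (X Y : E → E → E) (x ξ : ℝ → E) : Prop where
  unit : ∀ s, ‖ξ s‖ = 1
  deriv_x : ∀ s, HasDerivAt x (X (x s) (ξ s)) s
  deriv_xi : ∀ s, HasDerivAt ξ (-Y (x s) (ξ s) + (inner ℝ (Y (x s) (ξ s)) (ξ s) : ℝ) • ξ s) s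

variable {X Y : E → E → E} {Λ c η R : ℝ}

theorem HamiltonBounds.norm_cosphereField_le (hH : HamiltonBounds X Y Λ c η R) (z : E × E) :
    ‖cosphereField X Y z‖ ≤ 2 * Λ := by
  have hp := norm_unitRetraction_le z.2
  have hX := hH.norm_X_le z.1 _ hp
  have hY := hH.norm_Y_le z.1 _ hp
  have hΛ := (norm_nonneg _).trans hX
  rw [cosphereField, Prod.norm_def]
  refine max_le (by simpa using by linarith) ((norm_add_le _ _).trans ?_)
  rw [norm_neg, norm_smul, two_mul]
  refine add_le_add hY ?_
  have h1 : ‖(inner ℝ (Y z.1 (unitRetraction z.2)) (unitRetraction z.2) : ℝ)‖ ≤ Λ * 1 :=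
    (norm_inner_le_norm _ _).trans (mul_le_mul hY hp (norm_nonneg _) hΛ)
  calc _ ≤ Λ * 1 * 1 := mul_le_mul h1 hp (norm_nonneg _) (by linarith)
    _ = Λ := by ring

/-- The retraction has Lipschitz constant 2, so X and Y contribute 3Λ each. The cubic term is split
into three differences; the second component adds up to (3 + 3 + 2 + 2)Λ ≤ 12Λ. -/
theorem HamiltonBounds.lipschitzWith_cosphereField (hH : HamiltonBounds X Y Λ c η R) :
    LipschitzWith (12 * Λ).toNNReal (cosphereField X Y) := by
  have hΛ : 0 ≤ Λ := (norm_nonneg _).trans (hH.norm_X_le 0 0 (by simp))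
  refine LipschitzWith.of_dist_le_mul fun z w => ?_
  rw [Real.coe_toNNReal _ (by positivity), dist_eq_norm, dist_eq_norm]
  have h1 : ‖z.1 - w.1‖ ≤ ‖z - w‖ := norm_fst_le (z - w)
  have h2 : ‖z.2 - w.2‖ ≤ ‖z - w‖ := norm_snd_le (z - w)
  set p := unitRetraction z.2 with hp
  set q := unitRetraction w.2 with hq
  have hp1 : ‖p‖ ≤ 1 := norm_unitRetraction_le z.2
  have hq1 : ‖q‖ ≤ 1 := norm_unitRetraction_le w.2
  have hpq : ‖p - q‖ ≤ 2 * ‖z - w‖ := (norm_unitRetraction_sub_le _ _).trans (by linarith)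
  have hX := hH.lip_X z.1 w.1 p q hp1 hq1
  have hY := hH.lip_Y z.1 w.1 p q hp1 hq1
  have hYz := hH.norm_Y_le z.1 p hp1
  have hYw := hH.norm_Y_le w.1 q hq1
  have hb : Λ * (‖z.1 - w.1‖ + ‖p - q‖) ≤ 3 * Λ * ‖z - w‖ := by nlinarith
  have hn := norm_nonneg (z - w)
  rw [Prod.norm_def]
  refine max_le ?_ ?_
  · change ‖X z.1 p - X w.1 q‖ ≤ _
    refine (hX.trans hb).trans ?_
    nlinarith
  · change ‖(-Y z.1 p + (inner ℝ (Y z.1 p) p : ℝ) • p) -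
      (-Y w.1 q + (inner ℝ (Y w.1 q) q : ℝ) • q)‖ ≤ _
    have e : (-Y z.1 p + (inner ℝ (Y z.1 p) p : ℝ) • p) -
        (-Y w.1 q + (inner ℝ (Y w.1 q) q : ℝ) • q) =
        -(Y z.1 p - Y w.1 q) + ((inner ℝ (Y z.1 p - Y w.1 q) p : ℝ) • p +
          ((inner ℝ (Y w.1 q) (p - q) : ℝ) • p + (inner ℝ (Y w.1 q) q : ℝ) • (p - q))) := by
      rw [inner_sub_left, inner_sub_right, sub_smul, sub_smul, smul_sub]
      abel
    have hi : ∀ a b c : E, ‖(inner ℝ a b : ℝ) • c‖ ≤ ‖a‖ * ‖b‖ * ‖c‖ := fun a b c => by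
      rw [norm_smul]
      exact mul_le_mul_of_nonneg_right (norm_inner_le_norm _ _) (norm_nonneg _)
    rw [e]
    have b1 := hi (Y z.1 p - Y w.1 q) p p
    have b2 := hi (Y w.1 q) (p - q) p
    have b3 := hi (Y w.1 q) q (p - q)
    have hYd := hY.trans hb
    have c1 : ‖Y z.1 p - Y w.1 q‖ * ‖p‖ * ‖p‖ ≤ 3 * Λ * ‖z - w‖ := by
      calc _ ≤ (3 * Λ * ‖z - w‖) * 1 * 1 := by gcongr
        _ = _ := by ring
    have c2 : ‖Y w.1 q‖ * ‖p - q‖ * ‖p‖ ≤ Λ * (2 * ‖z - w‖) * 1 := by gcongr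
    have c3 : ‖Y w.1 q‖ * ‖q‖ * ‖p - q‖ ≤ Λ * 1 * (2 * ‖z - w‖) := by gcongr
    refine (norm_add_le _ _).trans ?_
    rw [norm_neg]
    have t1 := norm_add_le ((inner ℝ (Y z.1 p - Y w.1 q) p : ℝ) • p)
      ((inner ℝ (Y w.1 q) (p - q) : ℝ) • p + (inner ℝ (Y w.1 q) q : ℝ) • (p - q))
    have t2 := norm_add_le ((inner ℝ (Y w.1 q) (p - q) : ℝ) • p)
      ((inner ℝ (Y w.1 q) q : ℝ) • (p - q))
    nlinarith

/-- The function u = |ξ|² - 1 satisfies |u'| ≤ 2Λ|u|: inside the unit ball u' = 2⟨Y,ξ⟩u, and outside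
it the retraction makes the field tangent to the spheres, so u' = 0. Gronwall's inequality then
forces u = 0, in both time directions. -/
theorem HamiltonBounds.norm_snd_eq_one (hH : HamiltonBounds X Y Λ c η R) {γ : ℝ → E × E}
    (hγ : ∀ s, HasDerivAt γ (cosphereField X Y (γ s)) s) (h0 : ‖(γ 0).2‖ = 1) (s : ℝ) :
    ‖(γ s).2‖ = 1 := by
  have hΛ : 0 ≤ Λ := (norm_nonneg _).trans (hH.norm_X_le 0 0 (by simp))
  set u : ℝ → ℝ := fun s => ‖(γ s).2‖ ^ 2 - 1 with hu
  set u' : ℝ → ℝ := fun s => 2 * inner ℝ (γ s).2 (cosphereField X Y (γ s)).2 with hu'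
  have hd : ∀ s, HasDerivAt u (u' s) s := fun s => by
    have h2 : HasDerivAt (fun s => (γ s).2) (cosphereField X Y (γ s)).2 s := (hγ s).snd
    exact h2.norm_sq.sub_const 1
  have hb : ∀ s, |u' s| ≤ 2 * Λ * |u s| := by
    intro s
    have hin : inner ℝ (γ s).2 (cosphereField X Y (γ s)).2 =
        inner ℝ (Y (γ s).1 (unitRetraction (γ s).2)) (unitRetraction (γ s).2) *
          inner ℝ (γ s).2 (unitRetraction (γ s).2) -
        inner ℝ (Y (γ s).1 (unitRetraction (γ s).2)) (γ s).2 := by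
      simp only [cosphereField]
      rw [inner_add_right, inner_neg_right, real_inner_smul_right, real_inner_comm (γ s).2 (Y _ _)]
      ring
    rcases le_or_gt ‖(γ s).2‖ 1 with h | h
    · have e : u' s = 2 * (inner ℝ (Y (γ s).1 (γ s).2) (γ s).2 * u s) := by
        simp only [hu', hu]
        rw [hin, unitRetraction_of_norm_le h, real_inner_self_eq_norm_sq]
        ring
      have h1 : |inner ℝ (Y (γ s).1 (γ s).2) (γ s).2| ≤ Λ := by
        refine (abs_real_inner_le_norm _ _).trans ?_
        have := hH.norm_Y_le (γ s).1 _ h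
        nlinarith [norm_nonneg (Y (γ s).1 (γ s).2), norm_nonneg (γ s).2]
      rw [e, abs_mul, abs_mul, abs_two]
      have := abs_nonneg (u s)
      nlinarith
    · have e : u' s = 0 := by
        simp only [hu']
        rw [hin, unitRetraction, max_eq_right h.le]
        rw [real_inner_smul_right, real_inner_smul_right, real_inner_self_eq_norm_sq]
        have : ‖(γ s).2‖ ≠ 0 := by linarith
        field_simp
        ring
      rw [e, abs_zero]
      positivity
  have hu0 : u 0 = 0 := by simp [hu, h0]
  have key : ∀ (w w' : ℝ → ℝ), (∀ s, HasDerivAt w (w' s) s) → (∀ s, |w' s| ≤ 2 * Λ * |w s|) →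
      w 0 = 0 → ∀ s, 0 ≤ s → w s = 0 := by
    intro w w' hw hwb hw0 s hs
    exact eq_zero_of_abs_deriv_le_mul_abs_self_of_eq_zero_right (f' := w') (K := 2 * Λ) (a := 0)
      (b := s) (continuous_iff_continuousAt.2 fun s => (hw s).continuousAt).continuousOn
      (fun t _ => (hw t).hasDerivWithinAt) hw0 (fun t _ => hwb t) s ⟨hs, le_rfl⟩
  have hus : u s = 0 := by
    rcases le_total 0 s with hs | hs
    · exact key u u' hd hb hu0 s hs
    · have := key (fun s => u (-s)) (fun s => -u' (-s)) (fun s => (hd (-s)).comp_neg_arg)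
        (fun s => by simpa using hb (-s))
        (by simpa using hu0) (-s) (by linarith)
      simpa using this
  have h2 : ‖(γ s).2‖ ^ 2 = 1 := by
    simp only [hu] at hus
    linarith
  exact (pow_eq_one_iff_of_nonneg (norm_nonneg _) two_ne_zero).1 h2

theorem HamiltonBounds.isSphereCurve (hH : HamiltonBounds X Y Λ c η R) {γ : ℝ → E × E}
    (hγ : ∀ s, HasDerivAt γ (cosphereField X Y (γ s)) s) (h0 : ‖(γ 0).2‖ = 1) :
    IsSphereCurve X Y (fun s => (γ s).1) (fun s => (γ s).2) := by
  have h1 := hH.norm_snd_eq_one hγ h0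
  refine ⟨h1, fun s => ?_, fun s => ?_⟩
  · have := (hγ s).fst
    rwa [cosphereField, unitRetraction_of_norm_le (h1 s).le] at this
  · have := (hγ s).snd
    rwa [cosphereField, unitRetraction_of_norm_le (h1 s).le] at this

/-- Time reversal: it turns every statement about outgoing curves and the future into one about
incoming curves and the past. -/
theorem IsSphereCurve.neg (hX : ∀ x ξ, X x (-ξ) = -X x ξ) (hY : ∀ x ξ, Y x (-ξ) = Y x ξ)
    {x ξ : ℝ → E} (h : IsSphereCurve X Y x ξ) :
    IsSphereCurve X Y (fun s => x (-s)) (fun s => -ξ (-s)) := by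
  refine ⟨fun s => by rw [norm_neg, h.unit], fun s => ?_, fun s => ?_⟩
  · rw [hX]
    exact (h.deriv_x (-s)).comp_neg_arg
  · rw [hY]
    refine (h.deriv_xi (-s)).comp_neg_arg.fun_neg.congr_deriv ?_
    rw [neg_neg, inner_neg_right, smul_neg, neg_smul, neg_neg]

end Cosphere

/-! ### Geodesics in the exterior region -/

/-- The bootstrap principle. At the first time where f reaches m, the weak bound holds up to that
time, and the hypothesis improves it to a strict one. -/
theorem forall_lt_of_forall_le_imp_lt {f : ℝ → ℝ} {a b m : ℝ} (hf : Continuous f) (ha : f a < m)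
    (h : ∀ b' ∈ Icc a b, (∀ s ∈ Icc a b', f s ≤ m) → f b' < m) : ∀ s ∈ Icc a b, f s < m := by
  by_contra! hne
  obtain ⟨s₁, hs₁, hms₁⟩ := hne
  have hcpt : IsCompact (Icc a b ∩ {s | m ≤ f s}) :=
    isCompact_Icc.inter_right (isClosed_le continuous_const hf)
  obtain ⟨t, ⟨htI, htm⟩, hleast⟩ := hcpt.exists_isLeast ⟨s₁, hs₁, hms₁⟩
  refine absurd (h t htI fun s hs => ?_) (not_lt.2 htm)
  rcases eq_or_lt_of_le hs.2 with rfl | hlt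
  · obtain ⟨s', hs', hs'm⟩ := intermediate_value_Icc hs.1 hf.continuousOn ⟨ha.le, htm⟩
    have : s ≤ s' := hleast ⟨⟨hs'.1, hs'.2.trans htI.2⟩, hs'm.ge⟩
    rw [le_antisymm this hs'.2, hs'm]
  · by_contra hsm
    exact absurd (hleast ⟨⟨hs.1, hs.2.trans htI.2⟩, (not_le.1 hsm).le⟩) (not_le.2 hlt)

section Exterior

variable {E : Type*} [NormedAddCommGroup E] [InnerProductSpace ℝ E] {X Y : E → E → E}
  {Λ c η R L : ℝ} {x ξ : ℝ → E}

theorem IsSphereCurve.continuous_x (h : IsSphereCurve X Y x ξ) : Continuous x :=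
  continuous_iff_continuousAt.2 fun s => (h.deriv_x s).continuousAt

theorem IsSphereCurve.continuous_xi (h : IsSphereCurve X Y x ξ) : Continuous ξ :=
  continuous_iff_continuousAt.2 fun s => (h.deriv_xi s).continuousAt

theorem HamiltonBounds.continuous_Y_comp (hH : HamiltonBounds X Y Λ c η R) {x ξ : ℝ → E}
    (hx : Continuous x) (hξ : Continuous ξ) (h1 : ∀ s, ‖ξ s‖ ≤ 1) :
    Continuous fun s => Y (x s) (ξ s) := by
  refine continuous_iff_continuousAt.2 fun s => ?_
  rw [ContinuousAt, tendsto_iff_norm_sub_tendsto_zero]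
  refine squeeze_zero (fun _ => norm_nonneg _)
    (fun r => hH.lip_Y (x r) (x s) (ξ r) (ξ s) (h1 r) (h1 s)) ?_
  have : Continuous fun r => Λ * (‖x r - x s‖ + ‖ξ r - ξ s‖) := by fun_prop
  simpa using this.tendsto s

theorem norm_neg_add_inner_smul_le {y ζ : E} (h : ‖ζ‖ = 1) :
    ‖-y + (inner ℝ y ζ : ℝ) • ζ‖ ≤ 2 * ‖y‖ := by
  refine (norm_add_le _ _).trans ?_
  rw [norm_neg, norm_smul, h, mul_one, two_mul]
  have := norm_inner_le_norm (𝕜 := ℝ) y ζ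
  rw [h, mul_one] at this
  linarith

/-- The square of the right side is at least |y|² - 4μσ|y| + 4σ² ≥ (1 - μ)(|y|² + 4σ²) ≥ (1 - μ)(|y|
+ 2σ)²/2. -/
theorem mul_add_le_norm_add_smul {y ζ : E} {k μ σ : ℝ} (hζ : ‖ζ‖ = 1) (hσ : 0 ≤ σ) (hk : 0 ≤ k)
    (hμ : 0 ≤ μ) (hkμ : k ^ 2 ≤ (1 - μ) / 2) (hy : -(μ * ‖y‖) ≤ inner ℝ y ζ) :
    k * (‖y‖ + 2 * σ) ≤ ‖y + (2 * σ) • ζ‖ := by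
  refine (pow_le_pow_iff_left₀ (by positivity) (norm_nonneg _) two_ne_zero).1 ?_
  rw [norm_add_sq_real, real_inner_smul_right, norm_smul, hζ, mul_one,
    Real.norm_of_nonneg (by linarith), mul_pow k]
  have hy0 := norm_nonneg y
  have h1 : k ^ 2 * (‖y‖ + 2 * σ) ^ 2 ≤ (1 - μ) / 2 * (‖y‖ + 2 * σ) ^ 2 :=
    mul_le_mul_of_nonneg_right hkμ (sq_nonneg _)
  have h2 : σ * -(μ * ‖y‖) ≤ σ * inner ℝ y ζ := mul_le_mul_of_nonneg_left hy hσ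
  have hμ1 : μ ≤ 1 := by nlinarith [sq_nonneg k]
  nlinarith [mul_nonneg hμ (sq_nonneg (‖y‖ - 2 * σ)),
    mul_nonneg (by linarith : 0 ≤ 1 - μ) (sq_nonneg (‖y‖ - 2 * σ))]

variable [CompleteSpace E]

/-- Bootstrap. As long as |ξ(s) - ξ(a)| ≤ 1/4, the velocity, close to 2ξ, has component at least 1
along ξ(a). Then the curve expands distances and the integral of |Y| along it is at most η. Since
|ξ'| ≤ 2|Y|, the deviation is at most 2η ≤ 1/50, which improves the assumption. -/
theorem IsSphereCurve.norm_xi_sub_le (hc : IsSphereCurve X Y x ξ)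
    (hH : HamiltonBounds X Y Λ c η R) (hη : η ≤ 1 / 100) {a b : ℝ}
    (hR : ∀ s ∈ Icc a b, R < ‖x s‖) : ∀ s ∈ Icc a b, ‖ξ s - ξ a‖ ≤ 2 * η := by
  have hcx := hc.continuous_x
  have hcξ := hc.continuous_xi
  have hcY := hH.continuous_Y_comp hcx hcξ fun s => (hc.unit s).le
  by_cases hab : a ≤ b
  swap
  · intro s hs
    exact absurd (hs.1.trans hs.2) hab
  have hη0 : 0 ≤ η :=
    (norm_nonneg _).trans (hH.exterior (x a) (ξ a) (hR a ⟨le_rfl, hab⟩) (hc.unit a).le)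
  have main : ∀ b' ∈ Icc a b, (∀ s ∈ Icc a b', ‖ξ s - ξ a‖ ≤ 1 / 4) → ‖ξ b' - ξ a‖ ≤ 2 * η := by
    intro b' hb' hq
    have hRb : ∀ s ∈ Icc a b', R < ‖x s‖ := fun s hs => hR s ⟨hs.1, hs.2.trans hb'.2⟩
    have hd : ∀ s, HasDerivAt (fun s => inner ℝ (x s) (ξ a) - s)
        (inner ℝ (X (x s) (ξ s)) (ξ a) - 1) s := fun s => by
      have := ((hc.deriv_x s).inner ℝ (hasDerivAt_const s (ξ a))).fun_sub (hasDerivAt_id' s)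
      simpa using this
    -- For unit vectors 2⟨ξ(s),ξ(a)⟩ = 2 - |ξ(s) - ξ(a)|² ≥ 2 - 1/16, and replacing X by 2ξ costs at
    -- most η.
    have hpos : ∀ s ∈ Icc a b', 0 ≤ inner ℝ (X (x s) (ξ s)) (ξ a) - 1 := by
      intro s hs
      have h1 := hH.exterior (x s) (ξ s) (hRb s hs) (hc.unit s).le
      have h2 := abs_real_inner_le_norm (X (x s) (ξ s) - (2 : ℝ) • ξ s) (ξ a)
      rw [hc.unit a, mul_one, inner_sub_left, real_inner_smul_left, abs_le] at h2
      have h3 := norm_sub_sq_real (ξ s) (ξ a)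
      rw [hc.unit, hc.unit] at h3
      have h4 := hq s hs
      nlinarith [norm_nonneg (ξ s - ξ a)]
    have hmono : MonotoneOn (fun s => inner ℝ (x s) (ξ a) - s) (Icc a b') := by
      refine monotoneOn_of_deriv_nonneg (convex_Icc a b')
        (continuous_iff_continuousAt.2 fun s => (hd s).continuousAt).continuousOn
        (fun s _ => (hd s).differentiableAt.differentiableWithinAt) fun s hs => ?_
      rw [(hd s).deriv]
      exact hpos s (interior_subset hs)
    have hexp' : ∀ s ∈ Icc a b', ∀ s' ∈ Icc a b', s' ≤ s → s - s' ≤ ‖x s - x s'‖ := by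
      intro s hs s' hs' hle
      have h1 := hmono hs' hs hle
      have h2 := real_inner_le_norm (x s - x s') (ξ a)
      rw [hc.unit a, mul_one, inner_sub_left] at h2
      simp only at h1
      linarith
    have hexp : ∀ s ∈ Icc a b', ∀ s' ∈ Icc a b', |s - s'| ≤ ‖x s - x s'‖ := by
      intro s hs s' hs'
      rcases le_total s' s with h | h
      · rw [abs_of_nonneg (by linarith)]
        exact hexp' s hs s' hs' h
      · rw [abs_of_nonpos (by linarith), norm_sub_rev, neg_sub]
        exact hexp' s' hs' s hs h
    have hcurve := hH.curve x ξ a b' hcx (fun s => (hc.unit s).le) hexp hRb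
    have hder : Continuous fun s => -Y (x s) (ξ s) + (inner ℝ (Y (x s) (ξ s)) (ξ s) : ℝ) • ξ s :=
      hcY.neg.add ((hcY.inner hcξ).smul hcξ)
    have hint := intervalIntegral.integral_eq_sub_of_hasDerivAt
      (fun s _ => hc.deriv_xi s) (hder.intervalIntegrable a b')
    rw [← hint, intervalIntegral.integral_of_le hb'.1]
    have henorm : ‖∫ s in Ioc a b', (-Y (x s) (ξ s) + (inner ℝ (Y (x s) (ξ s)) (ξ s) : ℝ) • ξ s)‖ₑ ≤
        ENNReal.ofReal (2 * η) := by
      refine (enorm_integral_le_lintegral_enorm _).trans ?_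
      calc _ ≤ ∫⁻ s in Icc a b', ‖-Y (x s) (ξ s) + (inner ℝ (Y (x s) (ξ s)) (ξ s) : ℝ) • ξ s‖ₑ :=
            lintegral_mono_set Ioc_subset_Icc_self
        _ ≤ ∫⁻ s in Icc a b', 2 * ‖Y (x s) (ξ s)‖ₑ := by
            refine lintegral_mono fun s => ?_
            rw [← ofReal_norm, ← ofReal_norm, ← ENNReal.ofReal_ofNat 2,
              ← ENNReal.ofReal_mul (by norm_num)]
            exact ENNReal.ofReal_le_ofReal (norm_neg_add_inner_smul_le (hc.unit s))
        _ = 2 * ∫⁻ s in Icc a b', ‖Y (x s) (ξ s)‖ₑ := lintegral_const_mul' _ _ (by norm_num)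
        _ ≤ 2 * ENNReal.ofReal η := mul_le_mul_right hcurve _
        _ = _ := by rw [ENNReal.ofReal_mul (by norm_num)]; simp
    rw [← ofReal_norm] at henorm
    exact (ENNReal.ofReal_le_ofReal_iff (by positivity)).1 henorm
  have hlt := forall_lt_of_forall_le_imp_lt (f := fun s => ‖ξ s - ξ a‖) (a := a) (b := b)
    (m := 1 / 4) (by fun_prop) (by simp) fun b' hb' hq => (main b' hb' hq).trans_lt (by linarith)
  exact fun s hs => main s hs fun r hr => (hlt r ⟨hr.1, hr.2.trans hs.2⟩).le

theorem IsSphereCurve.norm_x_sub_le (hc : IsSphereCurve X Y x ξ)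
    (hH : HamiltonBounds X Y Λ c η R) (hη : η ≤ 1 / 100) {a b : ℝ} (hab : a ≤ b)
    (hR : ∀ s ∈ Icc a b, R < ‖x s‖) :
    ‖x b - x a - (2 * (b - a)) • ξ a‖ ≤ 5 * η * (b - a) := by
  have hξ := hc.norm_xi_sub_le hH hη hR
  have hd : ∀ s, HasDerivAt (fun s => x s - (2 * s) • ξ a) (X (x s) (ξ s) - (2 : ℝ) • ξ a) s :=
    fun s => by
      have h2 : HasDerivAt (fun s : ℝ => 2 * s) 2 s := by
        simpa using (hasDerivAt_id' s).const_mul (2 : ℝ)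
      exact (hc.deriv_x s).fun_sub (h2.smul_const (ξ a))
  have := (convex_Icc a b).norm_image_sub_le_of_norm_hasDerivWithin_le (C := 5 * η)
    (fun s _ => (hd s).hasDerivWithinAt) (fun s hs => ?_) (left_mem_Icc.2 hab)
    (right_mem_Icc.2 hab)
  · rw [Real.norm_of_nonneg (by linarith)] at this
    refine le_trans (le_of_eq ?_) this
    congr 1
    rw [mul_sub, sub_smul]
    abel
  · have h1 := hH.exterior (x s) (ξ s) (hR s hs) (hc.unit s).le
    have h2 := hξ s hs
    calc ‖X (x s) (ξ s) - (2 : ℝ) • ξ a‖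
        = ‖(X (x s) (ξ s) - (2 : ℝ) • ξ s) + (2 : ℝ) • (ξ s - ξ a)‖ := by
          rw [smul_sub]; congr 1; abel
      _ ≤ η + 2 * (2 * η) := by
          refine (norm_add_le _ _).trans (add_le_add h1 ?_)
          rw [norm_smul, Real.norm_ofNat]
          linarith
      _ = _ := by ring

/-- Outside B_R the curve follows the line x(a) + 2(s - a)ξ(a) up to 5η(s - a) ≤ (s - a)/20, and the
line recedes by `mul_add_le_norm_add_smul`. The bootstrap runs on |x| ≥ 11R/10, which the lower
bound k|x(a)| > 11R/10 reproduces strictly. -/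
theorem IsSphereCurve.le_norm_of_outgoing (hc : IsSphereCurve X Y x ξ)
    (hH : HamiltonBounds X Y Λ c η R) (hη : η ≤ 1 / 100) (hR : 0 < R) {k μ a : ℝ} (hk : 7 / 20 ≤ k)
    (hμ : 0 ≤ μ) (hkμ : k ^ 2 ≤ (1 - μ) / 2) (hka : 11 / 10 * R < k * ‖x a‖)
    (ha : -(μ * ‖x a‖) ≤ inner ℝ (x a) (ξ a)) {s : ℝ} (hs : a ≤ s) :
    k * ‖x a‖ + (2 * k - 1 / 20) * (s - a) ≤ ‖x s‖ := by
  have hka' : 11 / 10 * R < ‖x a‖ := by nlinarith [norm_nonneg (x a)]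
  have main : ∀ b, a ≤ b → (∀ s ∈ Icc a b, 11 / 10 * R ≤ ‖x s‖) →
      k * ‖x a‖ + (2 * k - 1 / 20) * (b - a) ≤ ‖x b‖ := by
    intro b hab hb
    have h1 := hc.norm_x_sub_le hH hη hab fun s hs => by linarith [hb s hs]
    have h2 := mul_add_le_norm_add_smul (hc.unit a) (sub_nonneg.2 hab) (by linarith) hμ hkμ ha
    have h3 : ‖x a + (2 * (b - a)) • ξ a‖ ≤ ‖x b‖ + ‖x b - x a - (2 * (b - a)) • ξ a‖ := by
      have e : x a + (2 * (b - a)) • ξ a = x b - (x b - x a - (2 * (b - a)) • ξ a) := by abel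
      rw [e]
      exact norm_sub_le _ _
    nlinarith
  have hlt := forall_lt_of_forall_le_imp_lt (f := fun s => -‖x s‖) (a := a) (b := s)
    (m := -(11 / 10 * R)) hc.continuous_x.norm.neg (by linarith) fun b hb hq => by
      have h1 := main b hb.1 fun r hr => by linarith [hq r hr]
      have h2 : 0 ≤ (2 * k - 1 / 20) * (b - a) := mul_nonneg (by linarith) (sub_nonneg.2 hb.1)
      linarith
  exact main s hs fun r hr => by linarith [hlt r hr]

theorem IsSphereCurve.sub_le_norm_of_outgoing (hc : IsSphereCurve X Y x ξ)
    (hH : HamiltonBounds X Y Λ c η R) (hη : η ≤ 1 / 100) (hR : 0 < R) {a s : ℝ}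
    (hxa : 2 * R ≤ ‖x a‖) (ha : 0 ≤ inner ℝ (x a) (ξ a)) (hs : a ≤ s) : s - a ≤ ‖x s‖ := by
  have h := hc.le_norm_of_outgoing hH hη hR (k := 7 / 10) (μ := 0) (a := a) (by norm_num) le_rfl
    (by norm_num) (by linarith) (by simpa using ha) hs
  have := norm_nonneg (x a)
  linarith

/-- The value k = 7/20 is admissible for μ = 3/4 because k² = 0.1225 ≤ 1/8, and k·10R = 3.5R. The
cosine -3/4 lies below -1/2, so the outgoing cutoff has room to rise to 1 before the cone of the
support condition. -/
theorem IsSphereCurve.three_mul_le_norm_of_outgoing (hc : IsSphereCurve X Y x ξ)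
    (hH : HamiltonBounds X Y Λ c η R) (hη : η ≤ 1 / 100) (hR : 0 < R) {a s : ℝ}
    (hxa : 10 * R ≤ ‖x a‖) (ha : -(3 / 4 * ‖x a‖) ≤ inner ℝ (x a) (ξ a)) (hs : a ≤ s) :
    3 * R ≤ ‖x s‖ := by
  have h := hc.le_norm_of_outgoing hH hη hR (k := 7 / 20) (μ := 3 / 4) (a := a) le_rfl
    (by norm_num) (by norm_num) (by linarith) ha hs
  linarith

/-- The interval [s₁,s₂] is covered by three sets. Times with |x| < 2R have measure at most L/(2c),
since the speed is at least 2c. At any other time s the curve is outgoing or incoming. If outgoing,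
|x(s₂)| ≥ s₂ - s, so s₂ - s ≤ ρ; if incoming, time reversal gives s - s₁ ≤ ρ. -/
theorem IsSphereCurve.sub_le_of_norm_le (hc : IsSphereCurve X Y x ξ)
    (hH : HamiltonBounds X Y Λ c η R) (hη : η ≤ 1 / 100) (hR : 0 < R) (hc0 : 0 < c) (hL0 : 0 ≤ L)
    (hL : ∫⁻ s in {s | ‖x s‖ < 2 * R}, ‖deriv x s‖ₑ ≤ ENNReal.ofReal L) {ρ s₁ s₂ : ℝ}
    (h₁ : ‖x s₁‖ ≤ ρ) (h₂ : ‖x s₂‖ ≤ ρ) : s₂ - s₁ ≤ 2 * ρ + L / (2 * c) := by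
  have hρ : 0 ≤ ρ := (norm_nonneg _).trans h₁
  have hvol : volume {s | ‖x s‖ < 2 * R} ≤ ENNReal.ofReal (L / (2 * c)) := by
    have hle : ENNReal.ofReal (2 * c) * volume {s | ‖x s‖ < 2 * R} ≤ ENNReal.ofReal L := by
      refine le_trans ?_ hL
      rw [← setLIntegral_const]
      refine lintegral_mono fun s => ?_
      rw [(hc.deriv_x s).deriv, ← ofReal_norm]
      refine ENNReal.ofReal_le_ofReal ((hH.inner_X (x s) (ξ s) (hc.unit s)).trans ?_)
      refine (real_inner_le_norm _ _).trans ?_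
      rw [hc.unit s, mul_one]
    rw [ENNReal.ofReal_div_of_pos (by positivity)]
    rw [ENNReal.le_div_iff_mul_le (Or.inl (by simpa using hc0)) (Or.inl ENNReal.ofReal_ne_top),
      mul_comm]
    exact hle
  have hsub : Icc s₁ s₂ ⊆ (Icc s₁ (s₁ + ρ) ∪ Icc (s₂ - ρ) s₂) ∪ {s | ‖x s‖ < 2 * R} := by
    intro s hs
    by_cases hx : ‖x s‖ < 2 * R
    · exact Or.inr hx
    · left
      rw [not_lt] at hx
      rcases le_total 0 (inner ℝ (x s) (ξ s)) with hin | hin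
      · right
        have := hc.sub_le_norm_of_outgoing hH hη hR hx hin hs.2
        exact ⟨by linarith, hs.2⟩
      · left
        have hneg := hc.neg hH.X_neg hH.Y_neg
        have := hneg.sub_le_norm_of_outgoing hH hη hR (a := -s) (s := -s₁)
          (by simpa using hx) (by simpa using hin) (by linarith [hs.1])
        simp only [neg_neg] at this
        exact ⟨hs.1, by linarith⟩
  have hm : ENNReal.ofReal (s₂ - s₁) ≤ ENNReal.ofReal (2 * ρ + L / (2 * c)) := by
    rw [← Real.volume_Icc]
    refine (measure_mono hsub).trans ((measure_union_le _ _).trans ?_)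
    rw [ENNReal.ofReal_add (by positivity) (by positivity)]
    refine add_le_add ((measure_union_le _ _).trans ?_) hvol
    rw [Real.volume_Icc, Real.volume_Icc, ← ENNReal.ofReal_add (by linarith) (by linarith)]
    exact ENNReal.ofReal_le_ofReal (by linarith)
  exact (ENNReal.ofReal_le_ofReal_iff (by positivity)).1 hm

end Exterior

/-! ### The escape function at a fixed time -/

/-- The piecewise linear ramp which is `0` for `u ≤ 0` and `1` for `u ≥ 1`. -/
def ramp (u : ℝ) : ℝ := max 0 (min 1 u)

theorem ramp_nonneg (u : ℝ) : 0 ≤ ramp u := le_max_left _ _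

theorem ramp_le_one (u : ℝ) : ramp u ≤ 1 := max_le zero_le_one (min_le_left _ _)

theorem ramp_of_one_le {u : ℝ} (h : 1 ≤ u) : ramp u = 1 := by
  rw [ramp, min_eq_left h, max_eq_right zero_le_one]

theorem ramp_of_nonpos {u : ℝ} (h : u ≤ 0) : ramp u = 0 := by
  rw [ramp, min_eq_right (h.trans zero_le_one), max_eq_left h]

theorem abs_ramp_sub_le (u v : ℝ) : |ramp u - ramp v| ≤ |u - v| := by
  refine (abs_max_sub_max_le_max _ _ _ _).trans ?_
  rw [sub_self, abs_zero, max_eq_right (abs_nonneg _)]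
  refine (abs_min_sub_min_le_max _ _ _ _).trans ?_
  rw [sub_self, abs_zero, max_eq_right (abs_nonneg _)]

theorem abs_mul_sub_mul_le {a b a' b' : ℝ} (ha : |b| ≤ 1) (hb : |a'| ≤ 1) :
    |a * b - a' * b'| ≤ |a - a'| + |b - b'| := by
  have e : a * b - a' * b' = (a - a') * b + a' * (b - b') := by ring
  rw [e]
  refine (abs_add_le _ _).trans ?_
  rw [abs_mul, abs_mul]
  exact add_le_add (mul_le_of_le_one_right (abs_nonneg _) ha)
    (mul_le_of_le_one_left (abs_nonneg _) hb)

theorem abs_ramp_le_one (u : ℝ) : |ramp u| ≤ 1 := by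
  rw [abs_of_nonneg (ramp_nonneg u)]
  exact ramp_le_one u

/-! ### The density and its Lipschitz bound -/

section EscapeRate

variable {E : Type*} [NormedAddCommGroup E] [InnerProductSpace ℝ E]

/-- Cutoff to the outgoing part of the exterior region. -/
def outgoingCutoff (R : ℝ) (z : E × E) : ℝ :=
  ramp (‖z.1‖ / R - 10) * ramp ((inner ℝ z.1 (unitRetraction z.2) + 3 / 4 * ‖z.1‖) / R)

/-- The density which is integrated along backward bicharacteristics. -/
def escapeRate (R K : ℝ) (z : E × E) : ℝ :=
  ramp ((200 * R - ‖z.1‖) / R) * (1 + K * outgoingCutoff R z)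

theorem outgoingCutoff_nonneg (R : ℝ) (z : E × E) : 0 ≤ outgoingCutoff R z :=
  mul_nonneg (ramp_nonneg _) (ramp_nonneg _)

theorem outgoingCutoff_le_one (R : ℝ) (z : E × E) : outgoingCutoff R z ≤ 1 :=
  mul_le_one₀ (ramp_le_one _) (ramp_nonneg _) (ramp_le_one _)

variable {R K : ℝ}

theorem escapeRate_nonneg (hK : 0 ≤ K) (z : E × E) : 0 ≤ escapeRate R K z :=
  mul_nonneg (ramp_nonneg _) (by have := mul_nonneg hK (outgoingCutoff_nonneg R z); linarith)

theorem escapeRate_le (hK : 0 ≤ K) (z : E × E) : escapeRate R K z ≤ 1 + K := by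
  have h1 := mul_nonneg hK (outgoingCutoff_nonneg R z)
  have h2 := mul_le_mul_of_nonneg_left (outgoingCutoff_le_one R z) hK
  exact (mul_le_of_le_one_left (by linarith) (ramp_le_one _)).trans (by linarith)

theorem escapeRate_eq_of_norm_le (hR : 0 < R) {z : E × E} (h : ‖z.1‖ ≤ 199 * R) :
    escapeRate R K z = 1 + K * outgoingCutoff R z := by
  rw [escapeRate, ramp_of_one_le, one_mul]
  rw [le_div_iff₀ hR]
  linarith

theorem one_le_escapeRate (hR : 0 < R) (hK : 0 ≤ K) {z : E × E} (h : ‖z.1‖ ≤ 199 * R) :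
    1 ≤ escapeRate R K z := by
  rw [escapeRate_eq_of_norm_le hR h]
  have := mul_nonneg hK (outgoingCutoff_nonneg R z)
  linarith

theorem escapeRate_eq_zero (hR : 0 < R) {z : E × E} (h : 200 * R ≤ ‖z.1‖) :
    escapeRate R K z = 0 := by
  rw [escapeRate, ramp_of_nonpos, zero_mul]
  exact div_nonpos_of_nonpos_of_nonneg (by linarith) hR.le

/-- The inner product in the outgoing cutoff has Lipschitz constant of order |x| in ξ. This is
harmless, because the outer ramp vanishes for |x| ≥ 200R and the argument is divided by R. The
product is expanded so that the difference of cutoffs is multiplied by the ramp at w. -/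
theorem abs_escapeRate_sub_le (hR : 1 ≤ R) (hK : 0 ≤ K) (z w : E × E) :
    |escapeRate R K z - escapeRate R K w| ≤ 405 * (1 + K) * ‖z - w‖ := by
  have hR0 : 0 < R := by linarith
  have hz1 : ‖z.1 - w.1‖ ≤ ‖z - w‖ := norm_fst_le (z - w)
  have hz2 : ‖z.2 - w.2‖ ≤ ‖z - w‖ := norm_snd_le (z - w)
  have hn : |‖z.1‖ - ‖w.1‖| ≤ ‖z - w‖ := (abs_norm_sub_norm_le _ _).trans hz1
  have hdiv : ∀ u : ℝ, |u / R| ≤ |u| := fun u => by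
    rw [abs_div, abs_of_pos hR0]
    exact div_le_self (abs_nonneg _) hR
  set r := ramp ((200 * R - ‖z.1‖) / R) with hr
  set r' := ramp ((200 * R - ‖w.1‖) / R) with hr'
  set o := outgoingCutoff R z with ho
  set o' := outgoingCutoff R w with ho'
  have hrr : |r - r'| ≤ ‖z - w‖ := by
    refine (abs_ramp_sub_le _ _).trans ?_
    rw [← sub_div]
    refine (hdiv _).trans ?_
    rw [sub_sub_sub_cancel_left, abs_sub_comm]
    exact hn
  have hoo : r' * |o - o'| ≤ 404 * ‖z - w‖ := by
    rcases le_or_gt (200 * R) ‖w.1‖ with hw | hw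
    · have : r' = 0 := ramp_of_nonpos (div_nonpos_of_nonpos_of_nonneg (by linarith) hR0.le)
      rw [this, zero_mul]
      positivity
    refine (mul_le_of_le_one_left (abs_nonneg _) (ramp_le_one _)).trans ?_
    refine (abs_mul_sub_mul_le (abs_ramp_le_one _) (abs_ramp_le_one _)).trans ?_
    have h1 : |ramp (‖z.1‖ / R - 10) - ramp (‖w.1‖ / R - 10)| ≤ ‖z - w‖ := by
      refine (abs_ramp_sub_le _ _).trans ?_
      rw [sub_sub_sub_cancel_right, ← sub_div]
      exact (hdiv _).trans hn
    have h2 : |ramp ((inner ℝ z.1 (unitRetraction z.2) + 3 / 4 * ‖z.1‖) / R) -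
        ramp ((inner ℝ w.1 (unitRetraction w.2) + 3 / 4 * ‖w.1‖) / R)| ≤ 403 * ‖z - w‖ := by
      refine (abs_ramp_sub_le _ _).trans ?_
      rw [← sub_div]
      have e : inner ℝ z.1 (unitRetraction z.2) + 3 / 4 * ‖z.1‖ -
          (inner ℝ w.1 (unitRetraction w.2) + 3 / 4 * ‖w.1‖) =
          (inner ℝ (z.1 - w.1) (unitRetraction z.2) + 3 / 4 * (‖z.1‖ - ‖w.1‖)) +
          inner ℝ w.1 (unitRetraction z.2 - unitRetraction w.2) := by
        rw [inner_sub_left, inner_sub_right]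
        ring
      have i1 : |inner ℝ (z.1 - w.1) (unitRetraction z.2)| ≤ ‖z - w‖ :=
        (abs_real_inner_le_norm _ _).trans ((mul_le_of_le_one_right (norm_nonneg _)
          (norm_unitRetraction_le _)).trans hz1)
      have i2 : |inner ℝ w.1 (unitRetraction z.2 - unitRetraction w.2)| ≤
          200 * R * (2 * ‖z - w‖) := by
        refine (abs_real_inner_le_norm _ _).trans (mul_le_mul hw.le ?_ (norm_nonneg _)
          (by positivity))
        exact (norm_unitRetraction_sub_le _ _).trans (by linarith)
      rw [abs_div, abs_of_pos hR0, div_le_iff₀ hR0, e]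
      have i3 : |3 / 4 * (‖z.1‖ - ‖w.1‖)| ≤ ‖z - w‖ := by
        rw [abs_mul, abs_of_pos (by norm_num)]
        linarith [abs_nonneg (‖z.1‖ - ‖w.1‖)]
      refine (abs_add_le _ _).trans ((add_le_add ((abs_add_le _ _).trans (add_le_add i1 i3))
        i2).trans ?_)
      nlinarith [norm_nonneg (z - w)]
    linarith
  have e : escapeRate R K z - escapeRate R K w = (r - r') * (1 + K * o) + K * (r' * (o - o')) := by
    rw [escapeRate, escapeRate]
    ring
  rw [e]
  have ho0 := outgoingCutoff_nonneg R z
  have ho1 := outgoingCutoff_le_one R z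
  have hKo := mul_nonneg hK ho0
  have hKo1 := mul_le_mul_of_nonneg_left ho1 hK
  refine (abs_add_le _ _).trans ?_
  rw [abs_mul, abs_mul, abs_mul, abs_of_nonneg hK, abs_of_nonneg (ramp_nonneg _ : 0 ≤ r'),
    abs_of_nonneg (by linarith : 0 ≤ 1 + K * o)]
  have t1 : |r - r'| * (1 + K * o) ≤ ‖z - w‖ * (1 + K) :=
    mul_le_mul hrr (by linarith) (by linarith) (norm_nonneg _)
  have t2 := mul_le_mul_of_nonneg_left hoo hK
  nlinarith [norm_nonneg (z - w)]

theorem continuous_escapeRate (hR : 1 ≤ R) (hK : 0 ≤ K) : Continuous (escapeRate (E := E) R K) := by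
  refine (LipschitzWith.of_dist_le_mul (K := (405 * (1 + K)).toNNReal) fun z w => ?_).continuous
  rw [Real.coe_toNNReal _ (by positivity), Real.dist_eq, dist_eq_norm]
  exact abs_escapeRate_sub_le hR hK z w

end EscapeRate

/-! ### Integration of the density along the backward flow -/

section Escape

variable {E : Type*} [NormedAddCommGroup E] [InnerProductSpace ℝ E] [CompleteSpace E]
  {X Y : E → E → E} {Λ c η R L : ℝ}

/-- A past point in the support of the cutoff is outgoing with |x| ≥ 10R, so the curve would stay
beyond 3R at all later times and could not be in B_{2R} at time 0. -/
theorem IsSphereCurve.outgoingCutoff_eq_zero {x ξ : ℝ → E} (hc : IsSphereCurve X Y x ξ)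
    (hH : HamiltonBounds X Y Λ c η R) (hη : η ≤ 1 / 100) (hR : 0 < R) (h0 : ‖x 0‖ < 2 * R) {s : ℝ}
    (hs : s ≤ 0) : outgoingCutoff R (x s, ξ s) = 0 := by
  by_contra hne
  have h1 : 10 * R ≤ ‖x s‖ := by
    by_contra! h
    refine hne (mul_eq_zero_of_left (ramp_of_nonpos ?_) _)
    rw [sub_nonpos, div_le_iff₀ hR]
    exact h.le
  have h2 : -(3 / 4 * ‖x s‖) ≤ inner ℝ (x s) (ξ s) := by
    by_contra! h
    refine hne (mul_eq_zero_of_right _ (ramp_of_nonpos ?_))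
    refine div_nonpos_of_nonpos_of_nonneg ?_ hR.le
    simp only
    rw [unitRetraction_of_norm_le (hc.unit s).le]
    linarith
  have := hc.three_mul_le_norm_of_outgoing hH hη hR h1 h2 hs
  linarith

/-- In unit time the position moves by at most 21/10 and ξ by at most 1/50. Starting from |x| ≥ 49R
and cosine at least -51/100, the curve stays where both ramps equal 1: ⟨x,ξ⟩ + 3|x|/4 is still at
least 0.22·49R - 4 ≥ R. -/
theorem IsSphereCurve.outgoingCutoff_eq_one {x ξ : ℝ → E} (hc : IsSphereCurve X Y x ξ)
    (hH : HamiltonBounds X Y Λ c η R) (hη : η ≤ 1 / 100) (hR : 1 ≤ R) (h0 : 49 * R ≤ ‖x 0‖)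
    (hin : -(51 / 100 * ‖x 0‖) ≤ inner ℝ (x 0) (ξ 0)) {s : ℝ} (hs : s ∈ Icc (-1 : ℝ) 0) :
    outgoingCutoff R (x s, ξ s) = 1 ∧ ‖x s - x 0‖ ≤ 3 := by
  have hneg := hc.neg hH.X_neg hH.Y_neg
  have main : ∀ b ∈ Icc (0 : ℝ) 1, (∀ r ∈ Icc 0 b, ‖x (-r) - x 0‖ ≤ 3) →
      ‖x (-b) - x 0‖ ≤ 21 / 10 := by
    intro b hb hq
    have h1 := hneg.norm_x_sub_le hH hη hb.1 fun r hr => by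
      have := norm_sub_norm_le (x 0) (x (-r))
      rw [norm_sub_rev] at this
      linarith [hq r hr]
    simp only [neg_zero, sub_zero] at h1
    have h2 := norm_add_le (x (-b) - x 0 - (2 * b) • -ξ 0) ((2 * b) • -ξ 0)
    rw [sub_add_cancel, norm_smul, norm_neg, hc.unit, mul_one,
      Real.norm_of_nonneg (by linarith [hb.1])] at h2
    nlinarith [hb.1, hb.2]
  have hlt := forall_lt_of_forall_le_imp_lt (f := fun r => ‖x (-r) - x 0‖) (a := 0) (b := 1)
    (m := 3) ((hc.continuous_x.comp continuous_neg).sub continuous_const).norm (by simp)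
    fun b hb hq => (main b hb hq).trans_lt (by norm_num)
  have hsub : ‖x s - x 0‖ ≤ 21 / 10 := by
    have := main (-s) ⟨by linarith [hs.2], by linarith [hs.1]⟩ fun r hr =>
      (hlt r ⟨hr.1, by linarith [hr.2, hs.1]⟩).le
    rwa [neg_neg] at this
  have hn1 : ‖x 0‖ - 21 / 10 ≤ ‖x s‖ := by
    have := norm_sub_norm_le (x 0) (x s)
    rw [norm_sub_rev] at this
    linarith
  have hξ : ‖ξ s - ξ 0‖ ≤ 1 / 50 := by
    have := hneg.norm_xi_sub_le hH hη (a := 0) (b := 1) (fun r hr => by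
      have := norm_sub_norm_le (x 0) (x (-r))
      rw [norm_sub_rev] at this
      linarith [hlt r hr]) (-s) ⟨by linarith [hs.2], by linarith [hs.1]⟩
    rw [neg_neg, neg_zero, sub_neg_eq_add, neg_add_eq_sub, norm_sub_rev] at this
    linarith
  refine ⟨?_, by linarith⟩
  have hR0 : 0 < R := by linarith
  rw [outgoingCutoff, ramp_of_one_le, ramp_of_one_le, one_mul]
  · simp only
    rw [unitRetraction_of_norm_le (hc.unit s).le, le_div_iff₀ hR0]
    have e : inner ℝ (x s) (ξ s) =
        inner ℝ (x 0) (ξ 0) + inner ℝ (x s - x 0) (ξ s) + inner ℝ (x 0) (ξ s - ξ 0) := by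
      rw [inner_sub_left, inner_sub_right]
      ring
    have i1 := (abs_le.1 (abs_real_inner_le_norm (x s - x 0) (ξ s))).1
    have i2 := (abs_le.1 (abs_real_inner_le_norm (x 0) (ξ s - ξ 0))).1
    rw [hc.unit, mul_one] at i1
    have i3 := mul_le_mul_of_nonneg_left hξ (norm_nonneg (x 0))
    linarith
  · simp only
    rw [le_sub_iff_add_le, le_div_iff₀ hR0]
    linarith

/-- Quantitative properties of an escape function `ψ` of a field `V` on `E × E`. -/
structure IsEscapeFunction (V : E × E → E × E) (ψ : E × E → ℝ) (R τ Λ : ℝ) : Prop where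
  nonneg : ∀ z, 0 ≤ ψ z
  le : ∀ z, ψ z ≤ τ * (τ + 5)
  lip : ∀ z w, |ψ z - ψ w| ≤ 405 * τ * (τ + 5) * Real.exp (12 * Λ * τ) * ‖z - w‖
  incr : ∀ z w, ‖z.2‖ = 1 → ‖z.1‖ ≤ 101 * R → ‖w - z‖ * Real.exp (12 * Λ * τ) ≤ 1 → ∀ h, 0 ≤ h →
    2 * Λ * h ≤ 1 → h - 405 * τ * (τ + 5) * Real.exp (12 * Λ * τ) * (24 * Λ ^ 2 * h ^ 2) ≤
      ψ (w + h • V w) - ψ w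
  le_inner : ∀ z, ‖z.2‖ = 1 → ‖z.1‖ < 2 * R → ψ z ≤ τ
  ge_outgoing : ∀ z, ‖z.2‖ = 1 → 49 * R ≤ ‖z.1‖ → ‖z.1‖ ≤ 101 * R →
    -(51 / 100 * ‖z.1‖) ≤ inner ℝ z.1 z.2 → τ + 4 ≤ ψ z

/-- The function is the integral of the density over the past time interval of length τ; along the
flow it grows by the density at the present point minus that at time -τ, and the latter is zero
since τ exceeds the sojourn time. The weight τ + 4 makes one unit of time in the outgoing region
outweigh any past that ends in B_{2R}. The growth is proved also at points w off the sphere bundle,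
exponentially close to it, because mollification averages over them. -/
theorem HamiltonBounds.exists_isEscapeFunction (hH : HamiltonBounds X Y Λ c η R) (hη : η ≤ 1 / 100)
    (hΛ : 1 ≤ Λ) (hR : 1 ≤ R) (hc0 : 0 < c) (hL0 : 0 ≤ L)
    (hL : ∀ x ξ, IsSphereCurve X Y x ξ →
      ∫⁻ s in {s | ‖x s‖ < 2 * R}, ‖deriv x s‖ₑ ≤ ENNReal.ofReal L) {τ : ℝ}
    (hτ : 600 * R + L / (2 * c) + 1 ≤ τ) :
    ∃ ψ : E × E → ℝ, IsEscapeFunction (cosphereField X Y) ψ R τ Λ := by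
  have hLc : 0 ≤ L / (2 * c) := by positivity
  have hτ1 : 1 ≤ τ := by linarith
  have hR0 : 0 < R := by linarith
  have hK : 0 ≤ τ + 4 := by linarith
  set V := cosphereField X Y with hVdef
  have hV := hH.lipschitzWith_cosphereField
  have hVB := hH.norm_cosphereField_le
  have hco : ((12 * Λ).toNNReal : ℝ) = 12 * Λ := Real.coe_toNNReal _ (by positivity)
  obtain ⟨Φ, hΦ0, hΦ⟩ := hV.exists_global_flow hVB
  have hΦd : ∀ s z w, |s| ≤ τ → ‖Φ s z - Φ s w‖ ≤ Real.exp (12 * Λ * τ) * ‖z - w‖ := by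
    intro s z w hs
    have := hV.dist_le_of_hasDerivAt (hΦ z) (hΦ w) s
    rw [hΦ0, hΦ0, hco, dist_eq_norm, dist_eq_norm] at this
    refine this.trans (mul_le_mul_of_nonneg_right (Real.exp_le_exp.2 ?_) (norm_nonneg _))
    exact mul_le_mul_of_nonneg_left hs (by positivity)
  have hcurve : ∀ z : E × E, ‖z.2‖ = 1 →
      IsSphereCurve X Y (fun s => (Φ s z).1) (fun s => (Φ s z).2) := fun z hz =>
    hH.isSphereCurve (hΦ z) (by rw [hΦ0]; exact hz)
  have hΦc : ∀ z, Continuous fun s => Φ s z := fun z =>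
    continuous_iff_continuousAt.2 fun s => (hΦ z s).continuousAt
  have hfc := continuous_escapeRate (E := E) hR hK
  set f := escapeRate (E := E) R (τ + 4) with hf
  have hfΦ : ∀ z, Continuous fun s => f (Φ s z) := fun z => hfc.comp (hΦc z)
  have hfi : ∀ z a b, IntervalIntegrable (fun s => f (Φ s z)) volume a b := fun z a b =>
    (hfΦ z).intervalIntegrable a b
  have hf0 : ∀ z, 0 ≤ f z := escapeRate_nonneg hK
  set ψ : E × E → ℝ := fun z => ∫ s in (-τ)..0, f (Φ s z) with hψ
  set Lf := 405 * τ * (τ + 5) * Real.exp (12 * Λ * τ) with hLf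
  have hLf0 : 0 ≤ Lf := by positivity
  have hlip : ∀ z w, |ψ z - ψ w| ≤ Lf * ‖z - w‖ := by
    intro z w
    rw [hψ]
    simp only
    rw [← intervalIntegral.integral_sub (hfi z _ _) (hfi w _ _), ← Real.norm_eq_abs]
    refine (intervalIntegral.norm_integral_le_of_norm_le_const (C := 405 * (1 + (τ + 4)) *
      (Real.exp (12 * Λ * τ) * ‖z - w‖)) fun s hs => ?_).trans (le_of_eq ?_)
    · rw [uIoc_of_le (by linarith)] at hs
      refine (abs_escapeRate_sub_le hR hK _ _).trans (mul_le_mul_of_nonneg_left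
        (hΦd s z w ?_) (by positivity))
      rw [abs_le]
      constructor <;> linarith [hs.1, hs.2]
    · rw [zero_sub, neg_neg, abs_of_nonneg (by linarith), hLf]
      ring
  -- Moving along the flow translates the interval of integration; only the two end pieces remain.
  have hshift : ∀ w h, ψ (Φ h w) - ψ w =
      (∫ s in (0 : ℝ)..h, f (Φ s w)) - ∫ s in (-τ)..(-τ + h), f (Φ s w) := by
    intro w h
    have e : (fun s => Φ s (Φ h w)) = fun s => Φ (s + h) w :=
      hV.eq_of_hasDerivAt (hΦ _) (fun s => (hΦ w (s + h)).comp_add_const s h)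
        (by simp [hΦ0])
    have e1 : ψ (Φ h w) = ∫ s in (-τ + h)..h, f (Φ s w) := by
      have : ∀ s, Φ s (Φ h w) = Φ (s + h) w := congrFun e
      simp only [hψ, this]
      rw [intervalIntegral.integral_comp_add_right (fun s => f (Φ s w)), zero_add]
    rw [e1]
    have a1 := intervalIntegral.integral_add_adjacent_intervals (hfi w (-τ) 0) (hfi w 0 h)
    have a2 := intervalIntegral.integral_add_adjacent_intervals (hfi w (-τ) (-τ + h))
      (hfi w (-τ + h) h)
    simp only [hψ]
    linarith
  refine ⟨ψ, fun z => ?_, fun z => ?_, hlip, ?_, ?_, ?_⟩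
  · exact intervalIntegral.integral_nonneg (by linarith) fun s _ => hf0 _
  · have := intervalIntegral.integral_mono_on (by linarith) (hfi z (-τ) 0)
      (intervalIntegrable_const (c := 1 + (τ + 4))) fun s _ => escapeRate_le hK (Φ s z)
    rw [intervalIntegral.integral_const, zero_sub, neg_neg, smul_eq_mul] at this
    exact this.trans (le_of_eq (by ring))
  · intro z w hz2 hz1 hwz h hh hΛh
    have hexp1 : 1 ≤ Real.exp (12 * Λ * τ) := Real.one_le_exp (by positivity)
    have hwz1 : ‖w - z‖ ≤ 1 := by nlinarith [norm_nonneg (w - z)]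
    have hh1 : h ≤ 1 / 2 := by nlinarith
    have hpos : ∀ s ∈ Icc 0 h, 1 ≤ f (Φ s w) := by
      intro s hs
      refine one_le_escapeRate hR0 hK ?_
      have h1 := norm_sub_le_of_hasDerivAt_bounded hVB (hΦ w) 0 s
      rw [hΦ0, sub_zero, abs_of_nonneg hs.1] at h1
      have h2 : 2 * Λ * s ≤ 2 * Λ * h := mul_le_mul_of_nonneg_left hs.2 (by positivity)
      have h3 : ‖(Φ s w).1 - w.1‖ ≤ ‖Φ s w - w‖ := norm_fst_le (Φ s w - w)
      have h4 : ‖w.1 - z.1‖ ≤ ‖w - z‖ := norm_fst_le (w - z)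
      have h5 := norm_sub_norm_le (Φ s w).1 w.1
      have h6 := norm_sub_norm_le w.1 z.1
      linarith
    have hzero : ∀ s ∈ Icc (-τ) (-τ + h), f (Φ s w) = 0 := by
      intro s hs
      refine escapeRate_eq_zero hR0 ?_
      have hs0 : |s| ≤ τ := by
        rw [abs_le]
        constructor <;> linarith [hs.1, hs.2]
      have h1 := hΦd s w z hs0
      have h3 : ‖(Φ s w).1 - (Φ s z).1‖ ≤ ‖Φ s w - Φ s z‖ := norm_fst_le (Φ s w - Φ s z)
      have h5 := norm_sub_norm_le (Φ s z).1 (Φ s w).1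
      rw [norm_sub_rev] at h5
      -- Otherwise s and 0 would be two visits to the ball of radius 300R, at most 600R + L/(2c) ≤ τ
      -- - 1 apart, whereas s ≤ -τ + 1/2. Passing from z to w moves the point by at most 1, so it
      -- stays beyond 200R.
      have h6 : 300 * R < ‖(Φ s z).1‖ := by
        by_contra! hle
        have := (hcurve z hz2).sub_le_of_norm_le hH hη hR0 hc0 hL0 (hL _ _ (hcurve z hz2))
          (s₁ := s) (s₂ := 0) hle (by rw [hΦ0]; linarith)
        linarith [hs.2]
      rw [mul_comm] at hwz
      linarith
    have hI : h ≤ ψ (Φ h w) - ψ w := by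
      rw [hshift]
      have i1 := intervalIntegral.integral_mono_on hh
        (intervalIntegrable_const (c := (1 : ℝ))) (hfi w 0 h) hpos
      have i2 : ∫ s in (-τ)..(-τ + h), f (Φ s w) = 0 := by
        rw [intervalIntegral.integral_congr (g := fun _ => (0 : ℝ)) fun s hs => ?_]
        · simp
        · rw [uIcc_of_le (by linarith)] at hs
          exact hzero s hs
      rw [i2, sub_zero]
      simpa using i1
    -- The flow is replaced by its tangent line; the error is quadratic in h and disappears in the
    -- derivative.
    have h2 := hV.norm_sub_sub_smul_le hVB (hΦ w) hh
    rw [hΦ0, hco] at h2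
    have h3 := (abs_le.1 (hlip (w + h • V w) (Φ h w))).1
    have h4 : Lf * ‖w + h • V w - Φ h w‖ ≤ Lf * (24 * Λ ^ 2 * h ^ 2) := by
      refine mul_le_mul_of_nonneg_left ?_ hLf0
      rw [norm_sub_rev, ← sub_sub]
      exact h2.trans (le_of_eq (by ring))
    linarith
  · intro z hz2 hz1
    have hle : ∀ s ∈ Icc (-τ) 0, f (Φ s z) ≤ 1 := by
      intro s hs
      have h0 := (hcurve z hz2).outgoingCutoff_eq_zero hH hη hR0 (by simpa [hΦ0] using hz1) hs.2
      rw [hf, escapeRate]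
      change _ * (1 + (τ + 4) * outgoingCutoff R ((Φ s z).1, (Φ s z).2)) ≤ 1
      rw [h0, mul_zero, add_zero, mul_one]
      exact ramp_le_one _
    have := intervalIntegral.integral_mono_on (by linarith) (hfi z (-τ) 0)
      (intervalIntegrable_const (c := (1 : ℝ))) hle
    rw [intervalIntegral.integral_const, zero_sub, neg_neg, smul_eq_mul, mul_one] at this
    exact this
  · intro z hz2 hz1 hz1' hin
    have hge : ∀ s ∈ Icc (-1 : ℝ) 0, τ + 4 ≤ f (Φ s z) := by
      intro s hs
      obtain ⟨h1, h3⟩ := (hcurve z hz2).outgoingCutoff_eq_one hH hη hR (by simpa [hΦ0] using hz1)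
        (by simpa [hΦ0] using hin) hs
      simp only [hΦ0] at h3
      have h4 := norm_sub_norm_le (Φ s z).1 z.1
      rw [hf, escapeRate_eq_of_norm_le hR0 (by linarith)]
      change _ ≤ 1 + (τ + 4) * outgoingCutoff R ((Φ s z).1, (Φ s z).2)
      rw [h1]
      linarith
    have i1 := intervalIntegral.integral_mono_on (by norm_num)
      (intervalIntegrable_const (c := τ + 4)) (hfi z (-1) 0) hge
    have i2 := intervalIntegral.integral_add_adjacent_intervals (hfi z (-τ) (-1)) (hfi z (-1) 0)
    have i3 : 0 ≤ ∫ s in (-τ)..(-1), f (Φ s z) :=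
      intervalIntegral.integral_nonneg (by linarith) fun s _ => hf0 _
    rw [intervalIntegral.integral_const, zero_sub, neg_neg, one_smul] at i1
    simp only [hψ]
    linarith

end Escape

/-! ### Mollification -/

theorem locallyIntegrable_of_measurable_of_abs_le {G : Type*} [TopologicalSpace G]
    [MeasurableSpace G] {μ : Measure G} [IsLocallyFiniteMeasure μ]
    {F : G → ℝ} {S : ℝ} (hF : Measurable F) (hS : ∀ p, |F p| ≤ S) : LocallyIntegrable F μ := by
  refine (locallyIntegrable_const S).mono hF.aestronglyMeasurable (Eventually.of_forall fun p => ?_)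
  rw [Real.norm_eq_abs, Real.norm_eq_abs]
  exact (hS p).trans (le_abs_self S)

section Mollify

open scoped Convolution

variable {G : Type} [NormedAddCommGroup G] [NormedSpace ℝ G] [FiniteDimensional ℝ G]
  [MeasurableSpace G] [BorelSpace G]

/-- Every derivative falls on f, so by induction the constant depends on f and n only, and F enters
through its supremum. The bilinear pairing is arbitrary because the values of f change with each
derivative. -/
theorem exists_norm_iteratedFDeriv_convolution_le (μ : Measure G) [μ.IsAddHaarMeasure] (n : ℕ) :
    ∀ {A B : Type} [NormedAddCommGroup A] [NormedSpace ℝ A] [NormedAddCommGroup B]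
      [NormedSpace ℝ B] (T : A →L[ℝ] ℝ →L[ℝ] B) (f : G → A), HasCompactSupport f →
      ContDiff ℝ ∞ f → ∃ K, 0 ≤ K ∧ ∀ (F : G → ℝ) (S : ℝ), Measurable F → (∀ p, |F p| ≤ S) →
        ∀ p, ‖iteratedFDeriv ℝ n (f ⋆[T, μ] F) p‖ ≤ K * S := by
  induction n with
  | zero =>
    intro A B _ _ _ _ T f hf hf'
    have hfi : Integrable f μ := hf'.continuous.integrable_of_hasCompactSupport hf
    refine ⟨‖T‖ * ∫ w, ‖f w‖ ∂μ, by positivity, fun F S hF hS p => ?_⟩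
    rw [norm_iteratedFDeriv_zero, convolution_def]
    refine (norm_integral_le_of_norm_le ((hfi.norm.const_mul ‖T‖).mul_const S)
      (Eventually.of_forall fun w => ?_)).trans (le_of_eq ?_)
    · refine (T.le_opNorm₂ _ _).trans (mul_le_mul_of_nonneg_left ?_ (by positivity))
      exact hS _
    · rw [integral_mul_const, integral_const_mul]
  | succ n ih =>
    intro A B _ _ _ _ T f hf hf'
    obtain ⟨K, hK, h⟩ := ih (ContinuousLinearMap.precompL G T) (fderiv ℝ f) (hf.fderiv ℝ)
      (hf'.fderiv_right (by simp))
    refine ⟨K, hK, fun F S hF hS p => ?_⟩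
    rw [← norm_iteratedFDeriv_fderiv]
    have e : fderiv ℝ (f ⋆[T, μ] F) = fderiv ℝ f ⋆[ContinuousLinearMap.precompL G T, μ] F :=
      funext fun p => (hf.hasFDerivAt_convolution_left T (hf'.of_le (by simp))
        (locallyIntegrable_of_measurable_of_abs_le hF hS) p).fderiv
    rw [e]
    exact h F S hF hS p

variable (G) in
/-- A smooth probability density with support in the unit ball. -/
def mollifier : G → ℝ :=
  (⟨1 / 2, 1, by norm_num, by norm_num⟩ : ContDiffBump (0 : G)).normed Measure.addHaar

theorem contDiff_mollifier : ContDiff ℝ ∞ (mollifier G) :=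
  ContDiffBump.contDiff_normed _ (n := ⊤)

theorem hasCompactSupport_mollifier : HasCompactSupport (mollifier G) :=
  ContDiffBump.hasCompactSupport_normed _

theorem mollifier_nonneg (w : G) : 0 ≤ mollifier G w := ContDiffBump.nonneg_normed _ w

theorem integral_mollifier : ∫ w, mollifier G w ∂Measure.addHaar = 1 :=
  ContDiffBump.integral_normed _

theorem mollifier_eq_zero {w : G} (h : 1 < ‖w‖) : mollifier G w = 0 := by
  by_contra hne
  have hmem : w ∈ Function.support (mollifier G) := hne
  rw [mollifier, ContDiffBump.support_normed_eq, mem_ball_zero_iff] at hmem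
  linarith

theorem integrable_mollifier : Integrable (mollifier G) Measure.addHaar :=
  contDiff_mollifier.continuous.integrable_of_hasCompactSupport hasCompactSupport_mollifier

/-- The mollification of `F` at scale `δ`. -/
def mollify (δ : ℝ) (F : G → ℝ) (p : G) : ℝ :=
  (mollifier G ⋆[ContinuousLinearMap.lsmul ℝ ℝ, Measure.addHaar] fun y => F (δ • y)) (δ⁻¹ • p)

variable {F : G → ℝ} {S δ : ℝ}

theorem mollify_eq_integral (hδ : δ ≠ 0) (p : G) :
    mollify δ F p = ∫ w, mollifier G w * F (p - δ • w) ∂Measure.addHaar := by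
  rw [mollify, convolution_def]
  refine integral_congr_ae (Eventually.of_forall fun w => ?_)
  simp [smul_sub, smul_inv_smul₀ hδ]

theorem contDiff_mollify (hF : Measurable F) (hS : ∀ p, |F p| ≤ S) : ContDiff ℝ ∞ (mollify δ F) := by
  refine ContDiff.comp (g := mollifier G ⋆[ContinuousLinearMap.lsmul ℝ ℝ, Measure.addHaar]
    fun y => F (δ • y)) ?_ (contDiff_const_smul _)
  exact hasCompactSupport_mollifier.contDiff_convolution_left _ contDiff_mollifier
    (locallyIntegrable_of_measurable_of_abs_le (hF.comp (measurable_const_smul δ)) fun p => hS _)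

variable (G) in
theorem exists_norm_iteratedFDeriv_mollify_le (n : ℕ) :
    ∃ K, 0 ≤ K ∧ ∀ (F : G → ℝ) (S δ : ℝ), 0 < δ → Measurable F → (∀ p, |F p| ≤ S) →
      ∀ p, ‖iteratedFDeriv ℝ n (mollify δ F) p‖ ≤ δ⁻¹ ^ n * (K * S) := by
  obtain ⟨K, hK, h⟩ := exists_norm_iteratedFDeriv_convolution_le (Measure.addHaar (G := G)) n
    (ContinuousLinearMap.lsmul ℝ ℝ) (mollifier G) hasCompactSupport_mollifier contDiff_mollifier
  refine ⟨K, hK, fun F S δ hδ hF hS p => ?_⟩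
  have hF' : Measurable fun y => F (δ • y) := hF.comp (measurable_const_smul δ)
  have hsm := hasCompactSupport_mollifier.contDiff_convolution_left
    (ContinuousLinearMap.lsmul ℝ ℝ) (contDiff_mollifier (G := G))
    (locallyIntegrable_of_measurable_of_abs_le (μ := Measure.addHaar) hF' fun p => hS _)
  have e : iteratedFDeriv ℝ n (mollify δ F) p = δ⁻¹ ^ n • iteratedFDeriv ℝ n (mollifier G
      ⋆[ContinuousLinearMap.lsmul ℝ ℝ, Measure.addHaar] fun y => F (δ • y)) (δ⁻¹ • p) :=
    congrFun (iteratedFDeriv_comp_const_smul δ⁻¹ (hsm.of_le (by exact_mod_cast le_top))) p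
  rw [e, norm_smul, Real.norm_of_nonneg (by positivity)]
  exact mul_le_mul_of_nonneg_left (h _ S hF' (fun p => hS _) _) (by positivity)

theorem integrable_mollifier_mul (hF : Measurable F) (hS : ∀ p, |F p| ≤ S) (p : G) :
    Integrable (fun w => mollifier G w * F (p - δ • w)) Measure.addHaar := by
  refine integrable_mollifier.mul_bdd (c := S) ?_ (Eventually.of_forall fun w => hS _)
  exact (hF.comp (measurable_const.sub (measurable_const_smul δ))).aestronglyMeasurable

/-- Inequalities between translates pass to the average against a probability density. Applied to
small increments this bounds derivatives of the mollification without any differentiability of F. -/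
theorem mollify_add_le (hF : Measurable F) (hS : ∀ p, |F p| ≤ S) (hδ : δ ≠ 0) {p p' : G} {a : ℝ}
    (h : ∀ w, ‖w‖ ≤ 1 → F (p - δ • w) + a ≤ F (p' - δ • w)) :
    mollify δ F p + a ≤ mollify δ F p' := by
  rw [mollify_eq_integral hδ, mollify_eq_integral hδ, ← mul_one a, ← integral_mollifier (G := G),
    ← integral_const_mul, ← integral_add (integrable_mollifier_mul hF hS p)
      (integrable_mollifier.const_mul a)]
  refine integral_mono ((integrable_mollifier_mul hF hS p).add (integrable_mollifier.const_mul a))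
    (integrable_mollifier_mul hF hS p') fun w => ?_
  simp only
  rcases le_or_gt ‖w‖ 1 with hw | hw
  · have := mul_le_mul_of_nonneg_left (h w hw) (mollifier_nonneg w)
    linarith
  · rw [mollifier_eq_zero hw]
    simp

theorem le_mollify (hF : Measurable F) (hS : ∀ p, |F p| ≤ S) (hδ : δ ≠ 0) {p : G} {a : ℝ}
    (h : ∀ w, ‖w‖ ≤ 1 → a ≤ F (p - δ • w)) : a ≤ mollify δ F p := by
  rw [mollify_eq_integral hδ, ← mul_one a, ← integral_mollifier (G := G), ← integral_const_mul]
  refine integral_mono (integrable_mollifier.const_mul a) (integrable_mollifier_mul hF hS p)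
    fun w => ?_
  simp only
  rcases le_or_gt ‖w‖ 1 with hw | hw
  · have := mul_le_mul_of_nonneg_left (h w hw) (mollifier_nonneg w)
    linarith
  · rw [mollifier_eq_zero hw]
    simp

theorem mollify_le (hF : Measurable F) (hS : ∀ p, |F p| ≤ S) (hδ : δ ≠ 0) {p : G} {a : ℝ}
    (h : ∀ w, ‖w‖ ≤ 1 → F (p - δ • w) ≤ a) : mollify δ F p ≤ a := by
  rw [mollify_eq_integral hδ, ← mul_one a, ← integral_mollifier (G := G), ← integral_const_mul]
  refine integral_mono (integrable_mollifier_mul hF hS p) (integrable_mollifier.const_mul a)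
    fun w => ?_
  simp only
  rcases le_or_gt ‖w‖ 1 with hw | hw
  · have := mul_le_mul_of_nonneg_left (h w hw) (mollifier_nonneg w)
    linarith
  · rw [mollifier_eq_zero hw]
    simp

end Mollify

/-! ### Mollified escape functions -/

/-- The largest multiple of `δ` below `t`, truncated to `[0,T]`. -/
def timeStep (T : ℝ) (hT : 0 ≤ T) (δ t : ℝ) : ℝ := projIcc 0 T hT (δ * ⌊t / δ⌋)

theorem timeStep_mem {T : ℝ} (hT : 0 ≤ T) (δ t : ℝ) : timeStep T hT δ t ∈ Icc 0 T :=
  (projIcc 0 T hT _).2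

theorem abs_timeStep_sub_le {T : ℝ} (hT : 0 ≤ T) {δ t : ℝ} (hδ : 0 < δ) (ht : t ∈ Icc 0 T)
    (t' : ℝ) : |timeStep T hT δ t' - t| ≤ |t' - t| + δ := by
  have h1 : |timeStep T hT δ t' - t| ≤ |δ * ⌊t' / δ⌋ - t| := by
    have := abs_projIcc_sub_projIcc hT (c := δ * ⌊t' / δ⌋) (d := t)
    rwa [projIcc_of_mem hT ht] at this
  have h2 : |δ * ⌊t' / δ⌋ - t'| ≤ δ := by
    have a1 := Int.floor_le (t' / δ)
    have a2 := Int.lt_floor_add_one (t' / δ)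
    rw [le_div_iff₀ hδ] at a1
    rw [div_lt_iff₀ hδ] at a2
    rw [abs_le]
    constructor <;> nlinarith
  refine h1.trans ?_
  have e : δ * ⌊t' / δ⌋ - t = (t' - t) + (δ * ⌊t' / δ⌋ - t') := by ring
  rw [e]
  exact (abs_add_le _ _).trans (by linarith)

/-- Nothing is known about the dependence of ψ on time. Freezing time on a grid leaves countably
many continuous functions, hence a jointly measurable one. -/
theorem measurable_comp_timeStep {Z : Type*} [TopologicalSpace Z] [MeasurableSpace Z]
    [OpensMeasurableSpace Z] {T : ℝ} (hT : 0 ≤ T) (δ : ℝ) {ψ : ℝ → Z → ℝ}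
    (hψ : ∀ t ∈ Icc 0 T, Continuous (ψ t)) :
    Measurable fun p : ℝ × Z => ψ (timeStep T hT δ p.1) p.2 := by
  have h1 : ∀ f : ℤ → Z → ℝ, (∀ n, Measurable (f n)) →
      Measurable fun p : ℝ × Z => f ⌊p.1 / δ⌋ p.2 := fun f hf => by
    have h2 : Measurable (Function.uncurry f) := measurable_from_prod_countable_right hf
    have h3 : Measurable fun p : ℝ × Z => ⌊p.1 / δ⌋ :=
      Int.measurable_floor.comp (measurable_fst.div_const δ)
    exact h2.comp (h3.prodMk measurable_snd)
  exact h1 (fun n => ψ (projIcc 0 T hT (δ * n))) fun n =>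
    (hψ _ (projIcc 0 T hT (δ * n)).2).measurable

theorem HasDerivAt.le_of_forall_add_le {g : ℝ → ℝ} {g' a b h₀ : ℝ} (hg : HasDerivAt g g' 0)
    (hh : 0 < h₀) (h : ∀ h, 0 < h → h ≤ h₀ → g 0 + (h * a - b * h ^ 2) ≤ g h) : a ≤ g' := by
  have h1 := hg.tendsto_slope_zero_right
  have h2 : Tendsto (fun h : ℝ => a - b * h) (𝓝[>] 0) (𝓝 a) := by
    have : Tendsto (fun h : ℝ => a - b * h) (𝓝 0) (𝓝 (a - b * 0)) :=
      (by fun_prop : Continuous fun h : ℝ => a - b * h).tendsto 0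
    rw [mul_zero, sub_zero] at this
    exact this.mono_left nhdsWithin_le_nhds
  refine le_of_tendsto_of_tendsto h2 h1 ?_
  filter_upwards [Ioc_mem_nhdsGT hh] with s hs
  have := h s hs.1 hs.2
  rw [zero_add, smul_eq_mul, le_inv_mul_iff₀ hs.1]
  nlinarith

/-- Quantitative properties of a smooth time dependent escape function of the fields `V t`. -/
structure IsSmoothEscape {d : ℕ} (V : ℝ → Eu d × Eu d → Eu d × Eu d) (Ψ : ℝ × Eu d × Eu d → ℝ)
    (T R τ ℓ : ℝ) : Prop where
  smooth : ContDiff ℝ ∞ Ψ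
  nonneg : ∀ p, 0 ≤ Ψ p
  le_inner : ∀ t z, ‖z.2‖ = 1 → ‖z.1‖ < 2 * R → Ψ (t, z) ≤ τ + 1 / 2
  ge_outgoing : ∀ t z, ‖z.2‖ = 1 → 49 * R ≤ ‖z.1‖ → ‖z.1‖ ≤ 101 * R →
    -(51 / 100 * ‖z.1‖) ≤ inner ℝ z.1 z.2 → τ + 7 / 2 ≤ Ψ (t, z)
  abs_fderiv_le : ∀ p v, |fderiv ℝ Ψ p (0, v)| ≤ ℓ * ‖v‖
  incr : ∀ t ∈ Icc 0 T, ∀ z, ‖z.2‖ = 1 → ‖z.1‖ ≤ 101 * R → 1 / 2 ≤ fderiv ℝ Ψ (t, z) (0, V t z)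

/-- The only danger is the mismatch between the field at (t,z) and the one at the frozen time and
shifted point. It is O(Λ√δ), because the field is 1/2-Hölder in time, and it is multiplied by the
Lipschitz constant ℓ. Hence √δ must be a small multiple of 1/(Λℓ). The values change by at most ℓδ ≤
1/2. -/
theorem exists_isSmoothEscape (d : ℕ) : ∃ K : ℕ → ℝ, (∀ n, 0 ≤ K n) ∧
    ∀ (V : ℝ → Eu d × Eu d → Eu d × Eu d) (ψ : ℝ → Eu d × Eu d → ℝ) (T R τ Λ ℓ : ℝ), 0 ≤ T →
      1 ≤ R → 1 ≤ τ → 1 ≤ Λ → ℓ = 405 * τ * (τ + 5) * Real.exp (12 * Λ * τ) →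
      (∀ t ∈ Icc 0 T, IsEscapeFunction (V t) (ψ t) R τ Λ) →
      (∀ t ∈ Icc 0 T, ∀ z w, ‖V t z - V t w‖ ≤ 12 * Λ * ‖z - w‖) →
      (∀ t ∈ Icc 0 T, ∀ r ∈ Icc 0 T, |t - r| ≤ 1 → ∀ z, ‖V t z - V r z‖ ≤ Λ * √|t - r|) →
      ∃ Ψ, IsSmoothEscape V Ψ T R τ ℓ ∧
        ∀ n p, ‖iteratedFDeriv ℝ n Ψ p‖ ≤ ((28 * Λ * ℓ) ^ 2) ^ n * (K n * (τ * (τ + 5))) := by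
  choose K hK0 hK using exists_norm_iteratedFDeriv_mollify_le (ℝ × Eu d × Eu d)
  refine ⟨K, hK0, fun V ψ T R τ Λ ℓ hT hR hτ hΛ hℓ hψ hVlip hVt => ?_⟩
  have hexp : 1 ≤ Real.exp (12 * Λ * τ) := Real.one_le_exp (by positivity)
  have hexpℓ : Real.exp (12 * Λ * τ) ≤ ℓ := by
    rw [hℓ]
    refine le_mul_of_one_le_left (by linarith) ?_
    nlinarith
  have hℓ1 : 1 ≤ ℓ := hexp.trans hexpℓ
  set m := 28 * Λ * ℓ with hm
  have hm1 : 28 * ℓ ≤ m := by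
    rw [hm]
    nlinarith
  have hm0 : 0 < m := by linarith
  set δ := (m ^ 2)⁻¹ with hδdef
  have hδ : 0 < δ := by positivity
  have hδ1 : 28 * ℓ * δ ≤ 1 := by
    rw [hδdef, ← div_eq_mul_inv, div_le_one (by positivity)]
    nlinarith
  have hδs : δ ≤ 1 / 28 := by nlinarith
  have hsq : m⁻¹ ^ 2 = δ := by rw [hδdef, inv_pow]
  have hψc : ∀ t ∈ Icc 0 T, Continuous (ψ t) := fun t ht => by
    refine (LipschitzWith.of_dist_le_mul (K := ℓ.toNNReal) fun z w => ?_).continuous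
    rw [Real.coe_toNNReal _ (by linarith), Real.dist_eq, dist_eq_norm, hℓ]
    exact (hψ t ht).lip z w
  set F : ℝ × Eu d × Eu d → ℝ := fun p => ψ (timeStep T hT δ p.1) p.2 with hF
  have hts : ∀ t, timeStep T hT δ t ∈ Icc 0 T := timeStep_mem hT δ
  have hFm : Measurable F := measurable_comp_timeStep hT δ hψc
  have hFS : ∀ p, |F p| ≤ τ * (τ + 5) := fun p => by
    rw [abs_of_nonneg ((hψ _ (hts _)).nonneg _)]
    exact (hψ _ (hts _)).le _
  have hFlip : ∀ t z w, |F (t, z) - F (t, w)| ≤ ℓ * ‖z - w‖ := fun t z w => by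
    rw [hℓ]
    exact (hψ _ (hts _)).lip z w
  have hδw : ∀ w : ℝ × Eu d × Eu d, ‖w‖ ≤ 1 → ‖δ • w.2‖ ≤ δ := fun w hw => by
    rw [norm_smul, Real.norm_of_nonneg hδ.le]
    exact mul_le_of_le_one_right hδ.le ((norm_snd_le w).trans hw)
  have hnear : ∀ t z, ∀ w : ℝ × Eu d × Eu d, ‖w‖ ≤ 1 →
      |F ((t, z) - δ • w) - ψ (timeStep T hT δ (t - δ * w.1)) z| ≤ 1 / 2 := by
    intro t z w hw
    have h1 := hFlip (t - δ * w.1) (z - δ • w.2) z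
    have h2 : ℓ * ‖z - δ • w.2 - z‖ ≤ ℓ * δ := by
      refine mul_le_mul_of_nonneg_left ?_ (by linarith)
      rw [sub_sub_cancel_left, norm_neg]
      exact hδw w hw
    exact h1.trans (h2.trans (by linarith))
  have hsm := contDiff_mollify (δ := δ) hFm hFS
  have hdiff : ∀ p, HasFDerivAt (mollify δ F) (fderiv ℝ (mollify δ F) p) p := fun p =>
    (hsm.differentiable (by simp) p).hasFDerivAt
  refine ⟨mollify δ F, ⟨hsm, ?_, ?_, ?_, ?_, ?_⟩, fun n p => ?_⟩
  · exact fun p => le_mollify hFm hFS hδ.ne' fun w _ => (hψ _ (hts _)).nonneg _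
  · intro t z hz2 hz1
    refine mollify_le hFm hFS hδ.ne' fun w hw => ?_
    have h1 := (abs_le.1 (hnear t z w hw)).2
    have h2 := (hψ _ (hts (t - δ * w.1))).le_inner z hz2 hz1
    linarith
  · intro t z hz2 hz1 hz1' hin
    refine le_mollify hFm hFS hδ.ne' fun w hw => ?_
    have h1 := (abs_le.1 (hnear t z w hw)).1
    have h2 := (hψ _ (hts (t - δ * w.1))).ge_outgoing z hz2 hz1 hz1' hin
    linarith
  · intro p v
    have hg : ∀ v : Eu d × Eu d, fderiv ℝ (mollify δ F) p (0, v) ≤ ℓ * ‖v‖ := by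
      intro v
      have hline : HasDerivAt (fun h : ℝ => -mollify δ F (p + h • (0, v)))
          (-(fderiv ℝ (mollify δ F) p (0, v))) 0 := by
        have h1 : HasLineDerivAt ℝ (mollify δ F) _ p (0, v) := (hdiff p).hasLineDerivAt (0, v)
        exact HasDerivAt.fun_neg h1
      have := hline.le_of_forall_add_le (a := -(ℓ * ‖v‖)) (b := 0) one_pos fun h hh _ => by
        rw [zero_smul, add_zero]
        have := mollify_add_le hFm hFS hδ.ne' (p := p + h • (0, v)) (p' := p)
          (a := -(h * (ℓ * ‖v‖))) fun w _ => by
            have h1 := (abs_le.1 (hFlip (p.1 - δ * w.1) (p.2 + h • v - δ • w.2)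
              (p.2 - δ • w.2))).2
            rw [sub_sub_sub_cancel_right, add_sub_cancel_left, norm_smul,
              Real.norm_of_nonneg hh.le] at h1
            have e1 : p + h • ((0 : ℝ), v) - δ • w =
                (p.1 - δ * w.1, p.2 + h • v - δ • w.2) := by
              ext1 <;> simp
            have e2 : p - δ • w = (p.1 - δ * w.1, p.2 - δ • w.2) := by
              ext1 <;> simp
            rw [e1, e2]
            linarith
        linarith
      linarith
    have h1 := hg v
    have h2 := hg (-v)
    have e : fderiv ℝ (mollify δ F) p (0, -v) = -fderiv ℝ (mollify δ F) p (0, v) := by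
      rw [← map_neg]
      congr 1
      ext1 <;> simp
    rw [e, norm_neg] at h2
    rw [abs_le]
    constructor <;> linarith
  · intro t ht z hz2 hz1
    set v := V t z with hv
    have hline : HasDerivAt (fun h : ℝ => mollify δ F ((t, z) + h • (0, v)))
        (fderiv ℝ (mollify δ F) (t, z) (0, v)) 0 := by
      have h1 : HasLineDerivAt ℝ (mollify δ F) _ (t, z) (0, v) :=
        (hdiff (t, z)).hasLineDerivAt (0, v)
      exact h1
    refine hline.le_of_forall_add_le (b := ℓ * (24 * Λ ^ 2)) (h₀ := (2 * Λ)⁻¹) (by positivity)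
      fun h hh hhΛ => ?_
    rw [zero_smul, add_zero]
    refine mollify_add_le hFm hFS hδ.ne' fun w hw => ?_
    set r := timeStep T hT δ (t - δ * w.1) with hr
    set y := z - δ • w.2 with hy
    have e1 : (t, z) + h • ((0 : ℝ), v) - δ • w = (t - δ * w.1, y + h • v) := by
      ext1
      · simp
      · simp [hy, add_sub_right_comm]
    have e2 : (t, z) - δ • w = (t - δ * w.1, y) := by
      ext1 <;> simp [hy]
    have hyz : ‖y - z‖ ≤ δ := by
      rw [hy, sub_sub_cancel_left, norm_neg]
      exact hδw w hw
    have htr : |t - r| ≤ 2 * δ := by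
      rw [abs_sub_comm]
      refine (abs_timeStep_sub_le hT hδ ht _).trans ?_
      rw [sub_sub_cancel_left, abs_neg, abs_mul, abs_of_pos hδ]
      have : |w.1| ≤ 1 := (norm_fst_le w).trans hw
      nlinarith
    -- The time shift costs at most Λ√(2δ) ≤ 2Λ/m and the shift in z at most 12Λδ ≤ 12Λ/m. With m =
    -- 28Λℓ the product of the sum with ℓ is exactly 1/2, so half of the rate 1 survives.
    have hVd : ‖v - V r y‖ ≤ 14 * Λ * m⁻¹ := by
      have a1 := hVt t ht r (hts _) (by linarith) z
      have a2 := hVlip r (hts (t - δ * w.1)) z y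
      rw [norm_sub_rev z y] at a2
      have a3 : √|t - r| ≤ 2 * m⁻¹ := by
        refine Real.sqrt_le_iff.2 ⟨by positivity, htr.trans ?_⟩
        rw [mul_pow, hsq]
        linarith
      have a4 : ‖v - V r y‖ ≤ ‖V t z - V r z‖ + ‖V r z - V r y‖ := norm_sub_le_norm_sub_add_norm_sub _ _ _
      have a5 : δ ≤ m⁻¹ := by
        have : m⁻¹ ≤ 1 := inv_le_one_of_one_le₀ (by linarith)
        rw [← hsq]
        have : 0 < m⁻¹ := by positivity
        nlinarith
      have a6 : Λ * √|t - r| ≤ Λ * (2 * m⁻¹) := mul_le_mul_of_nonneg_left a3 (by linarith)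
      have a7 : 12 * Λ * ‖y - z‖ ≤ 12 * Λ * m⁻¹ :=
        mul_le_mul_of_nonneg_left (hyz.trans a5) (by positivity)
      linarith
    have hi := (hψ r (hts _)).incr z y hz2 hz1 (by
      refine (mul_le_mul hyz hexpℓ (by positivity) hδ.le).trans ?_
      nlinarith) h hh.le (by
      rw [← le_inv_mul_iff₀ (by positivity), mul_one]
      exact hhΛ)
    rw [← hℓ] at hi
    have hl := (abs_le.1 (hFlip (t - δ * w.1) (y + h • v) (y + h • V r y))).1
    rw [add_sub_add_left_eq_sub, ← smul_sub, norm_smul, Real.norm_of_nonneg hh.le] at hl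
    have hb : ℓ * (h * ‖v - V r y‖) ≤ h * (1 / 2) := by
      have : ℓ * (14 * Λ * m⁻¹) = 1 / 2 := by
        rw [hm]
        field_simp
        norm_num
      calc ℓ * (h * ‖v - V r y‖) = h * (ℓ * ‖v - V r y‖) := by ring
        _ ≤ h * (ℓ * (14 * Λ * m⁻¹)) := by gcongr
        _ = _ := by rw [this]
    rw [e1, e2]
    change ψ r y + _ ≤ _
    change -(ℓ * _) ≤ F (t - δ * w.1, y + h • v) - ψ r (y + h • V r y) at hl
    linarith
  · have := hK n F (τ * (τ + 5)) δ hδ hFm hFS p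
    rwa [hδdef, inv_inv] at this

/-! ### Mixed partial derivatives -/

section Partial

variable {P W F : Type} [NormedAddCommGroup P] [NormedSpace ℝ P] [NormedAddCommGroup W]
  [NormedSpace ℝ W] [NormedAddCommGroup F] [NormedSpace ℝ F]

theorem norm_iteratedFDeriv_clm_comp_le (L : F →L[ℝ] W) (hL : ∀ x, ‖L x‖ ≤ ‖x‖) {g : P → F} {p : P}
    (hg : ContDiffAt ℝ ∞ g p) (m : ℕ) :
    ‖iteratedFDeriv ℝ m (fun p => L (g p)) p‖ ≤ ‖iteratedFDeriv ℝ m g p‖ := by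
  refine (L.norm_iteratedFDeriv_comp_left hg (n := m) (by exact_mod_cast le_top)).trans ?_
  exact mul_le_of_le_one_left (norm_nonneg _)
    (L.opNorm_le_bound zero_le_one (by simpa using hL))

variable (P F) in
theorem exists_iteratedFDeriv_succ_eq (n : ℕ) :
    ∃ L : (P [×n]→L[ℝ] (P →L[ℝ] F)) →L[ℝ] P [×(n + 1)]→L[ℝ] F, (∀ x, ‖L x‖ ≤ ‖x‖) ∧
      ∀ f : P → F, iteratedFDeriv ℝ (n + 1) f = fun p => L (iteratedFDeriv ℝ n (fderiv ℝ f) p) := by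
  refine ⟨LinearIsometryEquiv.toContinuousLinearEquiv
    (continuousMultilinearCurryRightEquiv' ℝ n P F).symm, fun x => ?_, fun f => ?_⟩
  · exact ((continuousMultilinearCurryRightEquiv' ℝ n P F).symm.norm_map x).le
  · funext x
    exact iteratedFDeriv_succ_eq_comp_right

theorem contDiffAt_iteratedFDeriv {f : P → F} {p : P} (hf : ContDiffAt ℝ ∞ f p) (n : ℕ) :
    ContDiffAt ℝ ∞ (iteratedFDeriv ℝ n f) p :=
  hf.iteratedFDeriv_right (m := ((⊤ : ℕ∞) : WithTop ℕ∞)) (by exact_mod_cast le_top)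

theorem norm_iteratedFDeriv_iteratedFDeriv_le (n m : ℕ) (p : P) :
    ∀ {F : Type} [NormedAddCommGroup F] [NormedSpace ℝ F] {f : P → F},
      ContDiffAt ℝ ∞ f p →
        ‖iteratedFDeriv ℝ m (iteratedFDeriv ℝ n f) p‖ ≤ ‖iteratedFDeriv ℝ (m + n) f p‖ := by
  induction n with
  | zero =>
    intro F _ _ f hf
    rw [iteratedFDeriv_zero_eq_comp, LinearIsometryEquiv.norm_iteratedFDeriv_comp_left, add_zero]
  | succ n ih =>
    intro F _ _ f hf
    have hf' : ContDiffAt ℝ ∞ (fderiv ℝ f) p := hf.fderiv_right (by simp)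
    obtain ⟨L, hL, h⟩ := exists_iteratedFDeriv_succ_eq P F n
    have h2 := norm_iteratedFDeriv_clm_comp_le L hL (contDiffAt_iteratedFDeriv hf' n) m
    have h3 := h f
    have h4 := h2.trans (ih hf')
    rw [norm_iteratedFDeriv_fderiv] at h4
    rw [← add_assoc]
    generalize iteratedFDeriv ℝ (n + 1) f = g at h3 ⊢
    subst h3
    exact h4

theorem iteratedFDeriv_comp_add_clm {U : Set P} (hU : IsOpen U) {f : P → F} (hf : ContDiffOn ℝ ∞ f U)
    (A : W →L[ℝ] P) (c : P) {w : W} (hw : c + A w ∈ U) (n : ℕ) :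
    iteratedFDeriv ℝ n (fun w => f (c + A w)) w =
      (iteratedFDeriv ℝ n f (c + A w)).compContinuousLinearMap fun _ => A := by
  have hS : IsOpen ((fun p => c + p) ⁻¹' U) := hU.preimage (continuous_const_add c)
  have hfS : ContDiffOn ℝ ∞ (fun p => f (c + p)) ((fun p => c + p) ⁻¹' U) :=
    hf.comp (by fun_prop) fun p hp => hp
  have hA : IsOpen (A ⁻¹' ((fun p => c + p) ⁻¹' U)) := hS.preimage A.continuous
  have h := A.iteratedFDerivWithin_comp_right hfS hS.uniqueDiffOn hA.uniqueDiffOn (x := w) hw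
    (i := n) (by exact_mod_cast le_top)
  rw [iteratedFDerivWithin_of_isOpen n hA hw, iteratedFDerivWithin_of_isOpen n hS hw,
    iteratedFDeriv_comp_add_left] at h
  exact h

/-- The `n`-th derivative of `f` in the directions of the range of `A`. -/
def partialFDeriv (A : W →L[ℝ] P) (n : ℕ) (f : P → F) (p : P) :
    ContinuousMultilinearMap ℝ (fun _ : Fin n => W) F :=
  (iteratedFDeriv ℝ n f p).compContinuousLinearMap fun _ => A

theorem partialFDeriv_eq_comp (A : W →L[ℝ] P) (n : ℕ) (f : P → F) :
    partialFDeriv A n f = ContinuousMultilinearMap.compContinuousLinearMapL (𝕜 := ℝ)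
      (fun _ : Fin n => A) ∘ iteratedFDeriv ℝ n f := rfl

theorem contDiffAt_partialFDeriv (A : W →L[ℝ] P) (n : ℕ) {f : P → F} {p : P}
    (hf : ContDiffAt ℝ ∞ f p) : ContDiffAt ℝ ∞ (partialFDeriv A n f) p := by
  rw [partialFDeriv_eq_comp]
  exact (ContinuousLinearMap.contDiff _).contDiffAt.comp p (contDiffAt_iteratedFDeriv hf n)

theorem norm_iteratedFDeriv_partialFDeriv_le (A : W →L[ℝ] P) (n m : ℕ) {f : P → F} {p : P}
    (hf : ContDiffAt ℝ ∞ f p) : ‖iteratedFDeriv ℝ m (partialFDeriv A n f) p‖ ≤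
      ‖A‖ ^ n * ‖iteratedFDeriv ℝ (m + n) f p‖ := by
  rw [partialFDeriv_eq_comp]
  refine le_trans ?_ (mul_le_mul_of_nonneg_left (norm_iteratedFDeriv_iteratedFDeriv_le n m p hf)
    (by positivity))
  refine (ContinuousLinearMap.norm_iteratedFDeriv_comp_left _ (contDiffAt_iteratedFDeriv hf n)
    (by exact_mod_cast le_top)).trans (mul_le_mul_of_nonneg_right ?_ (norm_nonneg _))
  refine (ContinuousMultilinearMap.norm_compContinuousLinearMapL_le F _).trans ?_
  simp

end Partial

theorem isOpen_snd_snd_ne_zero (d : ℕ) : IsOpen {p : ℝ × Eu d × Eu d | p.2.2 ≠ 0} :=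
  isOpen_ne_fun (by fun_prop) continuous_const

/-- By homogeneity η may be replaced by rη with r = 1/|ξ|; each ξ-derivative then yields a factor r
and is evaluated on the unit sphere. The three groups of derivatives are taken along injections of
norm at most 1, 1 and r, so the derivative of order j + k + l controls them. -/
theorem norm_mixedDeriv_le {d : ℕ} {H : ℝ × Eu d × Eu d → ℝ}
    (hH : ContDiffOn ℝ ∞ H {p | p.2.2 ≠ 0})
    (hom : ∀ t x ξ, ∀ r > (0 : ℝ), H (t, x, r • ξ) = H (t, x, ξ)) (j k l : ℕ) (t : ℝ) (x : Eu d)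
    {ξ : Eu d} (hξ : ξ ≠ 0) : ‖mixedDeriv j k l (fun t x ξ => H (t, x, ξ)) t x ξ‖ ≤
      ‖iteratedFDeriv ℝ (j + k + l) H (t, x, ‖ξ‖⁻¹ • ξ)‖ * (‖ξ‖ ^ l)⁻¹ := by
  have hU := isOpen_snd_snd_ne_zero d
  set U : Set (ℝ × Eu d × Eu d) := {p | p.2.2 ≠ 0} with hUdef
  set r := ‖ξ‖⁻¹ with hr
  have hr0 : 0 < r := by positivity
  have hrξ : r • ξ ≠ 0 := smul_ne_zero hr0.ne' hξ
  set A₁ : ℝ →L[ℝ] ℝ × Eu d × Eu d := ContinuousLinearMap.inl ℝ ℝ (Eu d × Eu d) with hA₁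
  set A₂ : Eu d →L[ℝ] ℝ × Eu d × Eu d := (ContinuousLinearMap.inr ℝ ℝ (Eu d × Eu d)).comp
    (ContinuousLinearMap.inl ℝ (Eu d) (Eu d)) with hA₂
  set A₃ : Eu d →L[ℝ] ℝ × Eu d × Eu d := r • (ContinuousLinearMap.inr ℝ ℝ (Eu d × Eu d)).comp
    (ContinuousLinearMap.inr ℝ (Eu d) (Eu d)) with hA₃
  have n₁ : ‖A₁‖ ≤ 1 := ContinuousLinearMap.opNorm_le_bound _ zero_le_one fun v => by
    simp [hA₁, Prod.norm_def]
  have n₂ : ‖A₂‖ ≤ 1 := ContinuousLinearMap.opNorm_le_bound _ zero_le_one fun v => by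
    simp [hA₂, Prod.norm_def]
  have n₃ : ‖A₃‖ ≤ r := ContinuousLinearMap.opNorm_le_bound _ hr0.le fun v => by
    simp [hA₃, Prod.norm_def, norm_smul, abs_of_pos hr0]
    positivity
  have hHat : ∀ p ∈ U, ContDiffAt ℝ ∞ H p := fun p hp => hH.contDiffAt (hU.mem_nhds hp)
  set H₁ := partialFDeriv A₃ l H with hH₁
  have hH₁at : ∀ p ∈ U, ContDiffAt ℝ ∞ H₁ p := fun p hp => contDiffAt_partialFDeriv _ _ (hHat p hp)
  set H₂ := partialFDeriv A₂ k H₁ with hH₂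
  have hH₂at : ∀ p ∈ U, ContDiffAt ℝ ∞ H₂ p := fun p hp => contDiffAt_partialFDeriv _ _ (hH₁at p hp)
  have e₁ : ∀ τ y, iteratedFDeriv ℝ l (fun η => H (τ, y, η)) ξ = H₁ (τ, y, r • ξ) := by
    intro τ y
    have h1 : (fun η => H (τ, y, η)) = fun η => H ((τ, y, 0) + A₃ η) := by
      funext η
      rw [← hom τ y η r hr0]
      simp [hA₃]
    have h2 : (τ, y, 0) + A₃ ξ = (τ, y, r • ξ) := by simp [hA₃]
    rw [h1, iteratedFDeriv_comp_add_clm hU hH A₃ _ (by rw [h2]; exact hrξ), h2]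
    rfl
  have e₂ : ∀ τ, iteratedFDeriv ℝ k (fun y => H₁ (τ, y, r • ξ)) x = H₂ (τ, x, r • ξ) := by
    intro τ
    have h1 : (fun y => H₁ (τ, y, r • ξ)) = fun y => H₁ ((τ, 0, r • ξ) + A₂ y) := by
      funext y
      simp [hA₂]
    have h2 : (τ, 0, r • ξ) + A₂ x = (τ, x, r • ξ) := by simp [hA₂]
    rw [h1, iteratedFDeriv_comp_add_clm hU (fun p hp => (hH₁at p hp).contDiffWithinAt) A₂ _
      (by rw [h2]; exact hrξ), h2]
    rfl
  have e₃ : ‖iteratedDeriv j (fun τ => H₂ (τ, x, r • ξ)) t‖ ≤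
      ‖iteratedFDeriv ℝ j H₂ (t, x, r • ξ)‖ := by
    have h1 : (fun τ => H₂ (τ, x, r • ξ)) = fun τ => H₂ ((0, x, r • ξ) + A₁ τ) := by
      funext y
      simp [hA₁]
    have h2 : (0, x, r • ξ) + A₁ t = (t, x, r • ξ) := by simp [hA₁]
    rw [← norm_iteratedFDeriv_eq_norm_iteratedDeriv, h1,
      iteratedFDeriv_comp_add_clm hU (fun p hp => (hH₂at p hp).contDiffWithinAt) A₁ _
      (by rw [h2]; exact hrξ), h2]
    refine (ContinuousMultilinearMap.norm_compContinuousLinearMap_le _ _).trans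
      (mul_le_of_le_one_right (norm_nonneg _) ?_)
    simpa using pow_le_one₀ (norm_nonneg _) n₁
  have hp : (t, x, r • ξ) ∈ U := hrξ
  have b₁ := norm_iteratedFDeriv_partialFDeriv_le A₂ k j (hH₁at _ hp)
  have b₂ := norm_iteratedFDeriv_partialFDeriv_le A₃ l (j + k) (hHat _ hp)
  rw [mixedDeriv]
  simp only [e₁, e₂]
  calc _ ≤ ‖iteratedFDeriv ℝ j H₂ (t, x, r • ξ)‖ := e₃
    _ ≤ 1 * ‖iteratedFDeriv ℝ (j + k) H₁ (t, x, r • ξ)‖ :=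
        b₁.trans (mul_le_mul_of_nonneg_right (pow_le_one₀ (norm_nonneg _) n₂) (norm_nonneg _))
    _ ≤ r ^ l * ‖iteratedFDeriv ℝ (j + k + l) H (t, x, r • ξ)‖ := by
        rw [one_mul]
        exact b₂.trans (mul_le_mul_of_nonneg_right (pow_le_pow_left₀ (norm_nonneg _) n₃ _)
          (norm_nonneg _))
    _ = _ := by rw [hr, inv_pow, mul_comm]

/-! ### Functions on the sphere bundle extended by homogeneity -/

/-- The radial projection `(t,x,ξ) ↦ (t,x,ξ/|ξ|)`. -/
def sphereProj {d : ℕ} (p : ℝ × Eu d × Eu d) : ℝ × Eu d × Eu d :=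
  (p.1, p.2.1, ‖p.2.2‖⁻¹ • p.2.2)

theorem contDiffOn_sphereProj (d : ℕ) :
    ContDiffOn ℝ ∞ (sphereProj (d := d)) {p | p.2.2 ≠ 0} := by
  intro p hp
  refine ContDiffAt.contDiffWithinAt ?_
  have h1 : ContDiffAt ℝ ∞ (fun p : ℝ × Eu d × Eu d => p.2.2) p := by fun_prop
  exact contDiffAt_fst.prodMk ((contDiffAt_fst.comp p contDiffAt_snd).prodMk
    (((h1.norm ℝ hp).inv (norm_ne_zero_iff.2 hp)).smul h1))

/-- A translation in (t,x) changes the projection by a constant only. So its derivatives of positive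
order depend on ξ alone, and the unit sphere is compact. -/
theorem exists_norm_iteratedFDeriv_sphereProj_le (d i : ℕ) (hi : 1 ≤ i) :
    ∃ B, ∀ p : ℝ × Eu d × Eu d, ‖p.2.2‖ = 1 → ‖iteratedFDeriv ℝ i sphereProj p‖ ≤ B := by
  have hU := isOpen_snd_snd_ne_zero d
  have hcont : ContinuousOn (fun p => iteratedFDeriv ℝ i (sphereProj (d := d)) p)
      {p | p.2.2 ≠ 0} := by
    refine ((contDiffOn_sphereProj d).continuousOn_iteratedFDerivWithin (m := i)
      (by exact_mod_cast le_top) hU.uniqueDiffOn).congr fun p hp => ?_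
    exact (iteratedFDerivWithin_of_isOpen i hU hp).symm
  have hK : IsCompact ((fun ξ : Eu d => ((0 : ℝ), (0 : Eu d), ξ)) '' Metric.sphere 0 1) :=
    (isCompact_sphere _ _).image (by fun_prop)
  obtain ⟨B, hB⟩ := hK.exists_bound_of_continuousOn (hcont.mono (by
    rintro _ ⟨ξ, hξ, rfl⟩ h0
    simp only at h0
    rw [h0] at hξ
    simp at hξ))
  refine ⟨B, fun p hp => ?_⟩
  have h1 := hB (0, 0, p.2.2) ⟨p.2.2, by simpa using hp, rfl⟩
  obtain ⟨k, rfl⟩ := Nat.exists_eq_add_of_le' hi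
  refine le_trans (le_of_eq ?_) h1
  have e1 : p = ((0 : ℝ), (0 : Eu d), p.2.2) + (p.1, p.2.1, 0) := by
    ext1
    · simp
    · ext1 <;> simp
  have e2 : (fun z : ℝ × Eu d × Eu d => sphereProj (z + (p.1, p.2.1, 0))) =
      fun z => sphereProj z + (p.1, p.2.1, 0) := by
    funext z
    simp [sphereProj]
  conv_lhs => rw [e1]
  rw [← iteratedFDeriv_comp_add_right, e2, ← norm_iteratedFDeriv_fderiv,
    ← norm_iteratedFDeriv_fderiv]
  congr 2
  funext z
  exact fderiv_add_const _

theorem exists_norm_iteratedFDeriv_comp_sphereProj_le (d N : ℕ) :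
    ∃ B, 0 ≤ B ∧ ∀ (Q : ℝ × Eu d × Eu d → ℝ) (C : ℝ), ContDiff ℝ ∞ Q →
      (∀ i ≤ N, ∀ p, ‖iteratedFDeriv ℝ i Q p‖ ≤ C) → ∀ p : ℝ × Eu d × Eu d, ‖p.2.2‖ = 1 →
        ‖iteratedFDeriv ℝ N (fun p => Q (sphereProj p)) p‖ ≤ B * C := by
  have hU := isOpen_snd_snd_ne_zero d
  have hB : ∀ i, ∃ B, ∀ p : ℝ × Eu d × Eu d, 1 ≤ i → ‖p.2.2‖ = 1 →
      ‖iteratedFDeriv ℝ i sphereProj p‖ ≤ B := fun i => by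
    by_cases hi : 1 ≤ i
    · obtain ⟨B, hB⟩ := exists_norm_iteratedFDeriv_sphereProj_le d i hi
      exact ⟨B, fun p _ => hB p⟩
    · exact ⟨0, fun p h => absurd h hi⟩
  choose B hB using hB
  set D := 1 + ∑ i ∈ Finset.range (N + 1), |B i| with hD
  have hD1 : 1 ≤ D := by
    have : 0 ≤ ∑ i ∈ Finset.range (N + 1), |B i| := Finset.sum_nonneg fun i _ => abs_nonneg _
    linarith
  refine ⟨N.factorial * D ^ N, by positivity, fun Q C hQ hC p hp => ?_⟩
  have hpU : p ∈ {p : ℝ × Eu d × Eu d | p.2.2 ≠ 0} := by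
    intro h0
    rw [h0, norm_zero] at hp
    exact zero_ne_one hp
  have h := norm_iteratedFDerivWithin_comp_le (n := N) (N := ((⊤ : ℕ∞) : WithTop ℕ∞))
    (hQ.contDiffOn (s := univ)) (contDiffOn_sphereProj d) (by exact_mod_cast le_top)
    uniqueDiffOn_univ hU.uniqueDiffOn (mapsTo_univ _ _) hpU (C := C) (D := D)
    (fun i hi => by
      rw [iteratedFDerivWithin_univ]
      exact hC i hi _)
    (fun i hi hiN => by
      rw [iteratedFDerivWithin_of_isOpen i hU hpU]
      refine (hB i p hi hp).trans (le_trans ?_ (le_self_pow₀ hD1 (by omega)))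
      have : |B i| ≤ ∑ i ∈ Finset.range (N + 1), |B i| :=
        Finset.single_le_sum (f := fun i => |B i|) (fun i _ => abs_nonneg _)
          (Finset.mem_range.2 (by omega))
      linarith [le_abs_self (B i)])
  rw [iteratedFDerivWithin_of_isOpen N hU hpU] at h
  exact h.trans (le_of_eq (by ring))

/-! ### The exponential profile -/

theorem exists_norm_iteratedFDeriv_smoothTransition_le (n : ℕ) :
    ∃ B, 1 ≤ B ∧ ∀ u, ‖iteratedFDeriv ℝ n Real.smoothTransition u‖ ≤ B := by
  have hcont : Continuous (iteratedFDeriv ℝ n Real.smoothTransition) :=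
    (Real.smoothTransition.contDiff (n := n)).continuous_iteratedFDeriv le_rfl
  obtain ⟨B, hB⟩ := (isCompact_Icc (a := (0 : ℝ)) (b := 1)).exists_bound_of_continuousOn
    hcont.continuousOn
  have hconst : ∀ c : ℝ, |c| ≤ 1 → ∀ u, ‖iteratedFDeriv ℝ n (fun _ : ℝ => c) u‖ ≤ 1 := by
    intro c hc u
    rcases eq_or_ne n 0 with rfl | hn
    · simpa using hc
    · rw [iteratedFDeriv_const_of_ne hn]
      simp
  refine ⟨max 1 B, le_max_left _ _, fun u => ?_⟩
  rcases lt_or_ge u 0 with h0 | h0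
  · have : Real.smoothTransition =ᶠ[𝓝 u] fun _ => 0 := by
      filter_upwards [Iio_mem_nhds h0] with v hv
      exact Real.smoothTransition.zero_of_nonpos (le_of_lt hv)
    rw [(this.iteratedFDeriv ℝ n).eq_of_nhds]
    exact (hconst 0 (by simp) u).trans (le_max_left _ _)
  rcases lt_or_ge 1 u with h1 | h1
  · have : Real.smoothTransition =ᶠ[𝓝 u] fun _ => 1 := by
      filter_upwards [Ioi_mem_nhds h1] with v hv
      exact Real.smoothTransition.one_of_one_le (le_of_lt hv)
    rw [(this.iteratedFDeriv ℝ n).eq_of_nhds]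
    exact (hconst 1 (by simp) u).trans (le_max_left _ _)
  · exact (hB u ⟨h0, h1⟩).trans (le_max_right _ _)

/-- The increasing profile `e^{Ku}`, cut off smoothly to `u > 0`. -/
def expProfile (K u : ℝ) : ℝ := Real.exp (K * u) * Real.smoothTransition u

theorem contDiff_expProfile (K : ℝ) : ContDiff ℝ ∞ (expProfile K) :=
  (by fun_prop : ContDiff ℝ ∞ fun u => Real.exp (K * u)).mul Real.smoothTransition.contDiff

theorem expProfile_nonneg (K u : ℝ) : 0 ≤ expProfile K u :=
  mul_nonneg (Real.exp_pos _).le (Real.smoothTransition.nonneg u)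

theorem expProfile_of_nonpos (K : ℝ) {u : ℝ} (h : u ≤ 0) : expProfile K u = 0 := by
  rw [expProfile, Real.smoothTransition.zero_of_nonpos h, mul_zero]

/-- The derivative is K times the profile plus e^{Ku} times the derivative of a nondecreasing
function. This is the source of the factor CM in the positive commutator. -/
theorem exp_le_expProfile_deriv {K : ℝ} (u : ℝ) :
    K * expProfile K u ≤ deriv (expProfile K) u := by
  have h1 : HasDerivAt (fun u => Real.exp (K * u)) (Real.exp (K * u) * (K * 1)) u :=
    ((hasDerivAt_id' u).const_mul K).exp
  have h2 : HasDerivAt Real.smoothTransition (deriv Real.smoothTransition u) u :=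
    ((Real.smoothTransition.contDiff (n := 1)).differentiable (by simp) u).hasDerivAt
  have h3 : 0 ≤ deriv Real.smoothTransition u := Real.smoothTransition.monotone.deriv_nonneg
  have h4 : HasDerivAt (expProfile K) _ u := h1.mul h2
  rw [h4.deriv, expProfile]
  have := mul_nonneg (Real.exp_pos (K * u)).le h3
  linarith

theorem exists_norm_iteratedFDeriv_expProfile_le (N : ℕ) :
    ∃ B, 0 ≤ B ∧ ∀ K s u : ℝ, 1 ≤ K → u ≤ s → ∀ i ≤ N,
      ‖iteratedFDeriv ℝ i (expProfile K) u‖ ≤ B * K ^ N * Real.exp (K * s) := by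
  choose B hB1 hB using exists_norm_iteratedFDeriv_smoothTransition_le
  set S := ∑ i ∈ Finset.range (N + 1), B i with hS
  have hSB : ∀ i ≤ N, B i ≤ S := fun i hi =>
    Finset.single_le_sum (f := B) (fun i _ => zero_le_one.trans (hB1 i))
      (Finset.mem_range.2 (by omega))
  have hS0 : 0 ≤ S := (zero_le_one.trans (hB1 0)).trans (hSB 0 (Nat.zero_le _))
  refine ⟨2 ^ N * S, by positivity, fun K s u hK hu i hi => ?_⟩
  have hE : ContDiff ℝ ∞ fun u => Real.exp (K * u) := by fun_prop
  have hsum := norm_iteratedFDeriv_mul_le hE (Real.smoothTransition.contDiff (n := ⊤)) u (n := i)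
    (by exact_mod_cast le_top)
  refine hsum.trans ?_
  have hterm : ∀ a ∈ Finset.range (i + 1), (i.choose a : ℝ) *
      ‖iteratedFDeriv ℝ a (fun u => Real.exp (K * u)) u‖ *
      ‖iteratedFDeriv ℝ (i - a) Real.smoothTransition u‖ ≤
      (i.choose a : ℝ) * (K ^ N * Real.exp (K * s) * S) := by
    intro a ha
    have haN : a ≤ N := by
      have := Finset.mem_range.1 ha
      omega
    rw [mul_assoc]
    refine mul_le_mul_of_nonneg_left (mul_le_mul ?_ ((hB _ u).trans (hSB _ (by omega)))
      (norm_nonneg _) (by positivity)) (by positivity)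
    rw [norm_iteratedFDeriv_eq_norm_iteratedDeriv, iteratedDeriv_exp_const_mul,
      Real.norm_of_nonneg (by positivity)]
    exact mul_le_mul (pow_le_pow_right₀ hK haN)
      (Real.exp_le_exp.2 (mul_le_mul_of_nonneg_left hu (by linarith))) (Real.exp_pos _).le
      (by positivity)
  refine (Finset.sum_le_sum hterm).trans ?_
  rw [← Finset.sum_mul]
  have hch : (∑ a ∈ Finset.range (i + 1), (i.choose a : ℝ)) ≤ 2 ^ N := by
    have h1 : (∑ a ∈ Finset.range (i + 1), (i.choose a : ℝ)) = 2 ^ i := by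
      exact_mod_cast Nat.sum_range_choose i
    rw [h1]
    exact pow_le_pow_right₀ (by norm_num) hi
  refine (mul_le_mul_of_nonneg_right hch (by positivity)).trans (le_of_eq (by ring))

/-- The symbol `G(s - Ψ(t,x,ξ/|ξ|))`, where `G` is the exponential profile. -/
def escapeSymbol {d : ℕ} (K s : ℝ) (Ψ : ℝ × Eu d × Eu d → ℝ) (p : ℝ × Eu d × Eu d) : ℝ :=
  expProfile K (s - Ψ (sphereProj p))

theorem contDiffOn_escapeSymbol {d : ℕ} (K s : ℝ) {Ψ : ℝ × Eu d × Eu d → ℝ} (hΨ : ContDiff ℝ ∞ Ψ) :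
    ContDiffOn ℝ ∞ (escapeSymbol K s Ψ) {p | p.2.2 ≠ 0} :=
  (contDiff_expProfile K).comp_contDiffOn
    (contDiffOn_const.sub (hΨ.comp_contDiffOn (contDiffOn_sphereProj d)))

theorem exists_norm_iteratedFDeriv_escapeSymbol_le (d N : ℕ) :
    ∃ B, 0 ≤ B ∧ ∀ (K s D : ℝ) (Ψ : ℝ × Eu d × Eu d → ℝ), 1 ≤ K → 1 ≤ D → ContDiff ℝ ∞ Ψ →
      (∀ p, 0 ≤ Ψ p) → (∀ i, 1 ≤ i → i ≤ N → ∀ p, ‖iteratedFDeriv ℝ i Ψ p‖ ≤ D ^ i) →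
      ∀ p : ℝ × Eu d × Eu d, ‖p.2.2‖ = 1 →
        ‖iteratedFDeriv ℝ N (escapeSymbol K s Ψ) p‖ ≤ B * (K ^ N * Real.exp (K * s) * D ^ N) := by
  obtain ⟨B₁, hB₁0, hB₁⟩ := exists_norm_iteratedFDeriv_comp_sphereProj_le d N
  obtain ⟨B₂, hB₂0, hB₂⟩ := exists_norm_iteratedFDeriv_expProfile_le N
  refine ⟨B₁ * (N.factorial * B₂), by positivity, fun K s D Ψ hK hD hΨ hΨ0 hΨD p hp => ?_⟩
  have hu : ContDiff ℝ ∞ fun p => s - Ψ p := contDiff_const.sub hΨ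
  have h := hB₁ (fun p => expProfile K (s - Ψ p))
    (N.factorial * (B₂ * K ^ N * Real.exp (K * s)) * D ^ N)
    ((contDiff_expProfile K).comp hu) (fun i hi p => ?_) p hp
  · exact h.trans (le_of_eq (by ring))
  · have h1 := norm_iteratedFDeriv_comp_le (contDiff_expProfile K) hu (n := i)
      (by exact_mod_cast le_top) p
      (C := B₂ * K ^ N * Real.exp (K * s)) (D := D)
      (fun a ha => hB₂ K s _ hK (by linarith [hΨ0 p]) a (ha.trans hi))
      (fun a ha hai => by
        refine le_trans (le_of_eq ?_) (hΨD a ha (hai.trans hi) p)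
        obtain ⟨k, rfl⟩ := Nat.exists_eq_add_of_le' ha
        rw [← norm_iteratedFDeriv_fderiv, ← norm_iteratedFDeriv_fderiv]
        have : fderiv ℝ (fun p => s - Ψ p) = -fderiv ℝ Ψ := by
          funext p
          rw [fderiv_const_sub, Pi.neg_apply]
        rw [this, iteratedFDeriv_neg_apply, norm_neg])
    refine h1.trans ?_
    gcongr

/-! ### The commutator with the escape symbol -/

theorem gradXi_princSymbol_smul {d : ℕ} (G : Eu d → Matrix (Fin d) (Fin d) ℝ) (x ξ : Eu d) (r : ℝ) :
    gradXi (princSymbol G) x (r • ξ) = r • gradXi (princSymbol G) x ξ := by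
  refine ext_inner_right ℝ fun v => ?_
  rw [real_inner_smul_left, inner_gradXi_princSymbol, inner_gradXi_princSymbol, Finset.mul_sum]
  refine Finset.sum_congr rfl fun i _ => ?_
  rw [Finset.mul_sum]
  refine Finset.sum_congr rfl fun k _ => ?_
  simp only [PiLp.smul_apply, smul_eq_mul]
  ring

theorem gradX_princSymbol_smul {d : ℕ} {G : Eu d → Matrix (Fin d) (Fin d) ℝ} {x : Eu d}
    (hG : ∀ i k, DifferentiableAt ℝ (fun x => G x i k) x) (ξ : Eu d) (r : ℝ) :
    gradX (princSymbol G) x (r • ξ) = r ^ 2 • gradX (princSymbol G) x ξ := by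
  refine ext_inner_right ℝ fun v => ?_
  rw [real_inner_smul_left, inner_gradX_princSymbol _ _ _ _ hG, inner_gradX_princSymbol _ _ _ _ hG,
    Finset.mul_sum]
  refine Finset.sum_congr rfl fun i _ => ?_
  rw [Finset.mul_sum]
  refine Finset.sum_congr rfl fun k _ => ?_
  simp only [PiLp.smul_apply, smul_eq_mul]
  ring

theorem hasDerivAt_normalize {E : Type*} [NormedAddCommGroup E] [InnerProductSpace ℝ E] {ξ : E}
    (hξ : ξ ≠ 0) (v : E) : HasDerivAt (fun h : ℝ => ‖ξ + h • v‖⁻¹ • (ξ + h • v))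
      (‖ξ‖⁻¹ • (v - (inner ℝ (‖ξ‖⁻¹ • ξ) v : ℝ) • ‖ξ‖⁻¹ • ξ)) 0 := by
  have h0 : ‖ξ‖ ≠ 0 := norm_ne_zero_iff.2 hξ
  have h1 : HasDerivAt (fun h : ℝ => ξ + h • v) v 0 := by
    simpa using ((hasDerivAt_id' (0 : ℝ)).smul_const v).const_add ξ
  have h2 : HasDerivAt (fun h : ℝ => √(‖ξ + h • v‖ ^ 2)) (inner ℝ ξ v / ‖ξ‖) 0 := by
    refine (h1.norm_sq.sqrt (by simpa using hξ)).congr_deriv ?_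
    rw [zero_smul, add_zero, Real.sqrt_sq (norm_nonneg ξ)]
    field_simp
  simp only [Real.sqrt_sq (norm_nonneg _)] at h2
  refine ((h2.fun_inv (by simpa using hξ)).fun_smul h1).congr_deriv ?_
  rw [zero_smul, add_zero, smul_sub, smul_smul, smul_smul, real_inner_smul_left, sub_eq_add_neg,
    ← neg_smul]
  congr 2
  field_simp

/-! ### Derivatives of the escape symbol -/

section EscapeSymbol

variable {d : ℕ} {K s : ℝ} {Ψ : ℝ × Eu d × Eu d → ℝ}

theorem hasDerivAt_expProfile_comp (hΨ : ContDiff ℝ ∞ Ψ) {γ : ℝ → ℝ × Eu d × Eu d}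
    {γ' : ℝ × Eu d × Eu d} (hγ : HasDerivAt γ γ' 0) :
    HasDerivAt (fun h => expProfile K (s - Ψ (γ h)))
      (-(deriv (expProfile K) (s - Ψ (γ 0)) * fderiv ℝ Ψ (γ 0) γ')) 0 := by
  have h1 : HasDerivAt (fun h => s - Ψ (γ h)) (-(fderiv ℝ Ψ (γ 0) γ')) 0 :=
    ((hΨ.differentiable (by simp) (γ 0)).hasFDerivAt.comp_hasDerivAt (0 : ℝ) hγ).const_sub s
  have h2 := ((contDiff_expProfile K).differentiable (by simp) (s - Ψ (γ 0))).hasDerivAt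
  have h3 := h2.comp (0 : ℝ) h1
  rw [mul_neg] at h3
  exact h3

theorem contDiffAt_escapeSymbol (hΨ : ContDiff ℝ ∞ Ψ) (t : ℝ) (x : Eu d) {ξ : Eu d} (hξ : ξ ≠ 0) :
    ContDiffAt ℝ ∞ (escapeSymbol K s Ψ) (t, x, ξ) :=
  (contDiffOn_escapeSymbol K s hΨ).contDiffAt ((isOpen_snd_snd_ne_zero d).mem_nhds hξ)

theorem inner_gradX_escapeSymbol (hΨ : ContDiff ℝ ∞ Ψ) (t : ℝ) (x : Eu d) {ξ : Eu d} (hξ : ξ ≠ 0)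
    (v : Eu d) : inner ℝ (gradX (fun x ξ => escapeSymbol K s Ψ (t, x, ξ)) x ξ) v =
      -(deriv (expProfile K) (s - Ψ (t, x, ‖ξ‖⁻¹ • ξ)) *
        fderiv ℝ Ψ (t, x, ‖ξ‖⁻¹ • ξ) (0, v, 0)) := by
  have hd : DifferentiableAt ℝ (fun y => escapeSymbol K s Ψ (t, y, ξ)) x :=
    ((contDiffAt_escapeSymbol hΨ t x hξ).differentiableAt (by simp)).comp
      (f := fun y => (t, y, ξ)) x (by fun_prop)
  rw [gradX, inner_gradient_eq, ← hd.lineDeriv_eq_fderiv]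
  have hγ : HasDerivAt (fun h : ℝ => (t, x + h • v, ‖ξ‖⁻¹ • ξ)) ((0 : ℝ), v, (0 : Eu d)) 0 := by
    refine (hasDerivAt_const _ _).prodMk (HasDerivAt.prodMk ?_ (hasDerivAt_const _ _))
    simpa using ((hasDerivAt_id' (0 : ℝ)).smul_const v).const_add x
  have h := hasDerivAt_expProfile_comp (K := K) (s := s) hΨ hγ
  simp only [zero_smul, add_zero] at h
  exact HasLineDerivAt.lineDeriv h

theorem inner_gradXi_escapeSymbol (hΨ : ContDiff ℝ ∞ Ψ) (t : ℝ) (x : Eu d) {ξ : Eu d} (hξ : ξ ≠ 0)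
    (v : Eu d) : inner ℝ (gradXi (fun x ξ => escapeSymbol K s Ψ (t, x, ξ)) x ξ) v =
      -(deriv (expProfile K) (s - Ψ (t, x, ‖ξ‖⁻¹ • ξ)) * fderiv ℝ Ψ (t, x, ‖ξ‖⁻¹ • ξ)
        (0, 0, ‖ξ‖⁻¹ • (v - (inner ℝ (‖ξ‖⁻¹ • ξ) v : ℝ) • ‖ξ‖⁻¹ • ξ))) := by
  have hd : DifferentiableAt ℝ (fun η => escapeSymbol K s Ψ (t, x, η)) ξ :=
    ((contDiffAt_escapeSymbol hΨ t x hξ).differentiableAt (by simp)).comp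
      (f := fun η => (t, x, η)) ξ (by fun_prop)
  rw [gradXi, inner_gradient_eq, ← hd.lineDeriv_eq_fderiv]
  have hγ : HasDerivAt (fun h : ℝ => (t, x, ‖ξ + h • v‖⁻¹ • (ξ + h • v))) ((0 : ℝ), (0 : Eu d),
      ‖ξ‖⁻¹ • (v - (inner ℝ (‖ξ‖⁻¹ • ξ) v : ℝ) • ‖ξ‖⁻¹ • ξ)) 0 :=
    (hasDerivAt_const _ _).prodMk ((hasDerivAt_const _ _).prodMk (hasDerivAt_normalize hξ v))
  have h := hasDerivAt_expProfile_comp (K := K) (s := s) hΨ hγ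
  simp only [zero_smul, add_zero] at h
  exact HasLineDerivAt.lineDeriv h

/-- In ξ, a_ξ has degree 1 and a_x has degree 2, and the derivative of ξ/|ξ| is the tangential
projection divided by |ξ|. So on functions of degree 0, H_a is |ξ| times the derivative along the
projected field. The sign is absorbed by the minus in s - Ψ. -/
theorem neg_hamVF_escapeSymbol (hΨ : ContDiff ℝ ∞ Ψ) {G : Eu d → Matrix (Fin d) (Fin d) ℝ} (t : ℝ)
    {x : Eu d} (hG : ∀ i k, DifferentiableAt ℝ (fun x => G x i k) x) {ξ : Eu d} (hξ : ξ ≠ 0) :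
    -hamVF (princSymbol G) (fun x ξ => escapeSymbol K s Ψ (t, x, ξ)) x ξ =
      deriv (expProfile K) (s - Ψ (t, x, ‖ξ‖⁻¹ • ξ)) * (‖ξ‖ * fderiv ℝ Ψ (t, x, ‖ξ‖⁻¹ • ξ)
        (0, cosphereField (gradXi (princSymbol G)) (gradX (princSymbol G)) (x, ‖ξ‖⁻¹ • ξ))) := by
  have h0 : ‖ξ‖ ≠ 0 := norm_ne_zero_iff.2 hξ
  set ζ := ‖ξ‖⁻¹ • ξ with hζ
  have hζ1 : ‖ζ‖ = 1 := by
    rw [hζ, norm_smul, norm_inv, norm_norm, inv_mul_cancel₀ (norm_ne_zero_iff.2 hξ)]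
  have hξζ : ξ = ‖ξ‖ • ζ := by rw [hζ, smul_inv_smul₀ h0]
  have hX : gradXi (princSymbol G) x ξ = ‖ξ‖ • gradXi (princSymbol G) x ζ := by
    conv_lhs => rw [hξζ, gradXi_princSymbol_smul]
  have hY : gradX (princSymbol G) x ξ = ‖ξ‖ ^ 2 • gradX (princSymbol G) x ζ := by
    conv_lhs => rw [hξζ, gradX_princSymbol_smul hG]
  rw [hamVF, real_inner_comm, real_inner_comm (gradXi (fun x ξ => escapeSymbol K s Ψ (t, x, ξ)) x ξ),
    inner_gradX_escapeSymbol hΨ t x hξ, inner_gradXi_escapeSymbol hΨ t x hξ, cosphereField,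
    ← hζ, hX, hY]
  simp only [unitRetraction_of_norm_le hζ1.le]
  set X := gradXi (princSymbol G) x ζ
  set Y := gradX (princSymbol G) x ζ
  set p := (t, x, ζ)
  have e1 : ((0 : ℝ), ‖ξ‖ • X, (0 : Eu d)) = ‖ξ‖ • ((0 : ℝ), X, (0 : Eu d)) := by simp
  have e2 : ((0 : ℝ), (0 : Eu d), ‖ξ‖⁻¹ • (‖ξ‖ ^ 2 • Y - (inner ℝ ζ (‖ξ‖ ^ 2 • Y) : ℝ) • ζ)) =
      ‖ξ‖ • ((0 : ℝ), (0 : Eu d), Y - (inner ℝ Y ζ : ℝ) • ζ) := by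
    rw [real_inner_smul_right, mul_smul, ← smul_sub, smul_smul, real_inner_comm]
    simp only [Prod.smul_mk, smul_zero]
    congr 3
    field_simp
  have e3 : ((0 : ℝ), X, -Y + (inner ℝ Y ζ : ℝ) • ζ) =
      ((0 : ℝ), X, (0 : Eu d)) - ((0 : ℝ), (0 : Eu d), Y - (inner ℝ Y ζ : ℝ) • ζ) := by
    simp [neg_add_eq_sub]
  rw [e1, e2, e3, map_smul, map_smul, map_sub]
  simp only [smul_eq_mul]
  ring

/-- Both gradients contain the factor G' that also appears in -H_a q, so the comparison holds even
where G' degenerates. The constant is 1 for x plus 2 for ξ, where the tangential projection is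
estimated by 2. -/
theorem norm_grad_escapeSymbol_le (hΨ : ContDiff ℝ ∞ Ψ) {ℓ : ℝ} (hℓ0 : 0 ≤ ℓ) (hK : 0 ≤ K)
    (hℓ : ∀ p v, |fderiv ℝ Ψ p (0, v)| ≤ ℓ * ‖v‖) (t : ℝ) (x : Eu d) {ξ : Eu d} (hξ : ξ ≠ 0) :
    ‖gradX (fun x ξ => escapeSymbol K s Ψ (t, x, ξ)) x ξ‖ +
      ‖ξ‖ * ‖gradXi (fun x ξ => escapeSymbol K s Ψ (t, x, ξ)) x ξ‖ ≤
        3 * ℓ * deriv (expProfile K) (s - Ψ (t, x, ‖ξ‖⁻¹ • ξ)) := by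
  have h0 : 0 < ‖ξ‖ := norm_pos_iff.2 hξ
  set G' := deriv (expProfile K) (s - Ψ (t, x, ‖ξ‖⁻¹ • ξ)) with hG'
  have hG0 : 0 ≤ G' :=
    (mul_nonneg hK (expProfile_nonneg _ _)).trans (exp_le_expProfile_deriv _)
  have h1 : ‖gradX (fun x ξ => escapeSymbol K s Ψ (t, x, ξ)) x ξ‖ ≤ ℓ * G' := by
    refine norm_le_of_forall_inner_le (by positivity) fun v => ?_
    rw [inner_gradX_escapeSymbol hΨ t x hξ, ← hG']
    have h2 := (abs_le.1 (hℓ (t, x, ‖ξ‖⁻¹ • ξ) (v, 0))).1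
    rw [Prod.norm_mk, norm_zero, max_eq_left (norm_nonneg v)] at h2
    nlinarith
  have h2 : ‖gradXi (fun x ξ => escapeSymbol K s Ψ (t, x, ξ)) x ξ‖ ≤ 2 * ℓ * G' * ‖ξ‖⁻¹ := by
    refine norm_le_of_forall_inner_le (by positivity) fun v => ?_
    rw [inner_gradXi_escapeSymbol hΨ t x hξ, ← hG']
    set ζ := ‖ξ‖⁻¹ • ξ with hζ
    have hζ1 : ‖ζ‖ = 1 := by
      rw [hζ, norm_smul, norm_inv, norm_norm, inv_mul_cancel₀ (norm_ne_zero_iff.2 hξ)]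
    have h2 := (abs_le.1 (hℓ (t, x, ζ) (0, ‖ξ‖⁻¹ • (v - (inner ℝ ζ v : ℝ) • ζ)))).1
    rw [Prod.norm_mk, norm_zero, max_eq_right (norm_nonneg _), norm_smul, norm_inv, norm_norm] at h2
    have h3 : ‖v - (inner ℝ ζ v : ℝ) • ζ‖ ≤ 2 * ‖v‖ := by
      have := norm_neg_add_inner_smul_le (y := v) hζ1
      rwa [neg_add_eq_sub, norm_sub_rev, real_inner_comm] at this
    have h4 : ‖ξ‖⁻¹ * ‖v - (inner ℝ ζ v : ℝ) • ζ‖ ≤ ‖ξ‖⁻¹ * (2 * ‖v‖) :=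
      mul_le_mul_of_nonneg_left h3 (by positivity)
    have h5 := mul_le_mul_of_nonneg_left h4 hℓ0
    calc _ = G' * -(fderiv ℝ Ψ (t, x, ζ)) (0, 0, ‖ξ‖⁻¹ • (v - (inner ℝ ζ v : ℝ) • ζ)) := by ring
      _ ≤ G' * (ℓ * (‖ξ‖⁻¹ * (2 * ‖v‖))) := mul_le_mul_of_nonneg_left (by linarith) hG0
      _ = _ := by ring
  have h3 : ‖ξ‖ * ‖gradXi (fun x ξ => escapeSymbol K s Ψ (t, x, ξ)) x ξ‖ ≤ 2 * ℓ * G' := by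
    refine (mul_le_mul_of_nonneg_left h2 h0.le).trans (le_of_eq ?_)
    field_simp
  linarith

end EscapeSymbol

/-! ### Exponential bounds in the size parameters -/

/-- `f(M,L)` is at most exponential in `ML` for `M, L ≥ 1`. -/
def ExpGrowth (f : ℝ → ℝ → ℝ) : Prop :=
  ∃ α, 0 ≤ α ∧ ∀ M L, 1 ≤ M → 1 ≤ L → |f M L| ≤ Real.exp (α * M * L)

theorem expGrowth_exp {α : ℝ} {f : ℝ → ℝ → ℝ} (hα : 0 ≤ α)
    (hf : ∀ M L, 1 ≤ M → 1 ≤ L → f M L ≤ α * M * L) : ExpGrowth fun M L => Real.exp (f M L) :=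
  ⟨α, hα, fun M L hM hL => by
    rw [abs_of_pos (Real.exp_pos _)]
    exact Real.exp_le_exp.2 (hf M L hM hL)⟩

theorem ExpGrowth.of_abs_le {α : ℝ} {f : ℝ → ℝ → ℝ} (hα : 0 ≤ α)
    (hf : ∀ M L, 1 ≤ M → 1 ≤ L → |f M L| ≤ α * M * L) : ExpGrowth f :=
  ⟨α, hα, fun M L hM hL => (hf M L hM hL).trans (by linarith [Real.add_one_le_exp (α * M * L)])⟩

theorem expGrowth_const (c : ℝ) : ExpGrowth fun _ _ => c :=
  .of_abs_le (abs_nonneg c) fun M L hM hL => by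
    rw [mul_assoc]
    exact le_mul_of_one_le_right (abs_nonneg c) (one_le_mul_of_one_le_of_one_le hM hL)

theorem expGrowth_fst : ExpGrowth fun M _ => M :=
  .of_abs_le zero_le_one fun M L hM hL => by
    rw [abs_of_nonneg (by linarith), one_mul]
    exact le_mul_of_one_le_right (by linarith) hL

theorem expGrowth_snd : ExpGrowth fun _ L => L :=
  .of_abs_le zero_le_one fun M L hM hL => by
    rw [abs_of_nonneg (by linarith), one_mul]
    exact le_mul_of_one_le_left (by linarith) hM

theorem ExpGrowth.mul {f g : ℝ → ℝ → ℝ} (hf : ExpGrowth f) (hg : ExpGrowth g) :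
    ExpGrowth fun M L => f M L * g M L := by
  obtain ⟨α, hα, hf⟩ := hf
  obtain ⟨β, hβ, hg⟩ := hg
  refine ⟨α + β, by positivity, fun M L hM hL => ?_⟩
  rw [abs_mul, add_mul, add_mul, Real.exp_add]
  exact mul_le_mul (hf M L hM hL) (hg M L hM hL) (abs_nonneg _) (Real.exp_pos _).le

theorem ExpGrowth.add {f g : ℝ → ℝ → ℝ} (hf : ExpGrowth f) (hg : ExpGrowth g) :
    ExpGrowth fun M L => f M L + g M L := by
  obtain ⟨γ, hγ, h2⟩ := expGrowth_const 2
  obtain ⟨α, hα, hf⟩ := hf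
  obtain ⟨β, hβ, hg⟩ := hg
  refine ⟨γ + (α + β), by positivity, fun M L hM hL => ?_⟩
  have e1 := hf M L hM hL
  have e2 := hg M L hM hL
  have e3 := h2 M L hM hL
  have e4 : 1 ≤ Real.exp (α * M * L) := Real.one_le_exp (by positivity)
  have e5 : 1 ≤ Real.exp (β * M * L) := Real.one_le_exp (by positivity)
  rw [abs_of_pos two_pos] at e3
  rw [add_mul, add_mul, add_mul, add_mul, Real.exp_add, Real.exp_add]
  refine (abs_add_le _ _).trans (le_trans ?_ (mul_le_mul_of_nonneg_right e3 (by positivity)))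
  nlinarith

theorem ExpGrowth.pow {f : ℝ → ℝ → ℝ} (hf : ExpGrowth f) (n : ℕ) :
    ExpGrowth fun M L => f M L ^ n := by
  induction n with
  | zero => simpa using expGrowth_const 1
  | succ n ih => simpa only [pow_succ] using ih.mul hf

/-! ### The fields of an admissible metric -/

theorem HamiltonBounds.mono {E : Type*} [NormedAddCommGroup E] [InnerProductSpace ℝ E]
    {X Y : E → E → E} {Λ Λ' c η η' R : ℝ} (h : HamiltonBounds X Y Λ c η R) (hΛ : Λ ≤ Λ')
    (hη : η ≤ η') : HamiltonBounds X Y Λ' c η' R where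
  lip_X x x' ξ ξ' h1 h2 :=
    (h.lip_X x x' ξ ξ' h1 h2).trans (mul_le_mul_of_nonneg_right hΛ (by positivity))
  lip_Y x x' ξ ξ' h1 h2 :=
    (h.lip_Y x x' ξ ξ' h1 h2).trans (mul_le_mul_of_nonneg_right hΛ (by positivity))
  norm_X_le x ξ h1 := (h.norm_X_le x ξ h1).trans hΛ
  norm_Y_le x ξ h1 := (h.norm_Y_le x ξ h1).trans hΛ
  inner_X := h.inner_X
  X_neg := h.X_neg
  Y_neg := h.Y_neg
  exterior x ξ h1 h2 := (h.exterior x ξ h1 h2).trans hη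
  curve γ ζ a b h1 h2 h3 h4 :=
    (h.curve γ ζ a b h1 h2 h3 h4).trans (ENNReal.ofReal_le_ofReal hη)

theorem norm_cosphereField_sub_le {E : Type*} [NormedAddCommGroup E] [InnerProductSpace ℝ E]
    {X Y X' Y' : E → E → E} {z : E × E} {B : ℝ}
    (hX : ‖X z.1 (unitRetraction z.2) - X' z.1 (unitRetraction z.2)‖ ≤ 2 * B)
    (hY : ‖Y z.1 (unitRetraction z.2) - Y' z.1 (unitRetraction z.2)‖ ≤ B) :
    ‖cosphereField X Y z - cosphereField X' Y' z‖ ≤ 2 * B := by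
  have hp := norm_unitRetraction_le z.2
  rw [cosphereField, cosphereField, Prod.mk_sub_mk, Prod.norm_mk]
  refine max_le hX ?_
  set p := unitRetraction z.2
  set y := Y z.1 p
  set y' := Y' z.1 p
  have hB : 0 ≤ B := (norm_nonneg _).trans hY
  have e : -y + (inner ℝ y p : ℝ) • p - (-y' + (inner ℝ y' p : ℝ) • p) =
      -(y - y') + (inner ℝ (y - y') p : ℝ) • p := by
    rw [inner_sub_left, sub_smul]
    abel
  rw [e]
  refine (norm_add_le _ _).trans ?_
  rw [norm_neg, norm_smul, two_mul]
  refine add_le_add hY ?_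
  have h1 : ‖(inner ℝ (y - y') p : ℝ)‖ ≤ B * 1 :=
    (norm_inner_le_norm _ _).trans (mul_le_mul hY hp (norm_nonneg _) hB)
  calc _ ≤ B * 1 * 1 := mul_le_mul h1 hp (norm_nonneg _) (by linarith)
    _ = B := by ring

/-- The projected Hamilton field of the metric at time `t`. -/
def metricField {d : ℕ} (g : MatField d) (t : ℝ) : Eu d × Eu d → Eu d × Eu d :=
  cosphereField (gradXi (princSymbol (g t))) (gradX (princSymbol (g t)))

theorem exists_metricField_bounds {d : ℕ} (P : LPData d) {s₀ : ℝ} (hs₀ : (d : ℝ) / 2 + 2 < s₀) :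
    ∃ ε > (0 : ℝ), ∃ lam : ℝ, 1 ≤ lam ∧ ∀ (c₀ T M R L : ℝ) (g gt : MatField d), 1 ≤ M →
      IsAdmissibleMetric P s₀ c₀ ε T M R L g gt →
      (∀ t ∈ Icc 0 T, HamiltonBounds (gradXi (princSymbol (g t))) (gradX (princSymbol (g t)))
        (lam * M) c₀ (1 / 100) R) ∧
      (∀ t ∈ Icc 0 T, ∀ i k x, DifferentiableAt ℝ (fun x => g t x i k) x) ∧
      ∀ t ∈ Icc 0 T, ∀ r ∈ Icc 0 T, |t - r| ≤ 1 → ∀ z,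
        ‖metricField g t z - metricField g r z‖ ≤ lam * M * √|t - r| := by
  obtain ⟨C, hC, h⟩ := exists_metric_bounds P hs₀
  -- With this ε the exterior constant 2d²Cε is at most 1/100, the threshold in the bootstrap; d² +
  -- 1 keeps the denominator positive for every d.
  have hε : 0 < 1 / (200 * ((d : ℝ) ^ 2 + 1) * C) := by positivity
  refine ⟨1 / (200 * ((d : ℝ) ^ 2 + 1) * C), hε, 4 * ((d : ℝ) ^ 2 + 1) * C,
    by nlinarith [sq_nonneg (d : ℝ)], fun c₀ T M R L g gt hM hg => ?_⟩
  obtain ⟨h1, h2, h3⟩ := h c₀ _ T M R L g gt hε hM hg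
  have hCM : 1 ≤ C * M := one_le_mul_of_one_le_of_one_le hC hM
  have hdiff : ∀ t ∈ Icc 0 T, ∀ i k x, DifferentiableAt ℝ (fun x => g t x i k) x :=
    fun t ht i k x => EntryBounds.differentiableAt (h1 t ht) i k x
  refine ⟨fun t ht => ?_, hdiff, fun t ht r hr htr z => ?_⟩
  · refine (hamiltonBounds_of_entryBounds hCM (by positivity) (h1 t ht)
      (hg.elliptic_lower t ht)).mono (by nlinarith) ?_
    have : 2 * (d : ℝ) ^ 2 * (C * (1 / (200 * ((d : ℝ) ^ 2 + 1) * C))) =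
        (d : ℝ) ^ 2 / ((d : ℝ) ^ 2 + 1) * (1 / 100) := by
      field_simp
      ring
    rw [this]
    refine mul_le_of_le_one_left (by norm_num) ?_
    rw [div_le_one (by positivity)]
    linarith
  · have hs : |t - r| ≤ √|t - r| := by
      refine Real.le_sqrt_of_sq_le ?_
      nlinarith [abs_nonneg (t - r)]
    have hp := norm_unitRetraction_le z.2
    have hB0 : 0 ≤ C * M * √|t - r| := by positivity
    have hX := norm_gradXi_sub_le (x := z.1) (ξ := unitRetraction z.2) (fun i k =>
      (h2 t ht r hr i k z.1).trans (mul_le_mul_of_nonneg_left hs (by positivity))) hB0 hp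
    have hY := norm_gradX_sub_le (x := z.1) (ξ := unitRetraction z.2)
      (fun i k => hdiff t ht i k z.1) (fun i k => hdiff r hr i k z.1)
      (fun i k => h3 t ht r hr i k z.1) hB0 hp
    refine (norm_cosphereField_sub_le (hX.trans (le_of_eq (mul_assoc _ _ _))) hY).trans ?_
    nlinarith [sq_nonneg (d : ℝ)]

/-! ### The escape symbol of an admissible metric -/

/-- With τ = τ₀L and Λ = lam·M the Lipschitz constant contains exp(12ΛT₀) with T₀ = τ₀L, which is
exponential in ML; all other factors are powers of M, L and this constant. -/
theorem exists_isSmoothEscape_metricField {d : ℕ} (P : LPData d) {s₀ c₀ : ℝ}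
    (hs₀ : (d : ℝ) / 2 + 2 < s₀) (hc₀ : 0 < c₀) :
    ∃ ε > (0 : ℝ), ∃ τ₀ : ℝ, 1 ≤ τ₀ ∧ ∃ ℓ : ℝ → ℝ → ℝ, ExpGrowth ℓ ∧ ∃ D : ℕ → ℝ → ℝ → ℝ,
      (∀ N, ExpGrowth (D N)) ∧ ∀ (T M R L : ℝ) (g gt : MatField d), 0 < T → 1 ≤ M → 1 ≤ R → R ≤ L →
        IsAdmissibleMetric P s₀ c₀ ε T M R L g gt → 0 ≤ ℓ M L ∧ (∀ N, 1 ≤ D N M L) ∧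
          (∀ t ∈ Icc 0 T, ∀ i k x, DifferentiableAt ℝ (fun x => g t x i k) x) ∧
          ∃ Ψ, IsSmoothEscape (metricField g) Ψ T R (τ₀ * L) (ℓ M L) ∧
            ∀ N n, 1 ≤ n → n ≤ N → ∀ p, ‖iteratedFDeriv ℝ n Ψ p‖ ≤ D N M L ^ n := by
  obtain ⟨ε, hε, lam, hlam, hfield⟩ := exists_metricField_bounds P hs₀
  obtain ⟨B, hB0, hB⟩ := exists_isSmoothEscape d
  -- Since 1 ≤ R ≤ L, one has 600R + L/(2c₀) + 1 ≤ τ₀L.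
  set τ₀ : ℝ := 601 + 1 / (2 * c₀) with hτ₀
  have hc0' : 0 < 1 / (2 * c₀) := by positivity
  have hτ₀1 : 1 ≤ τ₀ := by linarith
  set S : ℝ → ℝ := fun L => τ₀ * L * (τ₀ * L + 5) with hS
  set ℓ : ℝ → ℝ → ℝ := fun M L => 405 * (τ₀ * L) * (τ₀ * L + 5) *
    Real.exp (12 * (lam * M) * (τ₀ * L)) with hℓ
  have hτg : ExpGrowth fun _ L => τ₀ * L := (expGrowth_const τ₀).mul expGrowth_snd
  have hτg5 : ExpGrowth fun _ L => τ₀ * L + 5 := hτg.add (expGrowth_const 5)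
  have hℓg : ExpGrowth ℓ := (((expGrowth_const 405).mul hτg).mul hτg5).mul
    (expGrowth_exp (α := 12 * lam * τ₀) (by positivity) fun M L _ _ => le_of_eq (by ring))
  refine ⟨ε, hε, τ₀, hτ₀1, ℓ, hℓg, fun N M L => (28 * (lam * M) * ℓ M L) ^ 2 *
    ((1 + ∑ i ∈ Finset.range (N + 1), B i) * (τ₀ * L * (τ₀ * L + 5))), fun N => ?_, ?_⟩
  · exact ((((expGrowth_const 28).mul ((expGrowth_const lam).mul expGrowth_fst)).mul hℓg).pow
      2).mul ((expGrowth_const _).mul (hτg.mul hτg5))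
  intro T M R L g gt hT hM hR hRL hg
  obtain ⟨hH, hdiff, htime⟩ := hfield c₀ T M R L g gt hM hg
  have hL : 1 ≤ L := hR.trans hRL
  have hΛ : 1 ≤ lam * M := one_le_mul_of_one_le_of_one_le hlam hM
  have hτ1 : 1 ≤ τ₀ * L := one_le_mul_of_one_le_of_one_le hτ₀1 hL
  have hS1 : 1 ≤ τ₀ * L * (τ₀ * L + 5) := one_le_mul_of_one_le_of_one_le hτ1 (by linarith)
  have hℓ1 : 1 ≤ ℓ M L := by
    refine one_le_mul_of_one_le_of_one_le ?_ (Real.one_le_exp (by positivity))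
    nlinarith
  have hm1 : 1 ≤ (28 * (lam * M) * ℓ M L) ^ 2 :=
    one_le_pow₀ (one_le_mul_of_one_le_of_one_le (by linarith) hℓ1)
  have hsum : ∀ N, 0 ≤ ∑ i ∈ Finset.range (N + 1), B i := fun N =>
    Finset.sum_nonneg fun i _ => hB0 i
  have hfac : ∀ N, 1 ≤ (1 + ∑ i ∈ Finset.range (N + 1), B i) * (τ₀ * L * (τ₀ * L + 5)) := fun N =>
    one_le_mul_of_one_le_of_one_le (by linarith [hsum N]) hS1
  refine ⟨by linarith, fun N => one_le_mul_of_one_le_of_one_le hm1 (hfac N), hdiff, ?_⟩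
  have hψ : ∀ t, ∃ ψ : Eu d × Eu d → ℝ, t ∈ Icc 0 T →
      IsEscapeFunction (metricField g t) ψ R (τ₀ * L) (lam * M) := fun t => by
    by_cases ht : t ∈ Icc 0 T
    · obtain ⟨ψ, hψ⟩ := (hH t ht).exists_isEscapeFunction le_rfl hΛ hR hc₀ (by linarith)
        (fun x ξ hx => hg.length_le t ht x ξ ⟨hx.unit, hx.deriv_x, hx.deriv_xi⟩) (τ := τ₀ * L) (by
          have : L / (2 * c₀) = 1 / (2 * c₀) * L := by ring
          rw [this, hτ₀]
          linarith)
      exact ⟨ψ, fun _ => hψ⟩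
    · exact ⟨0, fun h => absurd h ht⟩
  choose ψ hψ using hψ
  obtain ⟨Ψ, hΨ, hΨB⟩ := hB (metricField g) ψ T R (τ₀ * L) (lam * M) (ℓ M L) hT.le hR hτ1 hΛ rfl hψ
    (fun t ht z w => by
      have := (hH t ht).lipschitzWith_cosphereField.dist_le_mul z w
      rwa [Real.coe_toNNReal _ (by positivity), dist_eq_norm, dist_eq_norm] at this)
    htime
  refine ⟨Ψ, hΨ, fun N n hn hnN p => (hΨB n p).trans ?_⟩
  have hBn : B n ≤ ∑ i ∈ Finset.range (N + 1), B i :=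
    Finset.single_le_sum (f := B) (fun i _ => hB0 i) (Finset.mem_range.2 (by omega))
  have h1 : B n * (τ₀ * L * (τ₀ * L + 5)) ≤
      (1 + ∑ i ∈ Finset.range (N + 1), B i) * (τ₀ * L * (τ₀ * L + 5)) :=
    mul_le_mul_of_nonneg_right (by linarith) (by linarith)
  -- For n ≥ 1 a factor that is at least 1 is dominated by its n-th power. This gives the geometric
  -- form D^n required by the chain rule of higher order.
  have h2 := le_self_pow₀ (hfac N) (n := n) (by omega)
  simp only [mul_pow _ _ n]
  exact mul_le_mul_of_nonneg_left (h1.trans (by simpa only [mul_pow _ _ n] using h2))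
    (by positivity)

/-! ### Support, positive commutator and gradient bound of the symbol -/

section Commutator

variable {d : ℕ} {T R τ ℓ : ℝ} {Ψ : ℝ × Eu d × Eu d → ℝ}

theorem norm_inv_norm_smul {E : Type*} [NormedAddCommGroup E] [NormedSpace ℝ E] {ξ : E}
    (hξ : ξ ≠ 0) : ‖‖ξ‖⁻¹ • ξ‖ = 1 := by
  rw [norm_smul, norm_inv, norm_norm, inv_mul_cancel₀ (norm_ne_zero_iff.2 hξ)]

theorem escapeSymbol_smul (K s : ℝ) (Ψ : ℝ × Eu d × Eu d → ℝ) (t : ℝ) (x ξ : Eu d) {r : ℝ}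
    (hr : 0 < r) : escapeSymbol K s Ψ (t, x, r • ξ) = escapeSymbol K s Ψ (t, x, ξ) := by
  rw [escapeSymbol, escapeSymbol, sphereProj, sphereProj]
  simp only
  rw [norm_smul, Real.norm_of_nonneg hr.le, smul_smul, mul_inv, mul_right_comm,
    inv_mul_cancel₀ hr.ne', one_mul]

/-- The conditions |x| > 49R and cosine > -51/100 are open and slightly weaker than those to be
excluded. A point of the closure that violates the claim would have points of S nearby that satisfy
them; there Ψ ≥ τ + 7/2 exceeds τ + 3 and the symbol vanishes. -/
theorem IsSmoothEscape.inner_div_lt {V : ℝ → Eu d × Eu d → Eu d × Eu d}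
    (hΨ : IsSmoothEscape V Ψ T R τ ℓ) (hR : 0 < R) (K : ℝ) {S : Set (ℝ × Eu d × Eu d)}
    (hS : ∀ p ∈ S, ‖p.2.1‖ ≤ 100 * R ∧ p.2.2 ≠ 0 ∧ escapeSymbol K (τ + 3) Ψ p ≠ 0)
    {t : ℝ} {x ξ : Eu d} (hcl : (t, x, ξ) ∈ closure S) (hx : 50 * R < ‖x‖) (hξ : ξ ≠ 0) :
    inner ℝ x ξ / (‖x‖ * ‖ξ‖) < -(1 / 2 : ℝ) := by
  have hx0 : 0 < ‖x‖ := by linarith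
  have hξ0 : 0 < ‖ξ‖ := norm_pos_iff.2 hξ
  have hxξ := mul_pos hx0 hξ0
  rw [div_lt_iff₀ hxξ]
  by_contra! hcos
  have hO₁ : IsOpen {p : ℝ × Eu d × Eu d | 49 * R < ‖p.2.1‖} :=
    isOpen_lt continuous_const (by fun_prop)
  have hO₂ : IsOpen {p : ℝ × Eu d × Eu d |
      -(51 / 100 * (‖p.2.1‖ * ‖p.2.2‖)) < inner ℝ p.2.1 p.2.2} :=
    isOpen_lt (by fun_prop) (by fun_prop)
  obtain ⟨⟨t', x', ξ'⟩, ⟨h1, h2⟩, hpS⟩ := mem_closure_iff.1 hcl _ (hO₁.inter hO₂)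
    ⟨by change 49 * R < ‖x‖; linarith, by
      change -(51 / 100 * (‖x‖ * ‖ξ‖)) < inner ℝ x ξ
      linarith⟩
  obtain ⟨h4, h5, h6⟩ := hS _ hpS
  change 49 * R < ‖x'‖ at h1
  change -(51 / 100 * (‖x'‖ * ‖ξ'‖)) < inner ℝ x' ξ' at h2
  simp only at h4 h5
  refine h6 (expProfile_of_nonpos K ?_)
  have := hΨ.ge_outgoing t' (x', ‖ξ'‖⁻¹ • ξ') (norm_inv_norm_smul h5) h1.le
    (by simp only; linarith) (by
      simp only
      rw [real_inner_smul_right, le_inv_mul_iff₀ (norm_pos_iff.2 h5)]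
      linarith)
  rw [sphereProj]
  linarith

/-- Everything follows from -H_a q ≥ G'|ξ|/2. The first bound uses G' ≥ KG. In B_{2R} the argument
of G is at least 5/2, so G ≥ 1 and G' ≥ K ≥ 2. The gradient is at most 3ℓG'. -/
theorem IsSmoothEscape.commutator_bounds {g : MatField d}
    (hΨ : IsSmoothEscape (metricField g) Ψ T R τ ℓ) (hR : 0 < R) (hℓ0 : 0 ≤ ℓ) {K : ℝ} (hK : 2 ≤ K)
    {t : ℝ} (ht : t ∈ Icc 0 T) {x ξ : Eu d} (hG : ∀ i k, DifferentiableAt ℝ (fun x => g t x i k) x)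
    (hx : ‖x‖ ≤ 100 * R) (hξ : ξ ≠ 0) {q : ℝ → Eu d → Eu d → ℝ}
    (hq : q = fun t x ξ => escapeSymbol K (τ + 3) Ψ (t, x, ξ)) :
    K * ‖ξ‖ * q t x ξ ≤ 2 * -hamVF (princSymbol (g t)) (q t) x ξ ∧
      (‖x‖ < 2 * R → ‖ξ‖ ≤ -hamVF (princSymbol (g t)) (q t) x ξ) ∧
      ‖ξ‖ * (‖gradX (q t) x ξ‖ + ‖ξ‖ * ‖gradXi (q t) x ξ‖) ≤
        6 * ℓ * -hamVF (princSymbol (g t)) (q t) x ξ := by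
  have hξ0 : 0 < ‖ξ‖ := norm_pos_iff.2 hξ
  have hham := neg_hamVF_escapeSymbol (K := K) (s := τ + 3) hΨ.smooth t hG hξ
  have hinc := hΨ.incr t ht (x, ‖ξ‖⁻¹ • ξ) (norm_inv_norm_smul hξ) (by simp only; linarith)
  have hgrad := norm_grad_escapeSymbol_le (K := K) (s := τ + 3) hΨ.smooth hℓ0
    (by linarith) hΨ.abs_fderiv_le t x hξ
  have hin := hΨ.le_inner t (x, ‖ξ‖⁻¹ • ξ) (norm_inv_norm_smul hξ)
  have hval : q t x ξ = expProfile K (τ + 3 - Ψ (t, x, ‖ξ‖⁻¹ • ξ)) := by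
    rw [hq]
    rfl
  have hqt : q t = fun x ξ => escapeSymbol K (τ + 3) Ψ (t, x, ξ) := by rw [hq]
  rw [metricField] at hinc
  rw [← hqt] at hham hgrad
  rw [hval]
  set u := τ + 3 - Ψ (t, x, ‖ξ‖⁻¹ • ξ) with hu
  have hG' := exp_le_expProfile_deriv (K := K) u
  have hKq := mul_nonneg (by linarith : 0 ≤ K) (expProfile_nonneg K u)
  have hlow : deriv (expProfile K) u * ‖ξ‖ ≤ 2 * -hamVF (princSymbol (g t)) (q t) x ξ := by
    rw [hham]
    have := mul_le_mul_of_nonneg_left hinc (mul_nonneg (hKq.trans hG') hξ0.le)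
    linarith
  refine ⟨?_, fun hx2 => ?_, ?_⟩
  · have := mul_le_mul_of_nonneg_right hG' hξ0.le
    linarith
  · have h1 := hin hx2
    have h2 : 1 ≤ expProfile K u := by
      rw [expProfile, Real.smoothTransition.one_of_one_le (by linarith), mul_one]
      exact Real.one_le_exp (mul_nonneg (by linarith) (by linarith))
    have h3 : 2 ≤ deriv (expProfile K) u := by
      refine le_trans ?_ hG'
      nlinarith
    have h4 := mul_le_mul_of_nonneg_right h3 hξ0.le
    linarith
  · have h2 := mul_le_mul_of_nonneg_left hgrad hξ0.le
    have h5 := mul_le_mul_of_nonneg_left hlow (mul_nonneg (by norm_num : (0 : ℝ) ≤ 3) hℓ0)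
    linarith

end Commutator

end

/-! ### Choice of the constants and conclusion -/

theorem mainTheorem7 (d : ℕ) (P : LPData d) (s₀ c₀ : ℝ) (hs₀ : (d : ℝ) / 2 + 2 < s₀)
    (hc₀ : 0 < c₀) :
    -- the universal constants in the assumptions
    ∃ ε > (0 : ℝ), ∃ κ > (0 : ℝ), ∃ R₀ > (0 : ℝ),
    ∀ C > (0 : ℝ),
    -- the constants in the exponentials
    ∃ (A : ℕ → ℕ → ℕ → ℝ) (C₁ : ℝ),
    ∀ (T M R L : ℝ) (g gt : MatField d),
      0 < T → 1 ≤ M → R₀ ≤ R → κ * Real.log M ≤ Real.log R → R ≤ L →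
      IsAdmissibleMetric P s₀ c₀ ε T M R L g gt →
      ∃ q : ℝ → Eu d → Eu d → ℝ,
        -- smooth, homogeneous of degree zero, nonnegative
        ContDiffOn ℝ ∞ (fun p : ℝ × Eu d × Eu d => q p.1 p.2.1 p.2.2) {p | p.2.2 ≠ 0} ∧
        (∀ t x ξ, ∀ r > (0 : ℝ), ξ ≠ 0 → q t x (r • ξ) = q t x ξ) ∧
        (∀ t x ξ, 0 ≤ q t x ξ) ∧
        -- support
        (∀ t x ξ, (t, x, ξ) ∈ closure {p : ℝ × Eu d × Eu d | p.1 ∈ Icc 0 T ∧ ‖p.2.1‖ ≤ 100 * R ∧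
            p.2.2 ≠ 0 ∧ q p.1 p.2.1 p.2.2 ≠ 0} → 50 * R < ‖x‖ → ξ ≠ 0 →
          inner ℝ x ξ / (‖x‖ * ‖ξ‖) < -(1 / 2 : ℝ)) ∧
        -- the bounds in the region `|x| ≤ 100 R`
        ∀ t ∈ Icc 0 T, ∀ x ξ : Eu d, ‖x‖ ≤ 100 * R → ξ ≠ 0 →
          (∀ j k l : ℕ, ‖mixedDeriv j k l q t x ξ‖ ≤ Real.exp (A j k l * M * L) * (‖ξ‖ ^ l)⁻¹) ∧
          C * M * ‖ξ‖ * q t x ξ ≤ -hamVF (princSymbol (g t)) (q t) x ξ ∧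
          (‖x‖ < 2 * R → ‖ξ‖ ≤ -hamVF (princSymbol (g t)) (q t) x ξ) ∧
          ‖ξ‖ * (‖gradX (q t) x ξ‖ + ‖ξ‖ * ‖gradXi (q t) x ξ‖) ≤
            Real.exp (C₁ * M * L) * -hamVF (princSymbol (g t)) (q t) x ξ := by
  obtain ⟨ε, hε, τ₀, hτ₀, ℓ, hℓ, D, hD, hmain⟩ := exists_isSmoothEscape_metricField P hs₀ hc₀
  -- Taking R₀ = 1 ensures R ≥ 1, hence also L ≥ 1.
  refine ⟨ε, hε, 1, one_pos, 1, one_pos, fun C hC => ?_⟩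
  choose B hB0 hB using exists_norm_iteratedFDeriv_escapeSymbol_le d
  -- The profile parameter is K = 2(C + 1)M. The factor 2 compensates the rate 1/2 of the mollified
  -- escape function, and the extra 2M guarantees K ≥ 2.
  have hKg : ExpGrowth fun M _ => 2 * (C + 1) * M := (expGrowth_const _).mul expGrowth_fst
  have hEg : ExpGrowth fun M L => Real.exp (2 * (C + 1) * M * (τ₀ * L + 3)) := by
    refine expGrowth_exp (α := 2 * (C + 1) * (τ₀ + 3)) (by positivity) fun M L hM hL => ?_
    have : 0 ≤ 2 * (C + 1) * M * (L - 1) * 3 :=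
      mul_nonneg (mul_nonneg (by positivity) (by linarith)) (by norm_num)
    linarith
  have hA : ∀ N, ∃ α, ∀ M L, 1 ≤ M → 1 ≤ L → B N * ((2 * (C + 1) * M) ^ N *
      Real.exp (2 * (C + 1) * M * (τ₀ * L + 3)) * D N M L ^ N) ≤ Real.exp (α * M * L) := fun N => by
    obtain ⟨α, -, hα⟩ := (expGrowth_const (B N)).mul (((hKg.pow N).mul hEg).mul ((hD N).pow N))
    exact ⟨α, fun M L hM hL => (le_abs_self _).trans (hα M L hM hL)⟩
  choose A hA using hA
  obtain ⟨C₁, -, hC₁⟩ := (expGrowth_const 6).mul hℓ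
  refine ⟨fun j k l => A (j + k + l), C₁, fun T M R L g gt hT hM hR _ hRL hg => ?_⟩
  have hL : 1 ≤ L := hR.trans hRL
  have hR0 : 0 < R := by linarith
  obtain ⟨hℓ0, hD1, hdiff, Ψ, hΨ, hΨD⟩ := hmain T M R L g gt hT hM hR hRL hg
  specialize hC₁ M L hM hL
  have hAN := fun N => hA N M L hM hL
  generalize hK : 2 * (C + 1) * M = K at hAN
  have hCM : 0 < C * M := by positivity
  have hK2 : 2 * (C * M) + 2 * M = K := by rw [← hK]; ring
  refine ⟨fun t x ξ => escapeSymbol K (τ₀ * L + 3) Ψ (t, x, ξ), contDiffOn_escapeSymbol K _ hΨ.smooth,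
    fun t x ξ r hr _ => escapeSymbol_smul K _ Ψ t x ξ hr, fun t x ξ => expProfile_nonneg _ _,
    fun t x ξ hcl hx hξ => hΨ.inner_div_lt hR0 K (fun p hp => hp.2) hcl hx hξ,
    fun t ht x ξ hx hξ => ?_⟩
  obtain ⟨h1, h2, h3⟩ := hΨ.commutator_bounds hR0 hℓ0 (K := K) (by linarith) ht
    (fun i k => hdiff t ht i k x) hx hξ rfl
  have hq0 : 0 ≤ escapeSymbol K (τ₀ * L + 3) Ψ (t, x, ξ) := expProfile_nonneg _ _
  have h4 : 0 ≤ K * ‖ξ‖ * escapeSymbol K (τ₀ * L + 3) Ψ (t, x, ξ) :=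
    mul_nonneg (mul_nonneg (by linarith) (norm_nonneg ξ)) hq0
  refine ⟨fun j k l => ?_, ?_, h2, ?_⟩
  · refine (norm_mixedDeriv_le (contDiffOn_escapeSymbol K _ hΨ.smooth)
      (fun t x ξ r hr => escapeSymbol_smul K _ Ψ t x ξ hr) j k l t x hξ).trans
      (mul_le_mul_of_nonneg_right ?_ (by positivity))
    change _ ≤ Real.exp (A (j + k + l) * M * L)
    generalize j + k + l = N
    have h5 := hB N K (τ₀ * L + 3) (D N M L) Ψ (by linarith) (hD1 N) hΨ.smooth hΨ.nonneg (hΨD N)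
      (t, x, ‖ξ‖⁻¹ • ξ) (norm_inv_norm_smul hξ)
    exact h5.trans (hAN N)
  · have h5 := mul_nonneg (mul_nonneg (by linarith : 0 ≤ M) (norm_nonneg ξ)) hq0
    set Q := escapeSymbol K (τ₀ * L + 3) Ψ (t, x, ξ) with hQ
    have e : K * ‖ξ‖ * Q = 2 * (C * M * ‖ξ‖ * Q) + 2 * (M * ‖ξ‖ * Q) := by
      rw [← hK2]
      ring
    change C * M * ‖ξ‖ * Q ≤ _
    linarith
  · exact h3.trans (mul_le_mul_of_nonneg_right ((le_abs_self _).trans hC₁) (by linarith))
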